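/- Consider four-dimensional Riemann–Cartan space-times $M$ (a connected coordinate domain in $\mathbb R^4\ni(t,x,y,z)$ with a smooth Lorentzian metric $g$ of signature $(+,-,-,-)$ and a smooth metric-compatible connection $\Gamma$) of the following Gödel type: there are smooth real functions $H(x)$, $D(x)\neq 0$, $S(z)$ such that, with $\omega^0=dt+H(x)\,dy$, $\omega^1=dx$, $\omega^2=D(x)\,dy$, $\omega^3=dz$, $$ds^2=(\omega^0)^2-(\omega^1)^2-(\omega^2)^2-(\omega^3)^2,$$ and the only nonvanishing frame component of the torsion $T^a{}_{bc}=\Gamma^a{}_{bc}-\Gamma^a{}_{cb}$ is $T^0{}_{12}=-T^0{}_{21}=S(z)$. A (local) affine isometry is a diffeomorphism between open sets that preserves both the metric and the connection. $M$ is locally space-time homogeneous if for all $p,q\in M$ there is an affine isometry from a neighbourhood of $p$ in $M$ onto a neighbourhood of $q$ in $M$ that takes $p$ to $q$. Let $M$ be a locally space-time homogeneous Riemann–Cartan space-time of this class. (1) There are real numbers $m^2$ (of either sign or zero), $\omega$, $S_0$ with $H'/D=2\omega$, $D''/D=m^2$ and $S=S_0$ on $M$, and $M$ admits a five-dimensional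 (local) group of affine-isometric motions acting transitively: there is a five-dimensional real vector space of smooth vector fields on $M$, closed under the Lie bracket and spanning the tangent space at every point, each of which generates a local one-parameter group of affine isometries. If $S_0\neq0$, every smooth vector field on $M$ that generates a local one-parameter group of affine isometries belongs to this space, so that the full group of motions is five-dimensional. (2) $M$ is characterized locally by the parameters $(m^2,\omega,S_0)$. If $M$ and $\widetilde M$ are two locally homogeneous space-times of the class with identical triads, then for all $p\in M$ and $\tilde p\in\widetilde M$ some neighbourhood of $p$ is mapped onto a neighbourhood of $\tilde p$ by an affine isometry taking $p$ to $\tilde p$. In general, $M$ and $\widetilde M$ with triads $(m^2,\omega,S_0)$ and $(\tilde m^2,\tilde\omega,\tilde S_0)$ have affinely isometric nonempty open subsets if and only if $m^2=\tilde m^2$ and $(\omega,S_0)=\pm(\tilde\omega,\tilde S_0)$. (3) The parameters are independent: every triad $(m^2,\omega,S_0)\in\mathbb R^3$ occurs for some locally homogeneous space-time of the class. -/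

import Mathlib

open scoped ContDiff

/-- The coordinate space; the coordinates are `(t, x, y, z) = (p 0, p 1, p 2, p 3)`. -/
abbrev CoordSpace : Type := Fin 4 → ℝ

/-- A four-dimensional Riemann-Cartan space-time, covered by one coordinate system: a domain of
`ℝ⁴` with a smooth Lorentzian metric of signature `(+,-,-,-)` and a smooth metric-compatible
(in general nonsymmetric) connection. The connection is given by its coefficients,
`∇_u V = DV(u) + Γ(u, V)`. -/
structure RCSpacetime where
  carrier : Set CoordSpace
  isOpen_carrier : IsOpen carrier
  isConnected_carrier : IsConnected carrier
  metric : CoordSpace → CoordSpace →L[ℝ] CoordSpace →L[ℝ] ℝ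
  conn : CoordSpace → CoordSpace →L[ℝ] CoordSpace →L[ℝ] CoordSpace
  contDiffOn_metric : ContDiffOn ℝ ∞ metric carrier
  contDiffOn_conn : ContDiffOn ℝ ∞ conn carrier
  metric_symm : ∀ p ∈ carrier, ∀ u v, metric p u v = metric p v u
  metric_lorentzian : ∀ p ∈ carrier, ∃ e : Module.Basis (Fin 4) ℝ CoordSpace,
    ∀ i j, metric p (e i) (e j) = Matrix.diagonal ![(1 : ℝ), -1, -1, -1] i j
  metric_compatible : ∀ p ∈ carrier, ∀ u v w,
    fderiv ℝ metric p u v w = metric p (conn p u v) w + metric p v (conn p u w)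

/-- The torsion `T(u, v) = ∇_u v - ∇_v u - [u, v]`. -/
noncomputable def RCSpacetime.torsion (M : RCSpacetime) (p u v : CoordSpace) : CoordSpace :=
  M.conn p u v - M.conn p v u

/-- The Lorentz coframe `ω⁰ = dt + H dy`, `ω¹ = dx`, `ω² = D dy`, `ω³ = dz`. -/
noncomputable def godelCoframe (H D : ℝ → ℝ) (p u : CoordSpace) : Fin 4 → ℝ :=
  ![u 0 + H (p 1) * u 2, u 1, D (p 1) * u 2, u 3]

/-- `M` is endowed with the Gödel-type metric `(ω⁰)² - (ω¹)² - (ω²)² - (ω³)²` and with a torsion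
whose only nonvanishing component in the above frame is `T⁰₁₂ = -T⁰₂₁ = S(z)`; here `∂_t` is the
vector dual to `ω⁰`. -/
structure IsGodelType (M : RCSpacetime) (H D S : ℝ → ℝ) : Prop where
  smooth_H : ContDiffOn ℝ ∞ H ((fun p : CoordSpace => p 1) '' M.carrier)
  smooth_D : ContDiffOn ℝ ∞ D ((fun p : CoordSpace => p 1) '' M.carrier)
  smooth_S : ContDiffOn ℝ ∞ S ((fun p : CoordSpace => p 3) '' M.carrier)
  D_ne_zero : ∀ p ∈ M.carrier, D (p 1) ≠ 0
  metric_eq : ∀ p ∈ M.carrier, ∀ u v, M.metric p u v =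
    godelCoframe H D p u 0 * godelCoframe H D p v 0
      - godelCoframe H D p u 1 * godelCoframe H D p v 1
      - godelCoframe H D p u 2 * godelCoframe H D p v 2
      - godelCoframe H D p u 3 * godelCoframe H D p v 3
  torsion_eq : ∀ p ∈ M.carrier, ∀ u v, M.torsion p u v =
    (S (p 3) * (godelCoframe H D p u 1 * godelCoframe H D p v 2
      - godelCoframe H D p v 1 * godelCoframe H D p u 2)) • (Pi.single 0 1 : CoordSpace)

/-- `H'/D = 2ω`, `D''/D = m²` and `S = S₀` on `M`; `m2` and `w` stand for `m²` (which may be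
negative) and `ω`. -/
structure HasParameters (M : RCSpacetime) (H D S : ℝ → ℝ) (m2 w S₀ : ℝ) : Prop where
  rotation : ∀ p ∈ M.carrier, deriv H (p 1) / D (p 1) = 2 * w
  curvature : ∀ p ∈ M.carrier, deriv (deriv D) (p 1) / D (p 1) = m2
  torsion : ∀ p ∈ M.carrier, S (p 3) = S₀

/-- `φ` is an affine isometry of the open subset `V` of `M` onto an open subset of `N`: it preserves
the metric and the connection. The differential of `φ` is injective because it preserves the
metric, so an injective such `φ` is a diffeomorphism onto its open image. -/
structure IsAffineIsometryOn (M N : RCSpacetime) (V : Set CoordSpace)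
    (φ : CoordSpace → CoordSpace) : Prop where
  isOpen_source : IsOpen V
  source_subset : V ⊆ M.carrier
  mapsTo : Set.MapsTo φ V N.carrier
  injOn : Set.InjOn φ V
  smooth : ContDiffOn ℝ ∞ φ V
  map_metric : ∀ p ∈ V, ∀ u v,
    N.metric (φ p) (fderiv ℝ φ p u) (fderiv ℝ φ p v) = M.metric p u v
  map_conn : ∀ p ∈ V, ∀ u v,
    fderiv ℝ (fderiv ℝ φ) p u v + N.conn (φ p) (fderiv ℝ φ p u) (fderiv ℝ φ p v)
      = fderiv ℝ φ p (M.conn p u v)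

/-- A neighbourhood of `p` in `M` is carried onto a neighbourhood of `q` in `N`, and `p` to `q`, by
an affine isometry. -/
def LocallyEquivalentAt (M N : RCSpacetime) (p q : CoordSpace) : Prop :=
  ∃ (V : Set CoordSpace) (φ : CoordSpace → CoordSpace),
    IsAffineIsometryOn M N V φ ∧ p ∈ V ∧ φ p = q

/-- Local space-time homogeneity: the local affine-isometric motions act transitively. -/
def LocallyHomogeneous (M : RCSpacetime) : Prop :=
  ∀ p ∈ M.carrier, ∀ q ∈ M.carrier, LocallyEquivalentAt M M p q

/-- The smooth vector field `X` on `M` (extended by `0` to `ℝ⁴`) generates a local one-parameter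
group of affine-isometric motions of `M`: its local flow consists of affine isometries. -/
structure IsMotionGenerator (M : RCSpacetime) (X : CoordSpace → CoordSpace) : Prop where
  smooth : ContDiffOn ℝ ∞ X M.carrier
  eq_zero : ∀ p, p ∉ M.carrier → X p = 0
  flow : ∀ p ∈ M.carrier, ∃ ε > (0 : ℝ), ∃ V : Set CoordSpace, p ∈ V ∧
    ∃ Φ : ℝ → CoordSpace → CoordSpace,
      ContDiffOn ℝ ∞ (Function.uncurry Φ) (Set.Ioo (-ε) ε ×ˢ V) ∧
      (∀ q ∈ V, Φ 0 q = q) ∧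
      (∀ s ∈ Set.Ioo (-ε) ε, ∀ q ∈ V, HasDerivAt (fun r => Φ r q) (X (Φ s q)) s) ∧
      ∀ s ∈ Set.Ioo (-ε) ε, IsAffineIsometryOn M M V (Φ s)

/-- `L` is the Lie algebra of an `r`-dimensional (local) group of affine-isometric motions of `M`:
an `r`-dimensional space of generators that is closed under the Lie bracket of vector fields. -/
structure IsMotionGroupAlgebra (M : RCSpacetime) (r : ℕ)
    (L : Submodule ℝ (CoordSpace → CoordSpace)) : Prop where
  finite : Module.Finite ℝ L
  finrank_eq : Module.finrank ℝ L = r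
  generator : ∀ X ∈ L, IsMotionGenerator M X
  lie_mem : ∀ X ∈ L, ∀ Y ∈ L, VectorField.lieBracket ℝ X Y ∈ L

/-! The geometry is assembled from the surface metric dx² + D² dy², the one-form ω⁰ with dω⁰ = H' dx
∧ dy, and the z-line. A metric-compatible connection is determined by the metric and the torsion, so
a local diffeomorphism preserving the metric and the tensor S (ω¹ ∧ ω²) ⊗ ∂_t preserves the
connection as well (`map_conn_of_map_torsion`).

Homogeneity makes the parameters constant (`exists_hasParameters`). Invariance of the torsion makes
S² constant, and S follows by continuity. Put P = H'/D − S₀ and l = D''/D − P H'/(2D). The Ricci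
tensor relative to the metric has a characteristic polynomial with the same coefficients at all
points, and l is one of its roots. A continuous function with finitely many values on a connected
set is constant, so l is constant, and then so are P², P, H'/D and D''/D.

Constant parameters determine the local geometry (`locallyEquivalentAt`). The surface has constant
curvature −m², hence is a piece of a standard quadric, and two such pieces are matched by charts.
The matching preserves ω¹ ∧ ω², and dω⁰ = 2ω ω¹ ∧ ω², so the defect of ω⁰ is closed and is removed
by a change of the time coordinate. Time reversal accounts for (ω, S₀) ↦ −(ω, S₀). Conversely, the
Ricci eigenvalues fix (2ω − S₀)² and l; when S₀ ≠ 0, the torsion and ∇∂_t fix the remaining relative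
sign (`parameters_eq_of_locallyEquivalentAt`).

The motions are the fields preserving ω⁰, ω³ and the surface metric. Such a field is given by its
value and one rotation number at a point, and these 4 + 1 data are arbitrary
(`initialData_bijective`). If S₀ ≠ 0, the torsion singles out ∂_t and ω¹ ∧ ω², so every affine
motion is of this kind (`isCoframeKilling_of_isMotionGenerator`). The models H = 2ω s, D = c realize
every triad. -/

/-! ### Trigonometry uniform in the sign of the curvature. -/

/-- Generalized trigonometric functions of curvature `k`: cosine `c`, sine `s` and versine `v`. -/
structure GenTrig (k : ℝ) (c s v : ℝ → ℝ) : Prop where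
  smooth_c : ContDiff ℝ ∞ c
  smooth_s : ContDiff ℝ ∞ s
  smooth_v : ContDiff ℝ ∞ v
  deriv_c : ∀ x, HasDerivAt c (-k * s x) x
  deriv_s : ∀ x, HasDerivAt s (c x) x
  deriv_v : ∀ x, HasDerivAt v (s x) x
  c_zero : c 0 = 1
  s_zero : s 0 = 0
  v_zero : v 0 = 0

theorem exists_genTrig (k : ℝ) : ∃ c s v, GenTrig k c s v := by
  rcases lt_trichotomy k 0 with hk | rfl | hk
  · obtain ⟨r, hr, rfl⟩ : ∃ r : ℝ, 0 < r ∧ k = -r ^ 2 :=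
      ⟨√(-k), by positivity [neg_pos.2 hk], by rw [Real.sq_sqrt (by linarith)]; ring⟩
    refine ⟨fun x => Real.cosh (r * x), fun x => Real.sinh (r * x) / r,
      fun x => (Real.cosh (r * x) - 1) / r ^ 2, ?_⟩
    have hm (x : ℝ) : HasDerivAt (fun x => r * x) r x := by simpa using (hasDerivAt_id x).const_mul r
    refine ⟨by fun_prop, by fun_prop, by fun_prop, fun x => ?_, fun x => ?_, fun x => ?_,
      by simp, by simp, by simp⟩
    · refine ((hm x).cosh).congr_deriv ?_; field_simp
    · refine ((hm x).sinh.div_const r).congr_deriv ?_; field_simp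
    · refine (((hm x).cosh.sub_const 1).div_const (r ^ 2)).congr_deriv ?_; field_simp
  · refine ⟨fun _ => 1, fun x => x, fun x => x ^ 2 / 2, ?_⟩
    refine ⟨by fun_prop, by fun_prop, by fun_prop, fun x => ?_, fun x => ?_, fun x => ?_,
      by simp, by simp, by simp⟩
    · simpa using hasDerivAt_const x (1 : ℝ)
    · exact hasDerivAt_id x
    · refine (((hasDerivAt_id x).pow 2).div_const 2).congr_deriv ?_; simp
  · obtain ⟨r, hr, rfl⟩ : ∃ r : ℝ, 0 < r ∧ k = r ^ 2 :=
      ⟨√k, by positivity, by rw [Real.sq_sqrt hk.le]⟩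
    refine ⟨fun x => Real.cos (r * x), fun x => Real.sin (r * x) / r,
      fun x => (1 - Real.cos (r * x)) / r ^ 2, ?_⟩
    have hm (x : ℝ) : HasDerivAt (fun x => r * x) r x := by simpa using (hasDerivAt_id x).const_mul r
    refine ⟨by fun_prop, by fun_prop, by fun_prop, fun x => ?_, fun x => ?_, fun x => ?_,
      by simp, by simp, by simp⟩
    · refine ((hm x).cos).congr_deriv ?_; field_simp
    · refine ((hm x).sin.div_const r).congr_deriv ?_; field_simp
    · refine (((hm x).cos.const_sub 1).div_const (r ^ 2)).congr_deriv ?_; field_simp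

namespace GenTrig

variable {k : ℝ} {c s v : ℝ → ℝ}

/-- The versine replaces the quotient (1 − c)/k, so that this identity and `s_sq` also serve the
case k = 0. -/
theorem c_eq (h : GenTrig k c s v) (x : ℝ) : c x = 1 - k * v x := by
  have hd (x : ℝ) : HasDerivAt (fun x => c x + k * v x) 0 x := by
    refine ((h.deriv_c x).add ((h.deriv_v x).const_mul k)).congr_deriv ?_; ring
  have := is_const_of_deriv_eq_zero (fun x => (hd x).differentiableAt) (fun x => (hd x).deriv) x 0
  simp only [h.c_zero, h.v_zero] at this
  linarith

theorem s_sq (h : GenTrig k c s v) (x : ℝ) : s x ^ 2 = 2 * v x - k * v x ^ 2 := by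
  have hd (x : ℝ) : HasDerivAt (fun x => s x ^ 2 - 2 * v x + k * v x ^ 2) 0 x := by
    refine ((((h.deriv_s x).pow 2).sub ((h.deriv_v x).const_mul 2)).add
      (((h.deriv_v x).pow 2).const_mul k)).congr_deriv ?_
    rw [h.c_eq]; simp; ring
  have := is_const_of_deriv_eq_zero (fun x => (hd x).differentiableAt) (fun x => (hd x).deriv) x 0
  simp only [h.s_zero, h.v_zero] at this
  linarith

theorem c_sq (h : GenTrig k c s v) (x : ℝ) : c x ^ 2 + k * s x ^ 2 = 1 := by
  rw [h.s_sq, h.c_eq]; ring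

/-- Solutions of `f'' = -k f` on a preconnected open set of reals. -/
theorem eq_of_deriv_deriv (h : GenTrig k c s v) {I : Set ℝ} (hI : IsOpen I) (hc : IsPreconnected I)
    {f g : ℝ → ℝ} (hf : ∀ x ∈ I, HasDerivAt f (g x) x) (hg : ∀ x ∈ I, HasDerivAt g (-k * f x) x)
    {x₀ x : ℝ} (hx₀ : x₀ ∈ I) (hx : x ∈ I) :
    f x = f x₀ * c (x - x₀) + g x₀ * s (x - x₀) ∧
      g x = g x₀ * c (x - x₀) - k * f x₀ * s (x - x₀) := by
  have hC (x : ℝ) : HasDerivAt (fun x => c (x - x₀)) (-k * s (x - x₀)) x :=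
    (h.deriv_c (x - x₀)).comp_sub_const x x₀
  have hS (x : ℝ) : HasDerivAt (fun x => s (x - x₀)) (c (x - x₀)) x :=
    (h.deriv_s (x - x₀)).comp_sub_const x x₀
  -- The vector (f, g) turned back by the angle x − x₀ has zero derivative; `c_sq` then inverts the
  -- rotation.
  have h1 (x) (hx : x ∈ I) :
      HasDerivAt (fun x => f x * c (x - x₀) - g x * s (x - x₀)) 0 x := by
    refine (((hf x hx).mul (hC x)).sub ((hg x hx).mul (hS x))).congr_deriv ?_; ring
  have h2 (x) (hx : x ∈ I) :
      HasDerivAt (fun x => g x * c (x - x₀) + k * f x * s (x - x₀)) 0 x := by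
    refine (((hg x hx).mul (hC x)).add (((hf x hx).const_mul k).mul (hS x))).congr_deriv ?_; ring
  have e1 := hI.is_const_of_deriv_eq_zero hc
    (fun x hx => (h1 x hx).differentiableAt.differentiableWithinAt) (fun x hx => (h1 x hx).deriv)
    hx hx₀
  have e2 := hI.is_const_of_deriv_eq_zero hc
    (fun x hx => (h2 x hx).differentiableAt.differentiableWithinAt) (fun x hx => (h2 x hx).deriv)
    hx hx₀
  simp only [sub_self, h.c_zero, h.s_zero] at e1 e2
  have hcs := h.c_sq (x - x₀)
  constructor
  · linear_combination c (x - x₀) * e1 + s (x - x₀) * e2 - f x * hcs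
  · linear_combination c (x - x₀) * e2 - k * s (x - x₀) * e1 - g x * hcs

end GenTrig

/-! ### Metric and torsion determine the connection; a criterion for affine isometries. -/

namespace RCSpacetime

theorem eq_zero_of_metric_eq_zero (M : RCSpacetime) {p : CoordSpace} (hp : p ∈ M.carrier)
    {u : CoordSpace} (h : ∀ v, M.metric p u v = 0) : u = 0 := by
  obtain ⟨e, he⟩ := M.metric_lorentzian p hp
  have hc (j : Fin 4) : e.repr u j = 0 := by
    have h1 := h (e j)
    rw [← e.sum_repr u] at h1
    simp only [map_sum, map_smul, sum_apply, smul_apply,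
      he, smul_eq_mul] at h1
    fin_cases j <;> simpa [Fin.sum_univ_four] using h1
  exact e.repr.injective (Finsupp.ext fun j => by simp [hc j])

/-- Nondegeneracy of the source metric forces injectivity, and the dimensions are equal. -/
theorem surjective_of_map_metric (M N : RCSpacetime) {p q : CoordSpace} (hp : p ∈ M.carrier)
    {F : CoordSpace →L[ℝ] CoordSpace}
    (h : ∀ u v, N.metric q (F u) (F v) = M.metric p u v) : Function.Surjective F := by
  have hi : Function.Injective (F : CoordSpace →ₗ[ℝ] CoordSpace) := by
    rw [injective_iff_map_eq_zero]
    intro u hu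
    refine M.eq_zero_of_metric_eq_zero hp fun v => ?_
    rw [← h]
    simp only [ContinuousLinearMap.coe_coe] at hu
    simp [hu]
  exact LinearMap.injective_iff_surjective.1 hi

end RCSpacetime

theorem hasFDerivAt_fderiv_of_contDiffOn {E F : Type*} [NormedAddCommGroup E] [NormedSpace ℝ E]
    [NormedAddCommGroup F] [NormedSpace ℝ F] {φ : E → F} {V : Set E} (hV : IsOpen V)
    (hφ : ContDiffOn ℝ ∞ φ V) {p : E} (hp : p ∈ V) :
    HasFDerivAt (fderiv ℝ φ) (fderiv ℝ (fderiv ℝ φ) p) p := by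
  have h : ContDiffAt ℝ ∞ φ p := hφ.contDiffAt (hV.mem_nhds hp)
  exact ((h.fderiv_right (m := ∞) (by simp)).differentiableAt (by simp)).hasFDerivAt

theorem hasFDerivAt_of_contDiffOn {E F : Type*} [NormedAddCommGroup E] [NormedSpace ℝ E]
    [NormedAddCommGroup F] [NormedSpace ℝ F] {φ : E → F} {V : Set E} (hV : IsOpen V)
    (hφ : ContDiffOn ℝ ∞ φ V) {p : E} (hp : p ∈ V) :
    HasFDerivAt φ (fderiv ℝ φ p) p :=
  ((hφ.contDiffAt (hV.mem_nhds hp)).differentiableAt (by simp)).hasFDerivAt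

theorem fderiv_fderiv_symm_of_contDiffOn {E F : Type*} [NormedAddCommGroup E] [NormedSpace ℝ E]
    [NormedAddCommGroup F] [NormedSpace ℝ F] {φ : E → F} {V : Set E} (hV : IsOpen V)
    (hφ : ContDiffOn ℝ ∞ φ V) {p : E} (hp : p ∈ V) (u v : E) :
    fderiv ℝ (fderiv ℝ φ) p u v = fderiv ℝ (fderiv ℝ φ) p v u := by
  have h : ContDiffAt ℝ ∞ φ p := hφ.contDiffAt (hV.mem_nhds hp)
  exact (h.isSymmSndFDerivAt (by simpa using WithTop.coe_le_coe.2 (le_top : (2 : ℕ∞) ≤ ⊤))) u v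

/-- A metric-compatible connection is determined by its torsion: a metric-preserving map that
preserves the torsion preserves the connection. -/
theorem map_conn_of_map_torsion {M N : RCSpacetime} {V : Set CoordSpace}
    {φ : CoordSpace → CoordSpace} (hV : IsOpen V) (hVM : V ⊆ M.carrier)
    (hmap : Set.MapsTo φ V N.carrier) (hφ : ContDiffOn ℝ ∞ φ V)
    (hg : ∀ p ∈ V, ∀ u v, N.metric (φ p) (fderiv ℝ φ p u) (fderiv ℝ φ p v) = M.metric p u v)
    (hT : ∀ p ∈ V, ∀ u v,
      N.torsion (φ p) (fderiv ℝ φ p u) (fderiv ℝ φ p v) = fderiv ℝ φ p (M.torsion p u v)) :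
    ∀ p ∈ V, ∀ u v,
      fderiv ℝ (fderiv ℝ φ) p u v + N.conn (φ p) (fderiv ℝ φ p u) (fderiv ℝ φ p v)
        = fderiv ℝ φ p (M.conn p u v) := by
  intro p hp
  set F := fderiv ℝ φ p with hF
  -- Δ is the defect of φ as an affine map. It is symmetric because the torsions agree, and skew
  -- with respect to the metric because both connections are compatible. A trilinear form symmetric
  -- in two slots and skew in an overlapping pair vanishes, as in the uniqueness of the Levi-Civita
  -- connection.
  set Δ : CoordSpace → CoordSpace → CoordSpace := fun u v =>
    fderiv ℝ (fderiv ℝ φ) p u v + N.conn (φ p) (F u) (F v) - F (M.conn p u v) with hΔ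
  have hsymm (u v) : Δ u v = Δ v u := by
    have h1 := hT p hp u v
    rw [RCSpacetime.torsion, RCSpacetime.torsion, map_sub] at h1
    simp only [hΔ, fderiv_fderiv_symm_of_contDiffOn hV hφ hp u v]
    linear_combination (exp := 1) h1
  have hskew (w u v) : N.metric (φ p) (Δ w u) (F v) + N.metric (φ p) (F u) (Δ w v) = 0 := by
    have hφ1 := hasFDerivAt_of_contDiffOn hV hφ hp
    have hφ2 := hasFDerivAt_fderiv_of_contDiffOn hV hφ hp
    have hN := (hasFDerivAt_of_contDiffOn N.isOpen_carrier N.contDiffOn_metric (hmap hp)).comp p hφ1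
    have hM := hasFDerivAt_of_contDiffOn M.isOpen_carrier M.contDiffOn_metric (hVM hp)
    have h1 := (hN.clm_apply (hφ2.clm_apply (hasFDerivAt_const u p))).clm_apply
      (hφ2.clm_apply (hasFDerivAt_const v p))
    have h2 := (hM.clm_apply (hasFDerivAt_const u p)).clm_apply (hasFDerivAt_const v p)
    have h3 := (h1.congr_of_eventuallyEq (f₁ := fun q => M.metric q u v)
      (Filter.eventually_of_mem (hV.mem_nhds hp) fun q hq => (hg q hq u v).symm)).unique h2
    have h4 := DFunLike.congr_fun h3 w
    simp only [add_apply, ContinuousLinearMap.comp_apply,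
      ContinuousLinearMap.flip_apply, zero_apply, map_zero, zero_add,
      Function.comp_apply, ← hF] at h4
    rw [M.metric_compatible p (hVM hp), N.metric_compatible _ (hmap hp), ← hg p hp, ← hg p hp] at h4
    simp only [hΔ, map_add, map_sub, add_apply, sub_apply]
    rw [← hF] at h4
    linarith
  have hsurj := M.surjective_of_map_metric N (hVM hp) (hg p hp)
  have hNs (a b) : N.metric (φ p) a b = N.metric (φ p) b a := N.metric_symm _ (hmap hp) a b
  intro u v
  have h0 : Δ u v = 0 := by
    refine N.eq_zero_of_metric_eq_zero (hmap hp) fun w' => ?_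
    obtain ⟨w, rfl⟩ := hsurj w'
    change N.metric (φ p) (Δ u v) (F w) = 0
    have a1 := hskew u v w
    have a2 := hskew v w u
    have a3 := hskew w u v
    rw [hNs (F _)] at a1 a2 a3
    rw [hsymm v u] at a2
    rw [hsymm w u, hsymm w v] at a3
    linarith
  exact sub_eq_zero.1 h0

/-- `F` carries a coframe `θ` to a coframe `θ'`, up to the sign `σ` in `θ⁰` and up to a rotation of
`θ¹` and `θ²`. -/
structure CoframeCompat (σ : ℝ) (θ θ' : CoordSpace → Fin 4 → ℝ) (F : CoordSpace → CoordSpace) :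
    Prop where
  time : ∀ u, θ' (F u) 0 = σ * θ u 0
  flat : ∀ u v, θ' (F u) 1 * θ' (F v) 1 + θ' (F u) 2 * θ' (F v) 2 = θ u 1 * θ v 1 + θ u 2 * θ v 2
  area : ∀ u v, θ' (F u) 1 * θ' (F v) 2 - θ' (F v) 1 * θ' (F u) 2 = θ u 1 * θ v 2 - θ v 1 * θ u 2
  height : ∀ u, θ' (F u) 3 = θ u 3

/-- The last three coframe forms annihilate ∂_t. The image has the same property: its third
component vanishes by `height`, and the sum of the squares of the other two vanishes by `flat`. -/
theorem CoframeCompat.map_time {σ : ℝ} {H D H' D' : ℝ → ℝ} {p q : CoordSpace}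
    {F : CoordSpace → CoordSpace}
    (h : CoframeCompat σ (godelCoframe H D p) (godelCoframe H' D' q) F) (hD : D' (q 1) ≠ 0) :
    F (Pi.single 0 1) = σ • (Pi.single 0 1 : CoordSpace) := by
  have h0 := h.time (Pi.single 0 1)
  have h1 := h.flat (Pi.single 0 1) (Pi.single 0 1)
  have h3 := h.height (Pi.single 0 1)
  set w := F (Pi.single 0 1)
  simp [godelCoframe] at h0 h1 h3
  have e1 : w 1 = 0 := by nlinarith [sq_nonneg (w 1), sq_nonneg (D' (q 1) * w 2)]
  have e2 : D' (q 1) * w 2 = 0 := by nlinarith [sq_nonneg (w 1), sq_nonneg (D' (q 1) * w 2)]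
  have e2 : w 2 = 0 := by simpa [hD] using e2
  ext i
  fin_cases i <;> simp [e1, e2, h3]
  simpa [e2] using h0

/-- Only the metric and the torsion S (ω¹ ∧ ω²) ⊗ ∂_t need checking. Reversing time flips ∂_t while
keeping ω¹ ∧ ω², which is why S must change by the factor σ. -/
theorem IsGodelType.isAffineIsometryOn {M N : RCSpacetime} {H D S H' D' S' : ℝ → ℝ}
    (hM : IsGodelType M H D S) (hN : IsGodelType N H' D' S') {σ : ℝ} (hσ : σ * σ = 1)
    {V : Set CoordSpace} {φ : CoordSpace → CoordSpace} (hV : IsOpen V) (hVM : V ⊆ M.carrier)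
    (hmap : Set.MapsTo φ V N.carrier) (hinj : Set.InjOn φ V) (hφ : ContDiffOn ℝ ∞ φ V)
    (hS : ∀ p ∈ V, S' (φ p 3) = σ * S (p 3))
    (hF : ∀ p ∈ V,
      CoframeCompat σ (godelCoframe H D p) (godelCoframe H' D' (φ p)) (fderiv ℝ φ p)) :
    IsAffineIsometryOn M N V φ := by
  have hg : ∀ p ∈ V, ∀ u v,
      N.metric (φ p) (fderiv ℝ φ p u) (fderiv ℝ φ p v) = M.metric p u v := by
    intro p hp u v
    rw [hM.metric_eq p (hVM hp), hN.metric_eq _ (hmap hp), (hF p hp).time, (hF p hp).time,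
      (hF p hp).height, (hF p hp).height]
    linear_combination (godelCoframe H D p u 0 * godelCoframe H D p v 0) * hσ - (hF p hp).flat u v
  refine ⟨hV, hVM, hmap, hinj, hφ, hg, map_conn_of_map_torsion hV hVM hmap hφ hg ?_⟩
  intro p hp u v
  rw [hM.torsion_eq p (hVM hp), hN.torsion_eq _ (hmap hp), (hF p hp).area, map_smul,
    (hF p hp).map_time (hN.D_ne_zero _ (hmap hp)), hS p hp, smul_smul]
  congr 1
  ring

/-! ### Coordinate functions and the differential equations for H and D. -/

section Coordinates

theorem isOpen_image_apply {U : Set CoordSpace} (hU : IsOpen U) (i : Fin 4) :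
    IsOpen ((fun p : CoordSpace => p i) '' U) :=
  isOpenMap_eval i U hU

theorem isPreconnected_image_apply {U : Set CoordSpace} (hU : IsPreconnected U) (i : Fin 4) :
    IsPreconnected ((fun p : CoordSpace => p i) '' U) :=
  hU.image _ (continuous_apply i).continuousOn

theorem hasFDerivAt_apply_coord (i : Fin 4) (p : CoordSpace) :
    HasFDerivAt (fun p : CoordSpace => p i) (ContinuousLinearMap.proj (R := ℝ) i) p :=
  (ContinuousLinearMap.proj (R := ℝ) (φ := fun _ : Fin 4 => ℝ) i).hasFDerivAt

theorem HasDerivAt.hasFDerivAt_coord {f : ℝ → ℝ} {f' : ℝ} {i : Fin 4} {p : CoordSpace}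
    (h : HasDerivAt f f' (p i)) :
    HasFDerivAt (fun p : CoordSpace => f (p i))
      (f' • (ContinuousLinearMap.proj (R := ℝ) i : CoordSpace →L[ℝ] ℝ)) p :=
  h.comp_hasFDerivAt p (hasFDerivAt_apply_coord i p)

theorem ContDiffOn.comp_coord {f : ℝ → ℝ} {U : Set CoordSpace} {i : Fin 4}
    (h : ContDiffOn ℝ ∞ f ((fun p : CoordSpace => p i) '' U)) :
    ContDiffOn ℝ ∞ (fun p : CoordSpace => f (p i)) U :=
  h.comp (contDiff_apply ℝ ℝ i).contDiffOn fun _ hp => Set.mem_image_of_mem _ hp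

end Coordinates

namespace IsGodelType

variable {M : RCSpacetime} {H D S : ℝ → ℝ} {m2 w S₀ : ℝ}

theorem hasDerivAt_H (hM : IsGodelType M H D S) {p : CoordSpace} (hp : p ∈ M.carrier) :
    HasDerivAt H (deriv H (p 1)) (p 1) :=
  ((hM.smooth_H.contDiffAt ((isOpen_image_apply M.isOpen_carrier 1).mem_nhds
    (Set.mem_image_of_mem _ hp))).differentiableAt (by simp)).hasDerivAt

theorem hasDerivAt_D (hM : IsGodelType M H D S) {p : CoordSpace} (hp : p ∈ M.carrier) :
    HasDerivAt D (deriv D (p 1)) (p 1) :=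
  ((hM.smooth_D.contDiffAt ((isOpen_image_apply M.isOpen_carrier 1).mem_nhds
    (Set.mem_image_of_mem _ hp))).differentiableAt (by simp)).hasDerivAt

theorem smooth_deriv_D (hM : IsGodelType M H D S) :
    ContDiffOn ℝ ∞ (deriv D) ((fun p : CoordSpace => p 1) '' M.carrier) :=
  hM.smooth_D.deriv_of_isOpen (isOpen_image_apply M.isOpen_carrier 1) (by simp)

theorem smooth_deriv_H (hM : IsGodelType M H D S) :
    ContDiffOn ℝ ∞ (deriv H) ((fun p : CoordSpace => p 1) '' M.carrier) :=
  hM.smooth_H.deriv_of_isOpen (isOpen_image_apply M.isOpen_carrier 1) (by simp)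

theorem hasDerivAt_deriv_D (hM : IsGodelType M H D S) {p : CoordSpace} (hp : p ∈ M.carrier) :
    HasDerivAt (deriv D) (deriv (deriv D) (p 1)) (p 1) :=
  ((hM.smooth_deriv_D.contDiffAt ((isOpen_image_apply M.isOpen_carrier 1).mem_nhds
    (Set.mem_image_of_mem _ hp))).differentiableAt (by simp)).hasDerivAt

theorem hasDerivAt_deriv_H (hM : IsGodelType M H D S) {p : CoordSpace} (hp : p ∈ M.carrier) :
    HasDerivAt (deriv H) (deriv (deriv H) (p 1)) (p 1) :=
  ((hM.smooth_deriv_H.contDiffAt ((isOpen_image_apply M.isOpen_carrier 1).mem_nhds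
    (Set.mem_image_of_mem _ hp))).differentiableAt (by simp)).hasDerivAt

theorem deriv_H_eq (hM : IsGodelType M H D S) (hP : HasParameters M H D S m2 w S₀)
    {p : CoordSpace} (hp : p ∈ M.carrier) : deriv H (p 1) = 2 * w * D (p 1) :=
  (div_eq_iff (hM.D_ne_zero p hp)).1 (hP.rotation p hp)

theorem deriv_deriv_D_eq (hM : IsGodelType M H D S) (hP : HasParameters M H D S m2 w S₀)
    {p : CoordSpace} (hp : p ∈ M.carrier) : deriv (deriv D) (p 1) = m2 * D (p 1) :=
  (div_eq_iff (hM.D_ne_zero p hp)).1 (hP.curvature p hp)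

/-- `D` and `D'` in terms of their values at a point. -/
theorem D_eq (hM : IsGodelType M H D S) (hP : HasParameters M H D S m2 w S₀)
    {c s v : ℝ → ℝ} (h : GenTrig (-m2) c s v) {p q : CoordSpace} (hp : p ∈ M.carrier)
    (hq : q ∈ M.carrier) :
    D (q 1) = D (p 1) * c (q 1 - p 1) + deriv D (p 1) * s (q 1 - p 1) ∧
      deriv D (q 1) = deriv D (p 1) * c (q 1 - p 1) + m2 * D (p 1) * s (q 1 - p 1) := by
  have := h.eq_of_deriv_deriv (f := D) (g := deriv D) (isOpen_image_apply M.isOpen_carrier 1)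
    (isPreconnected_image_apply M.isConnected_carrier.isPreconnected 1)
    (by rintro _ ⟨q, hq, rfl⟩; exact hM.hasDerivAt_D hq)
    (by
      rintro _ ⟨q, hq, rfl⟩
      refine (hM.hasDerivAt_deriv_D hq).congr_deriv ?_
      rw [hM.deriv_deriv_D_eq hP hq]; ring)
    (Set.mem_image_of_mem _ hp) (Set.mem_image_of_mem _ hq)
  refine ⟨this.1, this.2.trans ?_⟩
  ring

end IsGodelType

/-! ### Constant-curvature charts and local equivalence for equal parameters. -/

/-- A local inverse of a smooth map with injective differentials. -/
theorem exists_openPartialHomeomorph {f : CoordSpace → CoordSpace} {U : Set CoordSpace}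
    (hU : IsOpen U) (hf : ContDiffOn ℝ ∞ f U)
    (hinj : ∀ p ∈ U, Function.Injective (fderiv ℝ f p)) {p : CoordSpace} (hp : p ∈ U) :
    ∃ e : OpenPartialHomeomorph CoordSpace CoordSpace, (∀ q, e q = f q) ∧ p ∈ e.source ∧
      e.source ⊆ U ∧ ContDiffOn ℝ ∞ e.symm e.target := by
  have hd (q) (hq : q ∈ U) : ∃ A : CoordSpace ≃L[ℝ] CoordSpace,
      HasFDerivAt f (A : CoordSpace →L[ℝ] CoordSpace) q := by
    refine ⟨(LinearEquiv.ofInjectiveEndo (fderiv ℝ f q : CoordSpace →ₗ[ℝ] CoordSpace)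
      (hinj q hq)).toContinuousLinearEquiv, ?_⟩
    convert! hasFDerivAt_of_contDiffOn hU hf hq
  have hca (q) (hq : q ∈ U) : ContDiffAt ℝ ∞ f q := hf.contDiffAt (hU.mem_nhds hq)
  obtain ⟨A, hA⟩ := hd p hp
  set e := ((hca p hp).toOpenPartialHomeomorph f hA (by simp)).restrOpen U hU with he
  have hef : ∀ q, e q = f q := fun q => rfl
  have hs : e.source ⊆ U := fun q hq => hq.2
  refine ⟨e, hef, ⟨(hca p hp).mem_toOpenPartialHomeomorph_source hA (by simp), hp⟩, hs, ?_⟩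
  intro q hq
  obtain ⟨B, hB⟩ := hd _ (hs (e.map_target hq))
  exact (e.contDiffAt_symm hq hB (hca _ (hs (e.map_target hq)))).contDiffWithinAt

/-- Coordinates `(t, u, v, z)` centred at a point, in which the flat part of a Gödel-type metric
depends on `m2` only; `W = √(1 + m2 (u² + v²))` near that point and `P = m2⁻¹ dW`. -/
structure IsFlatChart (m2 : ℝ) (D : ℝ → ℝ) (U : Set CoordSpace) (ψ : CoordSpace → CoordSpace)
    (W : CoordSpace → ℝ) (P : CoordSpace → CoordSpace → ℝ) : Prop where
  smooth : ContDiffOn ℝ ∞ ψ U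
  continuousOn_W : ContinuousOn W U
  map_zero : ∀ p ∈ U, ∀ u, fderiv ℝ ψ p u 0 = u 0
  map_three : ∀ p ∈ U, ∀ u, fderiv ℝ ψ p u 3 = u 3
  W_sq : ∀ p ∈ U, W p ^ 2 = 1 + m2 * (ψ p 1 ^ 2 + ψ p 2 ^ 2)
  radial : ∀ p ∈ U, ∀ a,
    ψ p 1 * fderiv ℝ ψ p a 1 + ψ p 2 * fderiv ℝ ψ p a 2 = W p * P p a
  flat : ∀ p ∈ U, ∀ a b, fderiv ℝ ψ p a 1 * fderiv ℝ ψ p b 1 + fderiv ℝ ψ p a 2 * fderiv ℝ ψ p b 2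
    - m2 * (P p a * P p b) = a 1 * b 1 + D (p 1) ^ 2 * (a 2 * b 2)
  area : ∀ p ∈ U, ∀ a b, fderiv ℝ ψ p a 1 * fderiv ℝ ψ p b 2 - fderiv ℝ ψ p b 1 * fderiv ℝ ψ p a 2
    = W p * (D (p 1) * (a 1 * b 2 - b 1 * a 2))

/-- On a kernel vector the radial identity gives P = 0, as W ≠ 0, and then `flat` equates a positive
definite form in (a 1, a 2) to zero. -/
theorem IsFlatChart.injective_fderiv {m2 : ℝ} {D : ℝ → ℝ} {U : Set CoordSpace}
    {ψ : CoordSpace → CoordSpace} {W : CoordSpace → ℝ} {P : CoordSpace → CoordSpace → ℝ}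
    (h : IsFlatChart m2 D U ψ W P) {p : CoordSpace} (hp : p ∈ U) (hD : D (p 1) ≠ 0)
    (hW : W p ≠ 0) : Function.Injective (fderiv ℝ ψ p) := by
  refine (injective_iff_map_eq_zero (fderiv ℝ ψ p)).2 fun a ha => ?_
  have h0 := h.map_zero p hp a
  have h3 := h.map_three p hp a
  have hr := h.radial p hp a
  have hf := h.flat p hp a a
  simp only [ha, Pi.zero_apply, mul_zero, add_zero, zero_eq_mul, hW, false_or] at h0 h3 hr hf
  rw [hr] at hf
  have hD2 : 0 < D (p 1) ^ 2 := by positivity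
  have h1 : a 1 = 0 := by nlinarith [sq_nonneg (a 1), mul_nonneg hD2.le (sq_nonneg (a 2))]
  have h2 : D (p 1) ^ 2 * a 2 ^ 2 = 0 := by rw [h1] at hf; linarith
  have h2 : a 2 = 0 := by simpa [hD] using h2
  ext i
  fin_cases i <;> simp [h0.symm, h1, h2, h3.symm]

/-- The metric dx² + D² dy² has curvature −m2, so it is realized on the quadric W² − m2 (u² + v²) =
1 with metric du² + dv² − m2 P², where dW = m2 P. Working with P instead of dW/m2 covers the flat
case m2 = 0 by the same formulas. -/
theorem IsGodelType.exists_isFlatChart {M : RCSpacetime} {H D S : ℝ → ℝ} {m2 w S₀ : ℝ}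
    (hM : IsGodelType M H D S) (hP : HasParameters M H D S m2 w S₀) {p₀ : CoordSpace}
    (hp₀ : p₀ ∈ M.carrier) :
    ∃ ψ W P, IsFlatChart m2 D M.carrier ψ W P ∧ ψ p₀ = 0 ∧ W p₀ = 1 := by
  obtain ⟨c, s, v, h⟩ := exists_genTrig (-m2)
  set x₀ := p₀ 1 with hx₀
  set y₀ := p₀ 2 with hy₀
  set D₀ := D x₀ with hD₀
  set D₁ := deriv D x₀ with hD₁
  -- D'² − m2 D² is a first integral of D'' = m2 D. Its sign tells whether the translations in y act
  -- on the quadric as an elliptic, parabolic or hyperbolic group.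
  obtain ⟨C, Sn, V, h'⟩ := exists_genTrig (D₁ ^ 2 - m2 * D₀ ^ 2)
  have hder (p) (hp : p ∈ M.carrier) : HasFDerivAt
      (fun p : CoordSpace => (![p 0 - p₀ 0, s (p 1 - x₀) - D₁ * (D (p 1) * V (p 2 - y₀)),
        D (p 1) * Sn (p 2 - y₀), p 3 - p₀ 3] : CoordSpace))
      (ContinuousLinearMap.pi ![ContinuousLinearMap.proj (R := ℝ) (φ := fun _ : Fin 4 => ℝ) 0,
        c (p 1 - x₀) • ContinuousLinearMap.proj (R := ℝ) (φ := fun _ : Fin 4 => ℝ) 1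
          - D₁ • (D (p 1) • (Sn (p 2 - y₀) •
              ContinuousLinearMap.proj (R := ℝ) (φ := fun _ : Fin 4 => ℝ) 2)
            + V (p 2 - y₀) • (deriv D (p 1) •
              ContinuousLinearMap.proj (R := ℝ) (φ := fun _ : Fin 4 => ℝ) 1)),
        D (p 1) • (C (p 2 - y₀) • ContinuousLinearMap.proj (R := ℝ) (φ := fun _ : Fin 4 => ℝ) 2)
            + Sn (p 2 - y₀) • (deriv D (p 1) •
              ContinuousLinearMap.proj (R := ℝ) (φ := fun _ : Fin 4 => ℝ) 1),
        ContinuousLinearMap.proj (R := ℝ) (φ := fun _ : Fin 4 => ℝ) 3]) p := by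
    have dD := (hM.hasDerivAt_D hp).hasFDerivAt_coord
    have ds : HasFDerivAt (fun p : CoordSpace => s (p 1 - x₀)) _ p :=
      ((h.deriv_s (p 1 - x₀)).comp_sub_const (p 1) x₀).hasFDerivAt_coord (i := 1)
    have dS : HasFDerivAt (fun p : CoordSpace => Sn (p 2 - y₀)) _ p :=
      ((h'.deriv_s (p 2 - y₀)).comp_sub_const (p 2) y₀).hasFDerivAt_coord (i := 2)
    have dV : HasFDerivAt (fun p : CoordSpace => V (p 2 - y₀)) _ p :=
      ((h'.deriv_v (p 2 - y₀)).comp_sub_const (p 2) y₀).hasFDerivAt_coord (i := 2)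
    refine hasFDerivAt_pi.2 fun i => ?_
    fin_cases i
    · exact (hasFDerivAt_apply_coord 0 p).sub_const _
    · exact ds.sub ((dD.mul dV).const_mul D₁)
    · exact dD.mul dS
    · exact (hasFDerivAt_apply_coord 3 p).sub_const _
  refine ⟨fun p => ![p 0 - p₀ 0, s (p 1 - x₀) - D₁ * (D (p 1) * V (p 2 - y₀)),
        D (p 1) * Sn (p 2 - y₀), p 3 - p₀ 3],
    fun p => c (p 1 - x₀) + m2 * D₀ * D (p 1) * V (p 2 - y₀),
    fun p a => (s (p 1 - x₀) + D₀ * deriv D (p 1) * V (p 2 - y₀)) * a 1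
      + D₀ * D (p 1) * Sn (p 2 - y₀) * a 2, ⟨?_, ?_, ?_, ?_, ?_, ?_, ?_, ?_⟩, ?_, ?_⟩
  · have sD := hM.smooth_D.comp_coord
    have ss : ContDiff ℝ ∞ fun p : CoordSpace => s (p 1 - x₀) := h.smooth_s.comp (by fun_prop)
    have sS : ContDiff ℝ ∞ fun p : CoordSpace => Sn (p 2 - y₀) := h'.smooth_s.comp (by fun_prop)
    have sV : ContDiff ℝ ∞ fun p : CoordSpace => V (p 2 - y₀) := h'.smooth_v.comp (by fun_prop)
    refine contDiffOn_pi.2 fun i => ?_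
    fin_cases i <;> simp only [Fin.zero_eta, Fin.mk_one, Fin.reduceFinMk, Matrix.cons_val]
    · fun_prop
    · exact ss.contDiffOn.sub (contDiffOn_const.mul (sD.mul sV.contDiffOn))
    · exact sD.mul sS.contDiffOn
    · fun_prop
  · have sD := hM.smooth_D.comp_coord.continuousOn
    have sc : Continuous fun p : CoordSpace => c (p 1 - x₀) :=
      h.smooth_c.continuous.comp (by fun_prop)
    have sV : Continuous fun p : CoordSpace => V (p 2 - y₀) :=
      h'.smooth_v.continuous.comp (by fun_prop)
    exact sc.continuousOn.add ((continuousOn_const.mul sD).mul sV.continuousOn)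
  · intro p hp u
    rw [(hder p hp).fderiv]; simp
  · intro p hp u
    rw [(hder p hp).fderiv]; simp
  · intro p hp
    obtain ⟨e1, e2⟩ := hM.D_eq hP h hp₀ hp
    have hc := h.c_sq (p 1 - x₀)
    have hs := h'.s_sq (p 2 - y₀)
    simp only [← hx₀, ← hD₀, ← hD₁] at e1 e2
    simp only [Matrix.cons_val]
    rw [mul_pow, hs, e1]
    generalize c (p 1 - x₀) = c' at *
    generalize s (p 1 - x₀) = s' at *
    generalize V (p 2 - y₀) = V' at *
    linear_combination hc
  · intro p hp a
    obtain ⟨e1, e2⟩ := hM.D_eq hP h hp₀ hp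
    have hc := h.c_sq (p 1 - x₀)
    have hs := h'.s_sq (p 2 - y₀)
    have hC := h'.c_eq (p 2 - y₀)
    simp only [← hx₀, ← hD₀, ← hD₁] at e1 e2
    rw [(hder p hp).fderiv]
    simp
    rw [e1, e2, hC]
    generalize c (p 1 - x₀) = c' at *
    generalize s (p 1 - x₀) = s' at *
    generalize V (p 2 - y₀) = V' at *
    generalize Sn (p 2 - y₀) = S' at *
    linear_combination (D₀ * c' + D₁ * s') * (D₁ * c' + m2 * D₀ * s') * a 1 * hs
  · intro p hp a b
    obtain ⟨e1, e2⟩ := hM.D_eq hP h hp₀ hp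
    have hc := h.c_sq (p 1 - x₀)
    have hs := h'.s_sq (p 2 - y₀)
    have hC := h'.c_eq (p 2 - y₀)
    simp only [← hx₀, ← hD₀, ← hD₁] at e1 e2
    rw [(hder p hp).fderiv]
    simp
    rw [e1, e2, hC]
    generalize c (p 1 - x₀) = c' at *
    generalize s (p 1 - x₀) = s' at *
    generalize V (p 2 - y₀) = V' at *
    generalize Sn (p 2 - y₀) = S' at *
    linear_combination a 1 * b 1 * (hc + (D₁ * c' + m2 * D₀ * s') ^ 2 * hs)
      + a 2 * b 2 * (D₁ ^ 2 - m2 * D₀ ^ 2) * (D₀ * c' + D₁ * s') ^ 2 * hs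
  · intro p hp a b
    obtain ⟨e1, e2⟩ := hM.D_eq hP h hp₀ hp
    have hc := h.c_sq (p 1 - x₀)
    have hs := h'.s_sq (p 2 - y₀)
    have hC := h'.c_eq (p 2 - y₀)
    simp only [← hx₀, ← hD₀, ← hD₁] at e1 e2
    rw [(hder p hp).fderiv]
    simp
    rw [e1, e2, hC]
    generalize c (p 1 - x₀) = c' at *
    generalize s (p 1 - x₀) = s' at *
    generalize V (p 2 - y₀) = V' at *
    generalize Sn (p 2 - y₀) = S' at *
    linear_combination (a 1 * b 2 - b 1 * a 2) * D₁ * (D₁ * c' + m2 * D₀ * s') * (D₀ * c' + D₁ * s') * hs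
  · ext i
    fin_cases i <;> simp [h.s_zero, h'.s_zero, h'.v_zero, hx₀, hy₀]
  · simp [h.c_zero, h'.v_zero, ← hx₀, ← hy₀]

/-- A map intertwining two flat charts preserves the flat part of the metric and its area form. -/
theorem IsFlatChart.flat_area_of_comp {m2 : ℝ} {D D' : ℝ → ℝ} {U U' : Set CoordSpace}
    {ψ ψ' : CoordSpace → CoordSpace} {W W' : CoordSpace → ℝ} {P P' : CoordSpace → CoordSpace → ℝ}
    (h : IsFlatChart m2 D U ψ W P) (h' : IsFlatChart m2 D' U' ψ' W' P') {p q : CoordSpace}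
    (hp : p ∈ U) (hq : q ∈ U') (hW : 0 < W p) (hW' : 0 < W' q) (he : ψ' q = ψ p)
    {F : CoordSpace → CoordSpace} (hF : ∀ a, fderiv ℝ ψ' q (F a) = fderiv ℝ ψ p a) :
    (∀ a, F a 0 = a 0) ∧ (∀ a, F a 3 = a 3) ∧
    (∀ a b, F a 1 * F b 1 + D' (q 1) ^ 2 * (F a 2 * F b 2)
      = a 1 * b 1 + D (p 1) ^ 2 * (a 2 * b 2)) ∧
    ∀ a b, D' (q 1) * (F a 1 * F b 2 - F b 1 * F a 2) = D (p 1) * (a 1 * b 2 - b 1 * a 2) := by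
  -- The charts agree in u and v only: W is recovered from W² by positivity, and P from the radial
  -- identity on dividing by W.
  have hWW : W' q = W p := by
    have h1 := h.W_sq p hp
    have h2 := h'.W_sq q hq
    rw [he, ← h1] at h2
    exact (sq_eq_sq₀ hW'.le hW.le).1 h2
  have hPP (a) : P' q (F a) = P p a := by
    have h1 := h.radial p hp a
    have h2 := h'.radial q hq (F a)
    rw [he, hF, h1, hWW] at h2
    exact (mul_left_cancel₀ hW.ne' h2).symm
  refine ⟨fun a => ?_, fun a => ?_, fun a b => ?_, fun a b => ?_⟩
  · rw [← h'.map_zero q hq (F a), hF, h.map_zero p hp]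
  · rw [← h'.map_three q hq (F a), hF, h.map_three p hp]
  · rw [← h'.flat q hq, ← h.flat p hp, hF, hF, hPP, hPP]
  · have h1 := h.area p hp a b
    have h2 := h'.area q hq (F a) (F b)
    rw [hF, hF, h1, hWW] at h2
    exact (mul_left_cancel₀ hW.ne' h2).symm

/-- A smooth closed one-form has a smooth primitive near each point. -/
theorem exists_smooth_primitive {η : CoordSpace → CoordSpace →L[ℝ] ℝ} {U : Set CoordSpace}
    (hU : IsOpen U) (hη : ContDiffOn ℝ ∞ η U)
    (hsymm : ∀ p ∈ U, ∀ a b, fderiv ℝ η p a b = fderiv ℝ η p b a) {p₀ : CoordSpace} (hp₀ : p₀ ∈ U) :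
    ∃ B ⊆ U, IsOpen B ∧ p₀ ∈ B ∧ ∃ T : CoordSpace → ℝ, ContDiffOn ℝ ∞ T B ∧ T p₀ = 0 ∧
      ∀ p ∈ B, HasFDerivAt T (η p) p := by
  obtain ⟨r, hr, hB⟩ := Metric.isOpen_iff.1 hU p₀ hp₀
  obtain ⟨T, hT⟩ := (convex_ball p₀ r).exists_forall_hasFDerivAt_of_fderiv_symmetric
    Metric.isOpen_ball ((hη.mono hB).differentiableOn (by simp)) fun p hp => hsymm p (hB hp)
  refine ⟨_, hB, Metric.isOpen_ball, Metric.mem_ball_self hr, fun p => T p - T p₀, ?_, by simp,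
    fun p hp => (hT p hp).sub_const _⟩
  refine ContDiffOn.sub ?_ contDiffOn_const
  refine (contDiffOn_infty_iff_fderiv_of_isOpen Metric.isOpen_ball).2
    ⟨fun p hp => (hT p hp).differentiableAt.differentiableWithinAt, ?_⟩
  exact (hη.mono hB).congr fun p hp => (hT p hp).fderiv

theorem exists_injOn_of_injective_fderiv {f : CoordSpace → CoordSpace} {U : Set CoordSpace}
    (hU : IsOpen U) (hf : ContDiffOn ℝ ∞ f U)
    (hinj : ∀ p ∈ U, Function.Injective (fderiv ℝ f p)) {p : CoordSpace} (hp : p ∈ U) :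
    ∃ V ⊆ U, IsOpen V ∧ p ∈ V ∧ Set.InjOn f V := by
  obtain ⟨e, he, hpe, hs, -⟩ := exists_openPartialHomeomorph hU hf hinj hp
  exact ⟨e.source, hs, e.open_source, hpe, e.injOn.congr fun q _ => he q⟩

theorem CoframeCompat.injective {σ : ℝ} (hσ : σ * σ = 1) {H D H' D' : ℝ → ℝ} {p q : CoordSpace}
    {F : CoordSpace →L[ℝ] CoordSpace}
    (h : CoframeCompat σ (godelCoframe H D p) (godelCoframe H' D' q) F) (hD : D (p 1) ≠ 0) :
    Function.Injective F := by
  refine (injective_iff_map_eq_zero F).2 fun a ha => ?_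
  have h0 := h.time a
  have h1 := h.flat a a
  have h3 := h.height a
  rw [ha] at h0 h1 h3
  simp [godelCoframe] at h0 h1 h3
  have hσ0 : σ ≠ 0 := by rintro rfl; simp at hσ
  have e1 : a 1 = 0 := by nlinarith [sq_nonneg (a 1), sq_nonneg (D (p 1) * a 2)]
  have e2 : D (p 1) * a 2 = 0 := by nlinarith [sq_nonneg (a 1), sq_nonneg (D (p 1) * a 2)]
  have e2 : a 2 = 0 := by simpa [hD] using e2
  ext i
  fin_cases i <;> simp [e1, e2, h3.symm]
  simpa [e2, hσ0] using h0

/-- Composing one flat chart with the inverse of the other gives φ preserving dt, dz, the surface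
metric and ω¹ ∧ ω². The form η = σ ω⁰ − φ* ω'⁰ is closed, since dω⁰ = 2w ω¹ ∧ ω² on M while the
corresponding factor on N is 2σw. Adding a primitive T of η to the time coordinate then makes ω'⁰
pull back to σ ω⁰. -/
theorem IsGodelType.locallyEquivalentAt {M N : RCSpacetime} {H D S H' D' S' : ℝ → ℝ}
    {m2 w S₀ σ : ℝ} (hσ : σ * σ = 1) (hM : IsGodelType M H D S)
    (hPM : HasParameters M H D S m2 w S₀) (hN : IsGodelType N H' D' S')
    (hPN : HasParameters N H' D' S' m2 (σ * w) (σ * S₀)) {p₀ q₀ : CoordSpace}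
    (hp₀ : p₀ ∈ M.carrier) (hq₀ : q₀ ∈ N.carrier) : LocallyEquivalentAt M N p₀ q₀ := by
  obtain ⟨ψ, W, P, h, hψ₀, hW₀⟩ := hM.exists_isFlatChart hPM hp₀
  obtain ⟨ψ', W', P', h', hψ₀', hW₀'⟩ := hN.exists_isFlatChart hPN hq₀
  have hUopen {Q : RCSpacetime} {W : CoordSpace → ℝ} (hW : ContinuousOn W Q.carrier) :
      IsOpen (Q.carrier ∩ W ⁻¹' Set.Ioi 0) := hW.isOpen_inter_preimage Q.isOpen_carrier isOpen_Ioi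
  set U := M.carrier ∩ W ⁻¹' Set.Ioi 0 with hU
  set U' := N.carrier ∩ W' ⁻¹' Set.Ioi 0 with hU'
  have hpU : p₀ ∈ U := ⟨hp₀, by simp [hW₀]⟩
  have hqU : q₀ ∈ U' := ⟨hq₀, by simp [hW₀']⟩
  obtain ⟨e, he, hqe, hes, hsymm⟩ := exists_openPartialHomeomorph (hUopen h'.continuousOn_W)
    (h'.smooth.mono Set.inter_subset_left)
    (fun q hq => h'.injective_fderiv hq.1 (hN.D_ne_zero q hq.1) (ne_of_gt hq.2)) hqU
  -- the equivalence of the flat parts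
  set φ : CoordSpace → CoordSpace := fun p => e.symm (ψ p) with hφ
  set V := U ∩ ψ ⁻¹' e.target with hV
  have hVopen : IsOpen V := (h.smooth.continuousOn.mono Set.inter_subset_left).isOpen_inter_preimage
    (hUopen h.continuousOn_W) e.open_target
  have hφ₀ : φ p₀ = q₀ := by
    rw [hφ]
    simp only
    rw [hψ₀, ← hψ₀', ← he, e.left_inv hqe]
  have hpV : p₀ ∈ V := by
    refine ⟨hpU, ?_⟩
    rw [Set.mem_preimage, hψ₀, ← hψ₀', ← he]
    exact e.map_source hqe
  have hφsmooth : ContDiffOn ℝ ∞ φ V :=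
    hsymm.comp (h.smooth.mono fun p hp => hp.1.1) fun p hp => hp.2
  have hφU (p) (hp : p ∈ V) : φ p ∈ U' := hes (e.map_target hp.2)
  have hφψ (p) (hp : p ∈ V) : ψ' (φ p) = ψ p := by rw [← he]; exact e.right_inv hp.2
  have hφd (p) (hp : p ∈ V) (a) : fderiv ℝ ψ' (φ p) (fderiv ℝ φ p a) = fderiv ℝ ψ p a := by
    have h1 := (hasFDerivAt_of_contDiffOn N.isOpen_carrier h'.smooth (hφU p hp).1).comp p
      (hasFDerivAt_of_contDiffOn hVopen hφsmooth hp)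
    have h2 := hasFDerivAt_of_contDiffOn M.isOpen_carrier h.smooth hp.1.1
    have h3 := (h1.congr_of_eventuallyEq (f₁ := ψ)
      (Filter.eventually_of_mem (hVopen.mem_nhds hp) fun q hq => (hφψ q hq).symm)).unique h2
    exact DFunLike.congr_fun h3 a
  have hflat (p) (hp : p ∈ V) := h.flat_area_of_comp h' hp.1.1 (hφU p hp).1 hp.1.2 (hφU p hp).2
    (hφψ p hp) (hφd p hp)
  -- the correction of the time coordinate
  set pr : Fin 4 → CoordSpace →L[ℝ] ℝ := fun i => ContinuousLinearMap.proj i with hpr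
  set η : CoordSpace → CoordSpace →L[ℝ] ℝ := fun p => (σ - 1) • pr 0 + ((σ * H (p 1)) • pr 2
    - H' (φ p 1) • (pr 2).comp (fderiv ℝ φ p)) with hη
  have hφcoord (i : Fin 4) : ContDiffOn ℝ ∞ (fun p => φ p i) V :=
    (contDiff_apply ℝ ℝ i).comp_contDiffOn hφsmooth
  have hηsmooth : ContDiffOn ℝ ∞ η V := by
    have s1 : ContDiffOn ℝ ∞ (fun p : CoordSpace => H (p 1)) V :=
      hM.smooth_H.comp_coord.mono fun p hp => hp.1.1
    have s2 : ContDiffOn ℝ ∞ (fun p : CoordSpace => H' (φ p 1)) V :=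
      hN.smooth_H.comp_coord.comp hφsmooth fun p hp => (hφU p hp).1
    have s3 : ContDiffOn ℝ ∞ (fderiv ℝ φ) V := hφsmooth.fderiv_of_isOpen hVopen (by simp)
    exact contDiffOn_const.add (((contDiffOn_const.mul s1).smul contDiffOn_const).sub
      (s2.smul (contDiffOn_const.clm_comp s3)))
  have hclosed (p) (hp : p ∈ V) (a b) : fderiv ℝ η p a b = fderiv ℝ η p b a := by
    have d1 := (hM.hasDerivAt_H hp.1.1).hasFDerivAt_coord
    have dφ1 : HasFDerivAt (fun p => φ p 1) ((pr 1).comp (fderiv ℝ φ p)) p :=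
      (pr 1).hasFDerivAt.comp p (hasFDerivAt_of_contDiffOn hVopen hφsmooth hp)
    have d2 : HasFDerivAt (fun p => H' (φ p 1)) (deriv H' (φ p 1) • (pr 1).comp (fderiv ℝ φ p)) p :=
      (hN.hasDerivAt_H (hφU p hp).1).comp_hasFDerivAt p dφ1
    have d3 : HasFDerivAt (fun p => (pr 2).comp (fderiv ℝ φ p)) _ p :=
      (hasFDerivAt_const (pr 2) p).clm_comp (hasFDerivAt_fderiv_of_contDiffOn hVopen hφsmooth hp)
    have hd : HasFDerivAt η _ p := (hasFDerivAt_const ((σ - 1) • pr 0) p).add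
      (((d1.const_mul σ).smul (hasFDerivAt_const (pr 2) p)).sub (d2.smul d3))
    have harea := (hflat p hp).2.2.2 a b
    rw [hd.fderiv]
    simp [hpr, fderiv_fderiv_symm_of_contDiffOn hVopen hφsmooth hp a b]
    rw [hM.deriv_H_eq hPM hp.1.1, hN.deriv_H_eq hPN (hφU p hp).1]
    linear_combination -2 * σ * w * harea
  obtain ⟨B, hBV, hB, hpB, T, hTsmooth, hT₀, hT⟩ :=
    exists_smooth_primitive hVopen hηsmooth hclosed hpV
  set Φ : CoordSpace → CoordSpace := fun p => φ p + T p • (Pi.single 0 1 : CoordSpace) with hΦ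
  have hΦsmooth : ContDiffOn ℝ ∞ Φ B :=
    (hφsmooth.mono hBV).add (hTsmooth.smul contDiffOn_const)
  have hΦd (p) (hp : p ∈ B) (a) :
      fderiv ℝ Φ p a = fderiv ℝ φ p a + η p a • (Pi.single 0 1 : CoordSpace) := by
    have hd : HasFDerivAt Φ _ p := (hasFDerivAt_of_contDiffOn hVopen hφsmooth (hBV hp)).add
      ((hT p hp).smul (hasFDerivAt_const (Pi.single 0 1 : CoordSpace) p))
    rw [hd.fderiv]
    simp
  have hΦ1 (p) : Φ p 1 = φ p 1 := by simp [hΦ]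
  have hcof (p) (hp : p ∈ B) :
      CoframeCompat σ (godelCoframe H D p) (godelCoframe H' D' (Φ p)) (fderiv ℝ Φ p) := by
    obtain ⟨f0, f3, ff, fa⟩ := hflat p (hBV hp)
    refine ⟨fun a => ?_, fun a b => ?_, fun a b => ?_, fun a => ?_⟩
    · rw [hΦd p hp]
      simp [godelCoframe, hΦ1, hη, hpr, f0]
      ring
    · rw [hΦd p hp, hΦd p hp]
      simp [godelCoframe, hΦ1]
      linear_combination ff a b
    · rw [hΦd p hp, hΦd p hp]
      simp [godelCoframe, hΦ1]
      linear_combination fa a b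
    · rw [hΦd p hp]
      simp [godelCoframe, f3]
  have hΦ₀ : Φ p₀ = q₀ := by simp [hΦ, hT₀, hφ₀]
  obtain ⟨V₁, hV₁B, hV₁, hpV₁, hV₁inj⟩ := exists_injOn_of_injective_fderiv hB hΦsmooth
    (fun p hp => (hcof p hp).injective hσ (hM.D_ne_zero p (hBV hp).1.1)) hpB
  have hV₁c : ContinuousOn Φ V₁ := hΦsmooth.continuousOn.mono hV₁B
  refine ⟨V₁ ∩ Φ ⁻¹' N.carrier, Φ, ?_, ⟨hpV₁, by simpa [hΦ₀] using hq₀⟩, hΦ₀⟩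
  refine hM.isAffineIsometryOn hN hσ (hV₁c.isOpen_inter_preimage hV₁ N.isOpen_carrier)
    (fun p hp => (hBV (hV₁B hp.1)).1.1) (fun p hp => hp.2) (hV₁inj.mono Set.inter_subset_left)
    (hΦsmooth.mono fun p hp => hV₁B hp.1) (fun p hp => ?_) fun p hp => hcof p (hV₁B hp.1)
  rw [hPN.torsion _ hp.2, hPM.torsion p (hBV (hV₁B hp.1)).1.1]

-- Smooth dependence of flows on time and initial point, by the implicit function theorem.

universe u

section Superposition

variable {K : Type*} [TopologicalSpace K] [CompactSpace K]
variable {E : Type*} [NormedAddCommGroup E] [NormedSpace ℝ E]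

/-- Pointwise application of a continuous family of operators. -/
noncomputable def pointwiseApplyₗ (F : Type*) [NormedAddCommGroup F] [NormedSpace ℝ F] :
    C(K, E →L[ℝ] F) →ₗ[ℝ] C(K, E) →ₗ[ℝ] C(K, F) where
  toFun A :=
    { toFun := fun h => ⟨fun x => A x (h x), by fun_prop⟩
      map_add' := fun h h' => by ext x; simp
      map_smul' := fun r h => by ext x; simp }
  map_add' A A' := by ext h x; simp
  map_smul' r A := by ext h x; simp

theorem norm_pointwiseApplyₗ_le {F : Type*} [NormedAddCommGroup F] [NormedSpace ℝ F]
    (A : C(K, E →L[ℝ] F)) (h : C(K, E)) : ‖pointwiseApplyₗ F A h‖ ≤ 1 * ‖A‖ * ‖h‖ := by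
  rw [ContinuousMap.norm_le _ (by positivity), one_mul]
  exact fun x => (A x).le_of_opNorm_le_of_le (A.norm_coe_le_norm x) (h.norm_coe_le_norm x)

/-- Pointwise application of a continuous family of operators, as a continuous bilinear map. -/
noncomputable def pointwiseApplyL (F : Type*) [NormedAddCommGroup F] [NormedSpace ℝ F] :
    C(K, E →L[ℝ] F) →L[ℝ] C(K, E) →L[ℝ] C(K, F) :=
  LinearMap.mkContinuous₂ (𝕜 := ℝ) (𝕜₂ := ℝ) (𝕜₃ := ℝ) (σ₁₃ := RingHom.id ℝ)
    (σ₂₃ := RingHom.id ℝ) (E := C(K, E →L[ℝ] F)) (F := C(K, E)) (G := C(K, F))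
    (pointwiseApplyₗ F) 1 fun A h => norm_pointwiseApplyₗ_le A h

/-- The differential of a superposition operator. -/
theorem hasFDerivAt_superposition {F : Type*} [NormedAddCommGroup F] [NormedSpace ℝ F]
    {g : C(E, F)} {g' : C(E, E →L[ℝ] F)} (hg : ∀ x, HasFDerivAt g (g' x) x) (f : C(K, E)) :
    HasFDerivAt (fun f : C(K, E) => g.comp f) (pointwiseApplyL F (g'.comp f)) f := by
  rw [hasFDerivAt_iff_isLittleO, Asymptotics.isLittleO_iff]
  intro ε hε
  have hc : ContinuousAt (fun f : C(K, E) => g'.comp f) f :=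
    (ContinuousMap.continuous_postcomp g').continuousAt
  obtain ⟨δ, hδ, hball⟩ := (Metric.continuousAt_iff (α := C(K, E)) (β := C(K, E →L[ℝ] F))).1 hc ε hε
  filter_upwards [Metric.ball_mem_nhds f hδ] with f₁ hf₁
  rw [ContinuousMap.norm_le _ (by positivity)]
  intro x
  have hx : ‖g (f₁ x) - g (f x) - g' (f x) (f₁ x - f x)‖ ≤ ε * ‖f₁ x - f x‖ := by
    refine (convex_segment (f x) (f₁ x)).norm_image_sub_le_of_norm_hasFDerivWithin_le'
      (fun y _ => (hg y).hasFDerivWithinAt) ?_ (left_mem_segment ℝ _ _) (right_mem_segment ℝ _ _)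
    rintro _ ⟨a, b, ha, hb, hab, rfl⟩
    have h1 : dist (f + b • (f₁ - f)) f < δ := by
      rw [dist_eq_norm, add_sub_cancel_left, norm_smul, ← dist_eq_norm, Real.norm_of_nonneg hb]
      exact (mul_le_of_le_one_left dist_nonneg (by linarith)).trans_lt hf₁
    have h2 := (ContinuousMap.dist_lt_iff hε).1 (hball h1) x
    rw [dist_eq_norm] at h2
    have h3 : a • f x + b • f₁ x = (f + b • (f₁ - f)) x := by
      obtain rfl : a = 1 - b := by linarith
      simp [sub_smul, smul_sub]
      abel
    rw [h3]
    exact h2.le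
  exact hx.trans (mul_le_mul_of_nonneg_left ((f₁ - f).norm_coe_le_norm x) hε.le)

/-- The derivative is the superposition operator of g' followed by a continuous linear map, so
induction on n works. The target F must vary because g' has values in `E →L[ℝ] F`, and the common
universe lets the induction hypothesis apply to it. -/
theorem contDiff_superposition_nat {E : Type u} [NormedAddCommGroup E] [NormedSpace ℝ E] (n : ℕ) :
    ∀ {F : Type u} [NormedAddCommGroup F] [NormedSpace ℝ F] (g : C(E, F)),
      ContDiff ℝ ∞ g → ContDiff ℝ n (fun f : C(K, E) => g.comp f) := by
  induction n with
  | zero => exact fun g _ => contDiff_zero.2 (ContinuousMap.continuous_postcomp g)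
  | succ n ih =>
    intro F _ _ g hg
    have hg' : ContDiff ℝ ∞ (fderiv ℝ g) := hg.fderiv_right (by simp)
    refine contDiff_succ_iff_hasFDerivAt.2
      ⟨fun f => pointwiseApplyL F
        ((⟨fderiv ℝ g, hg'.continuous⟩ : C(E, E →L[ℝ] F)).comp f), ?_,
      hasFDerivAt_superposition fun x => ((hg.differentiable (by simp)) x).hasFDerivAt⟩
    exact (pointwiseApplyL F).contDiff.comp
      (ih (⟨fderiv ℝ g, hg'.continuous⟩ : C(E, E →L[ℝ] F)) hg')

theorem contDiff_superposition (g : C(E, E)) (hg : ContDiff ℝ ∞ g) :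
    ContDiff ℝ ∞ (fun f : C(K, E) => g.comp f) :=
  contDiff_infty.2 fun n => contDiff_superposition_nat n g hg

end Superposition

section Flow

variable {E : Type*} [NormedAddCommGroup E] [NormedSpace ℝ E] [CompleteSpace E]

/-- The primitive vanishing at `0` of a continuous function on the unit interval. -/
noncomputable def unitPrimitiveL (E : Type*) [NormedAddCommGroup E] [NormedSpace ℝ E]
    [CompleteSpace E] : C(Set.Icc (0 : ℝ) 1, E) →L[ℝ] C(Set.Icc (0 : ℝ) 1, E) :=
  LinearMap.mkContinuous (
    { toFun := fun γ => ⟨fun r => ∫ τ in (0 : ℝ)..r, Set.IccExtend zero_le_one γ τ,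
        (intervalIntegral.continuous_primitive
          (fun a b => (γ.continuous.Icc_extend' (h := zero_le_one)).intervalIntegrable a b) 0).comp
          continuous_subtype_val⟩
      map_add' := fun γ γ' => by
        ext r
        exact intervalIntegral.integral_add
          ((γ.continuous.Icc_extend' (h := zero_le_one)).intervalIntegrable _ _)
          ((γ'.continuous.Icc_extend' (h := zero_le_one)).intervalIntegrable _ _)
      map_smul' := fun c γ => by
        ext r
        exact intervalIntegral.integral_smul c _ } :
      C(Set.Icc (0 : ℝ) 1, E) →ₗ[ℝ] C(Set.Icc (0 : ℝ) 1, E)) 1 (by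
    intro γ
    rw [ContinuousMap.norm_le _ (by positivity), one_mul]
    intro r
    refine (intervalIntegral.norm_integral_le_of_norm_le_const (C := ‖γ‖)
      fun x _ => γ.norm_coe_le_norm _).trans ?_
    rw [sub_zero, abs_of_nonneg r.2.1]
    exact mul_le_of_le_one_right (norm_nonneg _) r.2.2)

theorem unitPrimitiveL_apply (γ : C(Set.Icc (0 : ℝ) 1, E)) (r : Set.Icc (0 : ℝ) 1) :
    unitPrimitiveL E γ r = ∫ τ in (0 : ℝ)..r, Set.IccExtend zero_le_one γ τ := rfl

theorem norm_unitPrimitiveL_le : ‖unitPrimitiveL E‖ ≤ 1 :=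
  LinearMap.mkContinuous_norm_le _ zero_le_one _

/-- The integral equation of the rescaled integral curves. -/
noncomputable def flowEquation (v : C(E, E)) (z : (ℝ × E) × C(Set.Icc (0 : ℝ) 1, E)) :
    C(Set.Icc (0 : ℝ) 1, E) :=
  z.2 - ContinuousLinearMap.const ℝ (Set.Icc (0 : ℝ) 1) z.1.2
    - z.1.1 • unitPrimitiveL E (v.comp z.2)

theorem contDiff_flowEquation {v : C(E, E)} (hv : ContDiff ℝ ∞ v) :
    ContDiff ℝ ∞ (flowEquation v) := by
  have h1 : ContDiff ℝ ∞ fun z : (ℝ × E) × C(Set.Icc (0 : ℝ) 1, E) =>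
      unitPrimitiveL E (v.comp z.2) :=
    (unitPrimitiveL E).contDiff.comp ((contDiff_superposition v hv).comp contDiff_snd)
  have h2 : ContDiff ℝ ∞ fun z : (ℝ × E) × C(Set.Icc (0 : ℝ) 1, E) =>
      ContinuousLinearMap.const ℝ (Set.Icc (0 : ℝ) 1) z.1.2 :=
    (ContinuousLinearMap.contDiff _).comp (contDiff_snd.comp contDiff_fst)
  exact (contDiff_snd.sub h2).sub ((contDiff_fst.comp contDiff_fst).smul h1)

/-- The partial derivative in the curve is 1 − T, where T multiplies by the time, integrates and
applies Dv. Its norm is at most |s| C < 1, so the Neumann series inverts 1 − T. -/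
theorem isInvertible_fderiv_flowEquation {v : C(E, E)} (hv : ContDiff ℝ ∞ v) {C : ℝ}
    (hC : ∀ x, ‖fderiv ℝ v x‖ ≤ C) (z : (ℝ × E) × C(Set.Icc (0 : ℝ) 1, E))
    (hz : |z.1.1| * C < 1) :
    (fderiv ℝ (flowEquation v) z ∘L .inr ℝ (ℝ × E) C(Set.Icc (0 : ℝ) 1, E)).IsInvertible := by
  set v' : C(E, E →L[ℝ] E) := ⟨fderiv ℝ v, (hv.fderiv_right (m := ∞) (by simp)).continuous⟩ with hv'
  set T := z.1.1 • (unitPrimitiveL E ∘L pointwiseApplyL E (v'.comp z.2)) with hT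
  have hC0 : 0 ≤ C := (norm_nonneg _).trans (hC 0)
  have h1 : HasFDerivAt (fun γ => flowEquation v (z.1, γ)) (1 - T) z.2 := by
    have d := hasFDerivAt_superposition (g := v) (g' := v')
      (fun x => (hv.differentiable (by simp) x).hasFDerivAt) z.2
    have d1 : HasFDerivAt (fun γ : C(Set.Icc (0 : ℝ) 1, E) =>
        γ - ContinuousLinearMap.const ℝ (Set.Icc (0 : ℝ) 1) z.1.2)
        (ContinuousLinearMap.id ℝ _) z.2 := (hasFDerivAt_id z.2).sub_const _
    have d2 : HasFDerivAt (fun γ : C(Set.Icc (0 : ℝ) 1, E) =>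
        z.1.1 • unitPrimitiveL E (v.comp γ)) T z.2 :=
      ((unitPrimitiveL E).hasFDerivAt.comp z.2 d).const_smul z.1.1
    exact d1.sub d2
  have h2 : HasFDerivAt (fun γ => flowEquation v (z.1, γ))
      (fderiv ℝ (flowEquation v) z ∘L .inr ℝ (ℝ × E) C(Set.Icc (0 : ℝ) 1, E)) z.2 := by
    have d1 : HasFDerivAt (fun γ : C(Set.Icc (0 : ℝ) 1, E) => (z.1, γ))
      (.inr ℝ (ℝ × E) C(Set.Icc (0 : ℝ) 1, E)) z.2 := hasFDerivAt_prodMk_right z.1 z.2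
    have d2 : HasFDerivAt (flowEquation v) (fderiv ℝ (flowEquation v) z) (z.1, z.2) :=
      ((contDiff_flowEquation hv).differentiable (by simp) z).hasFDerivAt
    exact d2.comp z.2 d1
  rw [← h1.unique h2]
  have h3 : ‖pointwiseApplyL E (v'.comp z.2)‖ ≤ C := by
    refine ContinuousLinearMap.opNorm_le_bound _ hC0 fun h => ?_
    rw [ContinuousMap.norm_le _ (by positivity)]
    exact fun x => (v'.comp z.2 x).le_of_opNorm_le_of_le (hC _) (h.norm_coe_le_norm x)
  have hT1 : ‖T‖ < 1 := by
    refine lt_of_le_of_lt (ContinuousLinearMap.opNorm_le_bound _ (by positivity) fun h => ?_) hz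
    calc ‖z.1.1 • unitPrimitiveL E (pointwiseApplyL E (v'.comp z.2) h)‖
        = |z.1.1| * ‖unitPrimitiveL E (pointwiseApplyL E (v'.comp z.2) h)‖ := norm_smul _ _
      _ ≤ |z.1.1| * (1 * (C * ‖h‖)) := by
        gcongr
        exact (unitPrimitiveL E).le_of_opNorm_le_of_le norm_unitPrimitiveL_le
          ((pointwiseApplyL E (v'.comp z.2)).le_of_opNorm_le h3 h)
      _ = |z.1.1| * C * ‖h‖ := by ring
  exact ⟨ContinuousLinearEquiv.unitsEquiv ℝ _ (Units.oneSub T hT1), rfl⟩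

/-- A local flow of a smooth vector field of compact support is smooth. -/
theorem contDiffOn_flow_of_lipschitz {v : C(E, E)} (hv : ContDiff ℝ ∞ v) {C L : ℝ}
    (hC : ∀ x, ‖fderiv ℝ v x‖ ≤ C) (hL : ∀ x, ‖v x‖ ≤ L) {ε : ℝ} (hεC : ε * C < 1) {V : Set E}
    (hV : IsOpen V) {Φ : ℝ → E → E} (hΦ₀ : ∀ x ∈ V, Φ 0 x = x)
    (hΦ : ∀ s ∈ Set.Ioo (-ε) ε, ∀ x ∈ V, HasDerivAt (fun r => Φ r x) (v (Φ s x)) s)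
    {L' : ℝ} (hL' : ∀ s ∈ Set.Ioo (-ε) ε, ∀ x ∈ V, ∀ y ∈ V, ‖Φ s x - Φ s y‖ ≤ L' * ‖x - y‖) :
    ContDiffOn ℝ ∞ (Function.uncurry Φ) (Set.Ioo (-ε) ε ×ˢ V) := by
  classical
  have hmem {s r : ℝ} (hs : s ∈ Set.Ioo (-ε) ε) (hr : r ∈ Set.Icc (0 : ℝ) 1) :
      s * r ∈ Set.Ioo (-ε) ε := by
    have h1 : |s| < ε := abs_lt.2 hs
    have h2 : |s * r| ≤ |s| := by
      rw [abs_mul, abs_of_nonneg hr.1]; exact mul_le_of_le_one_right (abs_nonneg s) hr.2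
    exact abs_lt.1 (h2.trans_lt h1)
  have hcurve {s : ℝ} (hs : s ∈ Set.Ioo (-ε) ε) {x : E} (hx : x ∈ V) (r : ℝ)
      (hr : r ∈ Set.Icc (0 : ℝ) 1) :
      HasDerivAt (fun r => Φ (s * r) x) (s • v (Φ (s * r) x)) r := by
    have := (hΦ _ (hmem hs hr) x hx).scomp r ((hasDerivAt_id r).const_mul s)
    exact this.congr_deriv (by simp)
  have hcont {s : ℝ} (hs : s ∈ Set.Ioo (-ε) ε) {x : E} (hx : x ∈ V) :
      Continuous fun r : Set.Icc (0 : ℝ) 1 => Φ (s * r) x :=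
    (continuousOn_iff_continuous_domRestrict.1
      fun r hr => (hcurve hs hx r hr).continuousAt.continuousWithinAt :)
  -- Rescaling integral curves to r ↦ Φ (s r) x puts them all on the unit interval and turns the
  -- time s into a parameter of the equation. The value 0 elsewhere only makes γ total.
  set γ : ℝ × E → C(Set.Icc (0 : ℝ) 1, E) := fun z =>
    if h : z.1 ∈ Set.Ioo (-ε) ε ∧ z.2 ∈ V then ⟨fun r => Φ (z.1 * r) z.2, hcont h.1 h.2⟩ else 0
    with hγ
  have hγ_apply {z : ℝ × E} (hz : z ∈ Set.Ioo (-ε) ε ×ˢ V) (r : Set.Icc (0 : ℝ) 1) :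
      γ z r = Φ (z.1 * r) z.2 := by
    have : z.1 ∈ Set.Ioo (-ε) ε ∧ z.2 ∈ V := hz
    simp only [hγ, dif_pos this]
    rfl
  have hopen : IsOpen (Set.Ioo (-ε) ε ×ˢ V) := isOpen_Ioo.prod hV
  have hsol {z : ℝ × E} (hz : z ∈ Set.Ioo (-ε) ε ×ˢ V) : flowEquation v (z, γ z) = 0 := by
    ext r
    have h1 : ∫ τ in (0 : ℝ)..r, z.1 • v (Φ (z.1 * τ) z.2) = Φ (z.1 * r) z.2 - Φ (z.1 * 0) z.2 := by
      have hsub : Set.uIcc (0 : ℝ) r ⊆ Set.Icc 0 1 := by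
        rw [Set.uIcc_of_le r.2.1]; exact Set.Icc_subset_Icc_right r.2.2
      refine intervalIntegral.integral_eq_sub_of_hasDerivAt
        (fun τ hτ => hcurve hz.1 hz.2 τ (hsub hτ)) (ContinuousOn.intervalIntegrable fun τ hτ => ?_)
      exact ((v.continuous.continuousAt.comp
        (hcurve hz.1 hz.2 τ (hsub hτ)).continuousAt).const_smul z.1).continuousWithinAt
    have h2 : ∫ τ in (0 : ℝ)..r, Set.IccExtend zero_le_one (v.comp (γ z)) τ
        = ∫ τ in (0 : ℝ)..r, v (Φ (z.1 * τ) z.2) := by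
      refine intervalIntegral.integral_congr fun τ hτ => ?_
      rw [Set.uIcc_of_le r.2.1] at hτ
      have hτ' : τ ∈ Set.Icc (0 : ℝ) 1 := ⟨hτ.1, hτ.2.trans r.2.2⟩
      simp only [Set.IccExtend_of_mem zero_le_one _ hτ', ContinuousMap.comp_apply, hγ_apply hz]
    rw [intervalIntegral.integral_smul, mul_zero, hΦ₀ _ hz.2] at h1
    change γ z r - z.2 - z.1 • unitPrimitiveL E (v.comp (γ z)) r = 0
    rw [unitPrimitiveL_apply, h2, h1, hγ_apply hz, sub_self]
  have hLip {z₁ : ℝ × E} (hz₁ : z₁ ∈ Set.Ioo (-ε) ε ×ˢ V) {z : ℝ × E}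
      (hz : z ∈ Set.Ioo (-ε) ε ×ˢ V) :
      dist (γ z) (γ z₁) ≤ L' * ‖z.2 - z₁.2‖ + L * ‖z.1 - z₁.1‖ := by
    have hL0 : 0 ≤ L := (norm_nonneg _).trans (hL 0)
    have key (r : Set.Icc (0 : ℝ) 1) :
        dist (γ z r) (γ z₁ r) ≤ L' * ‖z.2 - z₁.2‖ + L * ‖z.1 - z₁.1‖ := by
      rw [hγ_apply hz, hγ_apply hz₁, dist_eq_norm]
      have e1 := hL' _ (hmem hz.1 r.2) z.2 hz.2 z₁.2 hz₁.2
      have e2 : ‖Φ (z.1 * r) z₁.2 - Φ (z₁.1 * r) z₁.2‖ ≤ L * ‖z.1 * r - z₁.1 * r‖ :=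
        (convex_Ioo (-ε) ε).norm_image_sub_le_of_norm_hasDerivWithin_le
          (fun s hs => (hΦ s hs z₁.2 hz₁.2).hasDerivWithinAt) (fun s _ => hL _)
          (hmem hz₁.1 r.2) (hmem hz.1 r.2)
      have e3 : ‖z.1 * r - z₁.1 * r‖ ≤ ‖z.1 - z₁.1‖ := by
        rw [← sub_mul, norm_mul]
        exact mul_le_of_le_one_right (norm_nonneg _)
          (by rw [Real.norm_of_nonneg r.2.1]; exact r.2.2)
      calc _ ≤ ‖Φ (z.1 * r) z.2 - Φ (z.1 * r) z₁.2‖ + ‖Φ (z.1 * r) z₁.2 - Φ (z₁.1 * r) z₁.2‖ :=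
            norm_sub_le_norm_sub_add_norm_sub _ _ _
        _ ≤ _ := by
            have := mul_le_mul_of_nonneg_left e3 hL0
            linarith
    exact (ContinuousMap.dist_le ((dist_nonneg).trans (key ⟨0, by simp⟩))).2 key
  -- Continuity in the supremum norm keeps γ z in the neighbourhood where the implicit function is
  -- the only solution; the Lipschitz hypothesis on Φ is needed for this.
  have hγcont {z₁ : ℝ × E} (hz₁ : z₁ ∈ Set.Ioo (-ε) ε ×ˢ V) : ContinuousAt γ z₁ := by
    refine tendsto_iff_dist_tendsto_zero.2 (squeeze_zero' (Filter.Eventually.of_forall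
      fun _ => dist_nonneg) (Filter.eventually_of_mem (hopen.mem_nhds hz₁)
      fun z hz => hLip hz₁ hz) ?_)
    have : ContinuousAt (fun z : ℝ × E => L' * ‖z.2 - z₁.2‖ + L * ‖z.1 - z₁.1‖) z₁ := by
      fun_prop
    simpa [ContinuousAt] using this
  intro z₁ hz₁
  have hinv := isInvertible_fderiv_flowEquation hv hC (z₁, γ z₁) (by
    refine lt_of_le_of_lt ?_ hεC
    have hC0 : 0 ≤ C := (norm_nonneg _).trans (hC 0)
    gcongr
    exact (abs_lt.2 hz₁.1).le)
  have hF : ContDiffAt ℝ ∞ (flowEquation v) (z₁, γ z₁) := (contDiff_flowEquation hv).contDiffAt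
  have hψ := hF.contDiffAt_implicitFunction (by simp) hinv
  have hiff := hF.eventually_apply_eq_iff_implicitFunction (by simp) hinv
  have htend : Filter.Tendsto (fun z => (z, γ z)) (nhds z₁) (nhds (z₁, γ z₁)) :=
    continuousAt_id.prodMk (hγcont hz₁)
  set ψ := hF.implicitFunction (by simp) hinv
  have heq : ∀ᶠ z in nhds z₁, Function.uncurry Φ z = ψ z ⟨1, by simp⟩ := by
    filter_upwards [htend.eventually hiff, hopen.mem_nhds hz₁] with z h1 h2
    rw [h1.1 (by rw [hsol h2, hsol hz₁]), hγ_apply h2]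
    simp [Function.uncurry]
  have hev : ContDiff ℝ ∞ fun f : C(Set.Icc (0 : ℝ) 1, E) => f ⟨1, by simp⟩ :=
    ContinuousLinearMap.contDiff (E := C(Set.Icc (0 : ℝ) 1, E)) (ContinuousMap.evalCLM ℝ (⟨1, by simp⟩ : Set.Icc (0 : ℝ) 1))
  exact ((hev.contDiffAt.comp z₁ hψ).congr_of_eventuallyEq heq).contDiffWithinAt

end Flow

/-- A smooth vector field has a smooth local flow near each point. -/
theorem exists_smooth_flow {X : CoordSpace → CoordSpace} {U : Set CoordSpace} (hU : IsOpen U)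
    (hX : ContDiffOn ℝ ∞ X U) {p : CoordSpace} (hp : p ∈ U) :
    ∃ ε > (0 : ℝ), ∃ V ⊆ U, IsOpen V ∧ p ∈ V ∧ ∃ Φ : ℝ → CoordSpace → CoordSpace,
      ContDiffOn ℝ ∞ (Function.uncurry Φ) (Set.Ioo (-ε) ε ×ˢ V) ∧ (∀ q ∈ V, Φ 0 q = q) ∧
      (∀ s ∈ Set.Ioo (-ε) ε, ∀ q ∈ V, Φ s q ∈ U) ∧
      (∀ s ∈ Set.Ioo (-ε) ε, ∀ q ∈ V, HasDerivAt (fun r => Φ r q) (X (Φ s q)) s) ∧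
      ∀ s ∈ Set.Ioo (-ε) ε, Set.InjOn (Φ s) V := by
  obtain ⟨R, hR, hRU⟩ := Metric.nhds_basis_closedBall.mem_iff.1 (hU.mem_nhds hp)
  let b : ContDiffBump p := ⟨R / 2, R, by positivity, by linarith⟩
  -- The cut-off field is globally smooth with compact support, hence bounded with bounded
  -- derivative, and equals X on the ball of radius R/2.
  set v₀ : CoordSpace → CoordSpace := fun q => b q • X q with hv₀
  have hsupp : tsupport b ⊆ U := by rw [b.tsupport_eq]; exact hRU
  have hv : ContDiff ℝ ∞ v₀ := by
    refine contDiff_iff_contDiffAt.2 fun q => ?_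
    by_cases hq : q ∈ U
    · exact b.contDiff.contDiffAt.smul (hX.contDiffAt (hU.mem_nhds hq))
    · have h0 : b =ᶠ[nhds q] 0 := notMem_tsupport_iff_eventuallyEq.1 fun h => hq (hsupp h)
      refine (contDiffAt_const (c := (0 : CoordSpace))).congr_of_eventuallyEq ?_
      filter_upwards [h0] with y hy
      simp [hv₀, hy]
  have hcs : HasCompactSupport v₀ := b.hasCompactSupport.smul_right
  obtain ⟨C, hC⟩ := (hv.continuous_fderiv (by simp)).bounded_above_of_compact_support (hcs.fderiv (𝕜 := ℝ))
  obtain ⟨L, hL⟩ := hv.continuous.bounded_above_of_compact_support hcs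
  obtain ⟨ε₀, hε₀, a, r, L₁, K, hr, hpl⟩ :=
    IsPicardLindelof.of_contDiffAt_one (x₀ := p) (hv.contDiffAt.of_le (m := 1) (by simp))
  obtain ⟨α, hα, L', hL'⟩ :=
    (hpl 0).exists_forall_mem_closedBall_eq_hasDerivWithinAt_lipschitzOnWith
  have hC0 : 0 ≤ C := (norm_nonneg _).trans (hC 0)
  have hL0 : 0 ≤ L := (norm_nonneg _).trans (hL 0)
  -- The three bounds ensure existence of the curves, ε C < 1 for the Neumann series, and
  -- displacement at most R/4, so that curves starting within R/4 of p stay where the cut-off is 1.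
  set ε := min ε₀ (min (1 / (C + 1)) (R / 4 / (L + 1))) with hε
  have hε0 : 0 < ε := by positivity
  have hε1 : ε ≤ ε₀ := min_le_left _ _
  have hε2 : ε * C < 1 := by
    have h1 : ε ≤ 1 / (C + 1) := (min_le_right _ _).trans (min_le_left _ _)
    rw [le_div_iff₀ (by positivity)] at h1
    linarith
  have hε3 : L * ε ≤ R / 4 := by
    have h1 : ε ≤ R / 4 / (L + 1) := (min_le_right _ _).trans (min_le_right _ _)
    rw [le_div_iff₀ (by positivity)] at h1
    linarith
  set V := Metric.ball p (min r (R / 4)) with hV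
  have hVr {q} (hq : q ∈ V) : q ∈ Metric.closedBall p (r : ℝ) :=
    Metric.ball_subset_closedBall (Metric.ball_subset_ball (min_le_left _ _) hq)
  have hVR {q} (hq : q ∈ V) : dist q p < R / 4 :=
    Metric.ball_subset_ball (min_le_right _ _) hq
  set Φ : ℝ → CoordSpace → CoordSpace := fun s q => α q s with hΦ
  have hΦ₀ : ∀ q ∈ V, Φ 0 q = q := fun q hq => (hα q (hVr hq)).1
  have hd : ∀ s ∈ Set.Ioo (-ε) ε, ∀ q ∈ V, HasDerivAt (fun r => Φ r q) (v₀ (Φ s q)) s := by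
    intro s hs q hq
    have h1 : s ∈ Set.Ioo (0 - ε₀) (0 + ε₀) := ⟨by linarith [hs.1], by linarith [hs.2]⟩
    exact ((hα q (hVr hq)).2 s (Set.Ioo_subset_Icc_self h1)).hasDerivAt (Icc_mem_nhds h1.1 h1.2)
  have hLip : ∀ s ∈ Set.Ioo (-ε) ε, ∀ x ∈ V, ∀ y ∈ V, ‖Φ s x - Φ s y‖ ≤ L' * ‖x - y‖ := by
    intro s hs x hx y hy
    exact (hL' s ⟨by linarith [hs.1], by linarith [hs.2]⟩).norm_sub_le (hVr hx) (hVr hy)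
  have hsmooth := contDiffOn_flow_of_lipschitz (v := ⟨v₀, hv.continuous⟩) hv hC hL hε2
    Metric.isOpen_ball hΦ₀ hd hLip
  have hnear : ∀ s ∈ Set.Ioo (-ε) ε, ∀ q ∈ V, Φ s q ∈ Metric.closedBall p (R / 2) := by
    intro s hs q hq
    have h1 : ‖Φ s q - Φ 0 q‖ ≤ L * ‖s - 0‖ :=
      (convex_Ioo (-ε) ε).norm_image_sub_le_of_norm_hasDerivWithin_le
        (fun s hs => (hd s hs q hq).hasDerivWithinAt) (fun s _ => hL _)
        ⟨by linarith, hε0⟩ hs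
    rw [hΦ₀ q hq, ← dist_eq_norm, sub_zero, Real.norm_eq_abs] at h1
    have h2 : L * |s| ≤ L * ε := mul_le_mul_of_nonneg_left (abs_lt.2 hs).le hL0
    have h3 := dist_triangle (Φ s q) q p
    have h4 := hVR hq
    rw [Metric.mem_closedBall]
    linarith
  have hvX {q} (hq : q ∈ Metric.closedBall p (R / 2)) : v₀ q = X q := by
    simp [hv₀, b.one_of_mem_closedBall hq]
  have hsub : Metric.closedBall p (R / 2) ⊆ U :=
    (Metric.closedBall_subset_closedBall (by linarith)).trans hRU
  refine ⟨ε, hε0, V, fun q hq => hsub ?_, Metric.isOpen_ball, Metric.mem_ball_self (by positivity),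
    Φ, hsmooth, hΦ₀, fun s hs q hq => hsub (hnear s hs q hq), fun s hs q hq => ?_, ?_⟩
  · rw [Metric.mem_closedBall]; linarith [hVR hq]
  · rw [← hvX (hnear s hs q hq)]; exact hd s hs q hq
  · intro s hs q hq q' hq' he
    -- Two integral curves that meet at time s coincide on the whole interval, in particular at time
    -- 0.
    obtain ⟨K', hK'⟩ : ∃ K', LipschitzWith K' v₀ := ⟨⟨C, hC0⟩, lipschitzWith_of_nnnorm_fderiv_le
      (hv.differentiable (by simp)) hC⟩
    have h1 : Φ 0 q = Φ 0 q' := ODE_solution_unique_of_mem_Ioo (v := fun _ => v₀) (s := fun _ => Set.univ)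
      (fun _ _ => hK'.lipschitzOnWith) hs (fun t ht => ⟨hd t ht q hq, trivial⟩)
      (fun t ht => ⟨hd t ht q' hq', trivial⟩) he (show (0 : ℝ) ∈ _ from ⟨by linarith, hε0⟩)
    rwa [hΦ₀ q hq, hΦ₀ q' hq'] at h1

/-! ### Lie derivatives, brackets and invariance of forms under flows. -/

/-- The Lie derivative of a bilinear form `B` along a vector field `X`. -/
noncomputable def lieDerivForm (B : CoordSpace → CoordSpace →L[ℝ] CoordSpace →L[ℝ] ℝ)
    (X : CoordSpace → CoordSpace) (p u v : CoordSpace) : ℝ :=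
  fderiv ℝ B p (X p) u v + B p (fderiv ℝ X p u) v + B p u (fderiv ℝ X p v)

/-- The differential of a Lie bracket. -/
theorem fderiv_lieBracket {X Y : CoordSpace → CoordSpace} {U : Set CoordSpace} (hU : IsOpen U)
    (hX : ContDiffOn ℝ ∞ X U) (hY : ContDiffOn ℝ ∞ Y U) {p : CoordSpace} (hp : p ∈ U)
    (u : CoordSpace) : fderiv ℝ (VectorField.lieBracket ℝ X Y) p u
      = fderiv ℝ (fderiv ℝ Y) p u (X p) + fderiv ℝ Y p (fderiv ℝ X p u)
        - (fderiv ℝ (fderiv ℝ X) p u (Y p) + fderiv ℝ X p (fderiv ℝ Y p u)) := by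
  have h1 := (hasFDerivAt_fderiv_of_contDiffOn hU hY hp).clm_apply
    (hasFDerivAt_of_contDiffOn hU hX hp)
  have h2 := (hasFDerivAt_fderiv_of_contDiffOn hU hX hp).clm_apply
    (hasFDerivAt_of_contDiffOn hU hY hp)
  have h3 : HasFDerivAt (VectorField.lieBracket ℝ X Y) _ p := h1.sub h2
  rw [h3.fderiv]
  simp
  abel

-- This is the identity expressing the Lie derivative along [X, Y] as a commutator. The equation for
-- Y is differentiated along X and that for X along Y; in the difference the second derivatives of B
-- cancel and the remaining terms are the original equations with arguments moved by DX or DY.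
set_option maxSynthPendingDepth 3 in
theorem lieDerivForm_lieBracket {B : CoordSpace → CoordSpace →L[ℝ] CoordSpace →L[ℝ] ℝ}
    {X Y : CoordSpace → CoordSpace} {U : Set CoordSpace} (hU : IsOpen U)
    (hB : ContDiffOn ℝ ∞ B U) (hX : ContDiffOn ℝ ∞ X U) (hY : ContDiffOn ℝ ∞ Y U)
    (hBX : ∀ p ∈ U, ∀ u v, lieDerivForm B X p u v = 0)
    (hBY : ∀ p ∈ U, ∀ u v, lieDerivForm B Y p u v = 0) :
    ∀ p ∈ U, ∀ u v, lieDerivForm B (VectorField.lieBracket ℝ X Y) p u v = 0 := by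
  intro p hp u v
  have key {Y : CoordSpace → CoordSpace} (hY : ContDiffOn ℝ ∞ Y U)
      (hBY : ∀ p ∈ U, ∀ u v, lieDerivForm B Y p u v = 0) (x : CoordSpace) :
      fderiv ℝ (fderiv ℝ B) p x (Y p) u v + fderiv ℝ B p (fderiv ℝ Y p x) u v
        + fderiv ℝ B p x (fderiv ℝ Y p u) v + B p (fderiv ℝ (fderiv ℝ Y) p x u) v
        + fderiv ℝ B p x u (fderiv ℝ Y p v) + B p u (fderiv ℝ (fderiv ℝ Y) p x v) = 0 := by
    have dB := hasFDerivAt_of_contDiffOn hU hB hp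
    have dB' := hasFDerivAt_fderiv_of_contDiffOn hU hB hp
    have dY := hasFDerivAt_of_contDiffOn hU hY hp
    have dY' := hasFDerivAt_fderiv_of_contDiffOn hU hY hp
    have cu := hasFDerivAt_const (𝕜 := ℝ) u p
    have cv := hasFDerivAt_const (𝕜 := ℝ) v p
    have h1 := (((dB'.clm_apply dY).clm_apply cu).clm_apply cv).add
      ((dB.clm_apply (dY'.clm_apply cu)).clm_apply cv)
    have h2 := h1.add ((dB.clm_apply cu).clm_apply (dY'.clm_apply cv))
    have h3 := h2.congr_of_eventuallyEq (f₁ := fun _ => (0 : ℝ))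
      (Filter.eventually_of_mem (hU.mem_nhds hp) fun q hq => (hBY q hq u v).symm)
    have h4 := DFunLike.congr_fun (h3.unique (hasFDerivAt_const 0 p)) x
    simp at h4
    linarith
  have hX1 := key hX hBX (Y p)
  have hY1 := key hY hBY (X p)
  have e1 := hBX p hp (fderiv ℝ Y p u) v
  have e2 := hBX p hp u (fderiv ℝ Y p v)
  have e3 := hBY p hp (fderiv ℝ X p u) v
  have e4 := hBY p hp u (fderiv ℝ X p v)
  have s1 := fderiv_fderiv_symm_of_contDiffOn hU hB hp (X p) (Y p)
  have s2 (w) := fderiv_fderiv_symm_of_contDiffOn hU hX hp (Y p) w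
  have s3 (w) := fderiv_fderiv_symm_of_contDiffOn hU hY hp (X p) w
  simp only [lieDerivForm] at e1 e2 e3 e4 ⊢
  simp only [fderiv_lieBracket hU hX hY hp, VectorField.lieBracket, map_sub, map_add, add_apply,
    sub_apply]
  rw [s1, s3, s3] at hY1
  rw [s2, s2] at hX1
  linarith

/-- The variational equation of a smooth flow. -/
theorem hasDerivAt_fderiv_flow {X : CoordSpace → CoordSpace} {U V : Set CoordSpace} (hU : IsOpen U)
    (hX : ContDiffOn ℝ ∞ X U) (hV : IsOpen V) {ε : ℝ} {Φ : ℝ → CoordSpace → CoordSpace}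
    (hΦ : ContDiffOn ℝ ∞ (Function.uncurry Φ) (Set.Ioo (-ε) ε ×ˢ V))
    (hΦU : ∀ s ∈ Set.Ioo (-ε) ε, ∀ q ∈ V, Φ s q ∈ U)
    (hd : ∀ s ∈ Set.Ioo (-ε) ε, ∀ q ∈ V, HasDerivAt (fun r => Φ r q) (X (Φ s q)) s)
    {s : ℝ} (hs : s ∈ Set.Ioo (-ε) ε) {q : CoordSpace} (hq : q ∈ V) (u : CoordSpace) :
    HasDerivAt (fun r => fderiv ℝ (Φ r) q u) (fderiv ℝ X (Φ s q) (fderiv ℝ (Φ s) q u)) s := by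
  set Ψ := Function.uncurry Φ with hΨ
  have hopen : IsOpen (Set.Ioo (-ε) ε ×ˢ V) := isOpen_Ioo.prod hV
  have hslice {r : ℝ} (hr : r ∈ Set.Ioo (-ε) ε) (w : CoordSpace) :
      fderiv ℝ (Φ r) q w = fderiv ℝ Ψ (r, q) (0, w) := by
    have h1 : HasFDerivAt (Φ r) (fderiv ℝ Ψ (r, q) ∘L .inr ℝ ℝ CoordSpace) q :=
      (hasFDerivAt_of_contDiffOn hopen hΦ (Set.mk_mem_prod hr hq)).comp q
        (hasFDerivAt_prodMk_right r q)
    rw [h1.fderiv]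
    simp
  have htime {z : ℝ × CoordSpace} (hz : z ∈ Set.Ioo (-ε) ε ×ˢ V) :
      fderiv ℝ Ψ z (1, 0) = X (Ψ z) := by
    have h1 : HasFDerivAt (fun r => Φ r z.2) (fderiv ℝ Ψ z ∘L .inl ℝ ℝ CoordSpace) z.1 := by
      have h0 : HasFDerivAt Ψ (fderiv ℝ Ψ z) (z.1, z.2) := hasFDerivAt_of_contDiffOn hopen hΦ hz
      have h1 : HasFDerivAt (fun r : ℝ => (r, z.2)) (.inl ℝ ℝ CoordSpace) z.1 :=
        hasFDerivAt_prodMk_left z.1 z.2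
      exact h0.comp z.1 h1
    have h2 := h1.hasDerivAt.unique (hd z.1 hz.1 z.2 hz.2)
    change fderiv ℝ Ψ z (1, 0) = X (Φ z.1 z.2)
    simpa using h2
  have hz : (s, q) ∈ Set.Ioo (-ε) ε ×ˢ V := ⟨hs, hq⟩
  have h1 := hasFDerivAt_fderiv_of_contDiffOn hopen hΦ hz
  have h2 : HasDerivAt (fun r => fderiv ℝ Ψ (r, q)) (fderiv ℝ (fderiv ℝ Ψ) (s, q) (1, 0)) s := by
    have := h1.comp_hasDerivAt s ((hasDerivAt_id s).prodMk (hasDerivAt_const s q))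
    exact this
  have h3 := h2.clm_apply (hasDerivAt_const s ((0 : ℝ), u))
  refine (h3.congr_of_eventuallyEq (Filter.eventually_of_mem (isOpen_Ioo.mem_nhds hs)
    fun r hr => hslice hr u)).congr_deriv ?_
  have h4 := (h1.clm_apply (hasFDerivAt_const ((1 : ℝ), (0 : CoordSpace)) (s, q)))
  have h5 : HasFDerivAt (fun z => X (Ψ z)) _ (s, q) :=
    (hasFDerivAt_of_contDiffOn hU hX (hΦU s hs q hq)).comp (s, q)
      (hasFDerivAt_of_contDiffOn hopen hΦ hz)
  have h6 := DFunLike.congr_fun (h5.unique (h4.congr_of_eventuallyEq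
    (Filter.eventually_of_mem (hopen.mem_nhds hz) fun z hz => (htime hz).symm))) ((0 : ℝ), u)
  rw [hslice hs]
  simp only [map_zero, add_zero, ContinuousLinearMap.comp_apply, ContinuousLinearMap.flip_apply,
    add_apply, zero_apply, zero_add] at h6 ⊢
  rw [fderiv_fderiv_symm_of_contDiffOn hopen hΦ hz, ← h6]

theorem hasDerivAt_form_flow {B : CoordSpace → CoordSpace →L[ℝ] CoordSpace →L[ℝ] ℝ}
    {X : CoordSpace → CoordSpace} {U V : Set CoordSpace} (hU : IsOpen U)
    (hB : ContDiffOn ℝ ∞ B U)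
    (hX : ContDiffOn ℝ ∞ X U) (hV : IsOpen V) {ε : ℝ} {Φ : ℝ → CoordSpace → CoordSpace}
    (hΦ : ContDiffOn ℝ ∞ (Function.uncurry Φ) (Set.Ioo (-ε) ε ×ˢ V))
    (hΦU : ∀ s ∈ Set.Ioo (-ε) ε, ∀ q ∈ V, Φ s q ∈ U)
    (hd : ∀ s ∈ Set.Ioo (-ε) ε, ∀ q ∈ V, HasDerivAt (fun r => Φ r q) (X (Φ s q)) s)
    {s : ℝ} (hs : s ∈ Set.Ioo (-ε) ε) {q : CoordSpace} (hq : q ∈ V) (u v : CoordSpace) :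
    HasDerivAt (fun r => B (Φ r q) (fderiv ℝ (Φ r) q u) (fderiv ℝ (Φ r) q v))
      (lieDerivForm B X (Φ s q) (fderiv ℝ (Φ s) q u) (fderiv ℝ (Φ s) q v)) s := by
  have dB := (hasFDerivAt_of_contDiffOn hU hB (hΦU s hs q hq)).comp_hasDerivAt s (hd s hs q hq)
  have du := hasDerivAt_fderiv_flow hU hX hV hΦ hΦU hd hs hq u
  have dv := hasDerivAt_fderiv_flow hU hX hV hΦ hΦU hd hs hq v
  exact (dB.clm_apply du).clm_apply dv

theorem fderiv_flow_zero {V : Set CoordSpace} (hV : IsOpen V) {Φ : ℝ → CoordSpace → CoordSpace}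
    (hΦ₀ : ∀ q ∈ V, Φ 0 q = q) {q : CoordSpace} (hq : q ∈ V) (u : CoordSpace) :
    fderiv ℝ (Φ 0) q u = u := by
  have h1 : HasFDerivAt (Φ 0) (ContinuousLinearMap.id ℝ CoordSpace) q :=
    (hasFDerivAt_id q).congr_of_eventuallyEq
      (Filter.eventually_of_mem (hV.mem_nhds hq) fun r hr => hΦ₀ r hr)
  rw [h1.fderiv]
  rfl

/-- The flow of `X` preserves a form whose Lie derivative along `X` vanishes. -/
theorem form_flow_eq {B : CoordSpace → CoordSpace →L[ℝ] CoordSpace →L[ℝ] ℝ}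
    {X : CoordSpace → CoordSpace} {U V : Set CoordSpace} (hU : IsOpen U)
    (hB : ContDiffOn ℝ ∞ B U)
    (hX : ContDiffOn ℝ ∞ X U) (hV : IsOpen V) {ε : ℝ} {Φ : ℝ → CoordSpace → CoordSpace}
    (hΦ : ContDiffOn ℝ ∞ (Function.uncurry Φ) (Set.Ioo (-ε) ε ×ˢ V))
    (hΦU : ∀ s ∈ Set.Ioo (-ε) ε, ∀ q ∈ V, Φ s q ∈ U)
    (hd : ∀ s ∈ Set.Ioo (-ε) ε, ∀ q ∈ V, HasDerivAt (fun r => Φ r q) (X (Φ s q)) s)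
    (hΦ₀ : ∀ q ∈ V, Φ 0 q = q) (hBX : ∀ p ∈ U, ∀ u v, lieDerivForm B X p u v = 0)
    {s : ℝ} (hs : s ∈ Set.Ioo (-ε) ε) {q : CoordSpace} (hq : q ∈ V) (u v : CoordSpace) :
    B (Φ s q) (fderiv ℝ (Φ s) q u) (fderiv ℝ (Φ s) q v) = B q u v := by
  have h1 (r) (hr : r ∈ Set.Ioo (-ε) ε) := (hasDerivAt_form_flow hU hB hX hV hΦ hΦU hd hr hq
    u v).congr_deriv (hBX _ (hΦU r hr q hq) _ _)
  have h0 : (0 : ℝ) ∈ Set.Ioo (-ε) ε := ⟨by linarith [hs.1, hs.2], by linarith [hs.1, hs.2]⟩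
  have h2 := isOpen_Ioo.is_const_of_deriv_eq_zero isPreconnected_Ioo
    (fun r hr => (h1 r hr).differentiableAt.differentiableWithinAt)
    (fun r hr => (h1 r hr).deriv) hs h0
  rw [h2, hΦ₀ q hq, fderiv_flow_zero hV hΦ₀ hq, fderiv_flow_zero hV hΦ₀ hq]

/-! ### The Gödel-type forms and their Killing equations. -/

set_option maxSynthPendingDepth 3

/-- The bilinear form `dxⁱ ⊗ dxʲ`. -/
noncomputable def coordForm (i j : Fin 4) : CoordSpace →L[ℝ] CoordSpace →L[ℝ] ℝ :=
  (ContinuousLinearMap.proj i : CoordSpace →L[ℝ] ℝ).smulRight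
    (ContinuousLinearMap.proj j : CoordSpace →L[ℝ] ℝ)

@[simp] theorem coordForm_apply (i j : Fin 4) (u v : CoordSpace) : coordForm i j u v = u i * v j := by
  simp [coordForm]

/-- The form `ω⁰ ⊗ ω³`. -/
noncomputable def timeForm (H : ℝ → ℝ) (p : CoordSpace) : CoordSpace →L[ℝ] CoordSpace →L[ℝ] ℝ :=
  coordForm 0 3 + H (p 1) • coordForm 2 3

/-- The form `ω¹ ⊗ ω¹ + ω² ⊗ ω²`. -/
noncomputable def flatForm (D : ℝ → ℝ) (p : CoordSpace) : CoordSpace →L[ℝ] CoordSpace →L[ℝ] ℝ :=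
  coordForm 1 1 + D (p 1) ^ 2 • coordForm 2 2

/-- The form `ω¹ ∧ ω²`. -/
noncomputable def areaForm (D : ℝ → ℝ) (p : CoordSpace) : CoordSpace →L[ℝ] CoordSpace →L[ℝ] ℝ :=
  D (p 1) • (coordForm 1 2 - coordForm 2 1)

/-- The form `ω³ ⊗ ω³`. -/
noncomputable def heightForm (_ : CoordSpace) : CoordSpace →L[ℝ] CoordSpace →L[ℝ] ℝ :=
  coordForm 3 3

/-- The metric of Gödel type. -/
noncomputable def godelMetric (H D : ℝ → ℝ) (p : CoordSpace) :
    CoordSpace →L[ℝ] CoordSpace →L[ℝ] ℝ :=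
  coordForm 0 0 + H (p 1) • (coordForm 0 2 + coordForm 2 0)
    + (H (p 1) ^ 2 - D (p 1) ^ 2) • coordForm 2 2 - coordForm 1 1 - coordForm 3 3

theorem godelMetric_apply (H D : ℝ → ℝ) (p u v : CoordSpace) : godelMetric H D p u v =
    godelCoframe H D p u 0 * godelCoframe H D p v 0
      - godelCoframe H D p u 1 * godelCoframe H D p v 1
      - godelCoframe H D p u 2 * godelCoframe H D p v 2
      - godelCoframe H D p u 3 * godelCoframe H D p v 3 := by
  simp [godelMetric, godelCoframe]
  ring

section Derivatives

variable {H D : ℝ → ℝ} {H' D' : ℝ} {p : CoordSpace}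

theorem hasFDerivAt_timeForm (hH : HasDerivAt H H' (p 1)) :
    HasFDerivAt (timeForm H)
      ((H' • (ContinuousLinearMap.proj 1 : CoordSpace →L[ℝ] ℝ)).smulRight (coordForm 2 3)) p :=
  (hH.hasFDerivAt_coord.smul_const (coordForm 2 3)).const_add (coordForm 0 3)

theorem hasFDerivAt_flatForm (hD : HasDerivAt D D' (p 1)) :
    HasFDerivAt (flatForm D) (((2 * D (p 1) * D') •
      (ContinuousLinearMap.proj 1 : CoordSpace →L[ℝ] ℝ)).smulRight (coordForm 2 2)) p := by
  have h : HasDerivAt (fun x => D x ^ 2) (2 * D (p 1) * D') (p 1) := by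
    exact (hD.pow 2).congr_deriv (by simp)
  exact (h.hasFDerivAt_coord.smul_const (coordForm 2 2)).const_add (coordForm 1 1)

theorem hasFDerivAt_areaForm (hD : HasDerivAt D D' (p 1)) :
    HasFDerivAt (areaForm D) ((D' • (ContinuousLinearMap.proj 1 : CoordSpace →L[ℝ] ℝ)).smulRight
      (coordForm 1 2 - coordForm 2 1)) p :=
  hD.hasFDerivAt_coord.smul_const (coordForm 1 2 - coordForm 2 1)

theorem hasFDerivAt_godelMetric (hH : HasDerivAt H H' (p 1)) (hD : HasDerivAt D D' (p 1)) :
    HasFDerivAt (godelMetric H D)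
      ((H' • (ContinuousLinearMap.proj 1 : CoordSpace →L[ℝ] ℝ)).smulRight
          (coordForm 0 2 + coordForm 2 0)
        + ((2 * H (p 1) * H' - 2 * D (p 1) * D') •
          (ContinuousLinearMap.proj 1 : CoordSpace →L[ℝ] ℝ)).smulRight (coordForm 2 2)) p := by
  have h : HasDerivAt (fun x => H x ^ 2 - D x ^ 2) (2 * H (p 1) * H' - 2 * D (p 1) * D') (p 1) := by
    exact ((hH.pow 2).sub (hD.pow 2)).congr_deriv (by simp)
  exact ((((hH.hasFDerivAt_coord.smul_const (coordForm 0 2 + coordForm 2 0)).const_add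
    (coordForm 0 0)).add (h.hasFDerivAt_coord.smul_const (coordForm 2 2))).sub_const
    (coordForm 1 1)).sub_const (coordForm 3 3)

variable (X : CoordSpace → CoordSpace) (u v : CoordSpace)

theorem lieDerivForm_timeForm (hH : HasDerivAt H H' (p 1)) :
    lieDerivForm (timeForm H) X p u v =
      (fderiv ℝ X p u 0 + H (p 1) * fderiv ℝ X p u 2 + H' * X p 1 * u 2) * v 3
        + (u 0 + H (p 1) * u 2) * fderiv ℝ X p v 3 := by
  rw [lieDerivForm, (hasFDerivAt_timeForm hH).fderiv]
  simp [timeForm]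
  ring

theorem lieDerivForm_flatForm (hD : HasDerivAt D D' (p 1)) :
    lieDerivForm (flatForm D) X p u v =
      2 * D (p 1) * D' * X p 1 * (u 2 * v 2) + fderiv ℝ X p u 1 * v 1 + u 1 * fderiv ℝ X p v 1
        + D (p 1) ^ 2 * (fderiv ℝ X p u 2 * v 2 + u 2 * fderiv ℝ X p v 2) := by
  rw [lieDerivForm, (hasFDerivAt_flatForm hD).fderiv]
  simp [flatForm]
  ring

theorem lieDerivForm_areaForm (hD : HasDerivAt D D' (p 1)) :
    lieDerivForm (areaForm D) X p u v =
      D' * X p 1 * (u 1 * v 2 - u 2 * v 1)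
        + D (p 1) * (fderiv ℝ X p u 1 * v 2 - fderiv ℝ X p u 2 * v 1
          + u 1 * fderiv ℝ X p v 2 - u 2 * fderiv ℝ X p v 1) := by
  rw [lieDerivForm, (hasFDerivAt_areaForm hD).fderiv]
  simp [areaForm]
  ring

theorem lieDerivForm_heightForm :
    lieDerivForm heightForm X p u v = fderiv ℝ X p u 3 * v 3 + u 3 * fderiv ℝ X p v 3 := by
  have : HasFDerivAt (𝕜 := ℝ) heightForm 0 p := hasFDerivAt_const _ _
  rw [lieDerivForm, this.fderiv]
  simp [heightForm]

theorem lieDerivForm_godelMetric (hH : HasDerivAt H H' (p 1)) (hD : HasDerivAt D D' (p 1)) :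
    lieDerivForm (godelMetric H D) X p u v =
      (fderiv ℝ X p u 0 + H (p 1) * fderiv ℝ X p u 2 + H' * X p 1 * u 2) * (v 0 + H (p 1) * v 2)
        + (u 0 + H (p 1) * u 2)
          * (fderiv ℝ X p v 0 + H (p 1) * fderiv ℝ X p v 2 + H' * X p 1 * v 2)
        - (2 * D (p 1) * D' * X p 1 * (u 2 * v 2) + fderiv ℝ X p u 1 * v 1 + u 1 * fderiv ℝ X p v 1
        + D (p 1) ^ 2 * (fderiv ℝ X p u 2 * v 2 + u 2 * fderiv ℝ X p v 2))
        - (fderiv ℝ X p u 3 * v 3 + u 3 * fderiv ℝ X p v 3) := by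
  rw [lieDerivForm, (hasFDerivAt_godelMetric hH hD).fderiv]
  simp [godelMetric]
  ring

end Derivatives

/-- Expansion of a linear map on the coordinate space. -/
theorem clm_apply_eq_sum {E : Type*} [NormedAddCommGroup E] [NormedSpace ℝ E]
    (A : CoordSpace →L[ℝ] E) (u : CoordSpace) :
    A u = u 0 • A (Pi.single 0 1) + u 1 • A (Pi.single 1 1) + u 2 • A (Pi.single 2 1)
      + u 3 • A (Pi.single 3 1) := by
  conv_lhs => rw [← Finset.univ_sum_single u]
  rw [map_sum, Fin.sum_univ_four]
  have h (i : Fin 4) : (Pi.single i (u i) : CoordSpace) = u i • Pi.single i 1 := by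
    rw [← Pi.single_smul, smul_eq_mul, mul_one]
  simp only [h, map_smul]

/-- The infinitesimal motions of the coframe up to rotations of `ω¹` and `ω²`. -/
structure IsCoframeKilling (M : RCSpacetime) (H D : ℝ → ℝ) (X : CoordSpace → CoordSpace) :
    Prop where
  smooth : ContDiffOn ℝ ∞ X M.carrier
  eq_zero : ∀ p, p ∉ M.carrier → X p = 0
  time : ∀ p ∈ M.carrier, ∀ u v, lieDerivForm (timeForm H) X p u v = 0
  flat : ∀ p ∈ M.carrier, ∀ u v, lieDerivForm (flatForm D) X p u v = 0
  height : ∀ p ∈ M.carrier, ∀ u v, lieDerivForm heightForm X p u v = 0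

namespace IsGodelType

variable {M : RCSpacetime} {H D S : ℝ → ℝ} {X : CoordSpace → CoordSpace}

theorem contDiffOn_timeForm (hM : IsGodelType M H D S) :
    ContDiffOn ℝ ∞ (timeForm H) M.carrier :=
  contDiffOn_const.add (hM.smooth_H.comp_coord.smul contDiffOn_const)

theorem contDiffOn_flatForm (hM : IsGodelType M H D S) :
    ContDiffOn ℝ ∞ (flatForm D) M.carrier :=
  contDiffOn_const.add ((hM.smooth_D.comp_coord.pow 2).smul contDiffOn_const)

theorem contDiffOn_areaForm (hM : IsGodelType M H D S) :
    ContDiffOn ℝ ∞ (areaForm D) M.carrier :=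
  hM.smooth_D.comp_coord.smul contDiffOn_const

/-- The Killing equations in coordinates. -/
theorem isCoframeKilling_iff (hM : IsGodelType M H D S) :
    IsCoframeKilling M H D X ↔ ContDiffOn ℝ ∞ X M.carrier ∧ (∀ p, p ∉ M.carrier → X p = 0) ∧
      ∀ p ∈ M.carrier, ∃ q : ℝ, ∀ u, fderiv ℝ X p u 1 = q * u 2 ∧
        fderiv ℝ X p u 2 = -(q / D (p 1) ^ 2) * u 1 - X p 1 * (deriv D (p 1) / D (p 1)) * u 2 ∧
        fderiv ℝ X p u 3 = 0 ∧
        fderiv ℝ X p u 0 = -(H (p 1) * fderiv ℝ X p u 2) - deriv H (p 1) * X p 1 * u 2 := by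
  constructor
  · intro h
    refine ⟨h.smooth, h.eq_zero, fun p hp => ?_⟩
    have hD := hM.D_ne_zero p hp
    have h3 (u) : fderiv ℝ X p u 3 = 0 := by
      have e1 := h.height p hp (Pi.single 3 1) (Pi.single 3 1)
      have e2 := h.height p hp u (Pi.single 3 1)
      rw [lieDerivForm_heightForm] at e1 e2
      simp at e1 e2
      have e3 : fderiv ℝ X p (Pi.single 3 1) 3 = 0 := by linarith
      simpa [e3] using e2
    -- The Killing equations leave one entry of DX free once X is given: the infinitesimal rotation
    -- q = ∂_y X¹ of the surface.
    refine ⟨fderiv ℝ X p (Pi.single 2 1) 1, fun u => ?_⟩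
    have f (u v) := h.flat p hp u v
    simp only [lieDerivForm_flatForm X _ _ (hM.hasDerivAt_D hp)] at f
    have f11 := f (Pi.single 1 1) (Pi.single 1 1)
    have f12 := f (Pi.single 1 1) (Pi.single 2 1)
    have f22 := f (Pi.single 2 1) (Pi.single 2 1)
    have f01 := f (Pi.single 0 1) (Pi.single 1 1)
    have f02 := f (Pi.single 0 1) (Pi.single 2 1)
    have f31 := f (Pi.single 3 1) (Pi.single 1 1)
    have f32 := f (Pi.single 3 1) (Pi.single 2 1)
    simp [hD] at f11 f12 f22 f01 f02 f31 f32
    have a1 : fderiv ℝ X p (Pi.single 1 1) 1 = 0 := by linarith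
    have b1 : fderiv ℝ X p (Pi.single 1 1) 2 = -(fderiv ℝ X p (Pi.single 2 1) 1 / D (p 1) ^ 2) := by
      field_simp; linarith
    have b2 : fderiv ℝ X p (Pi.single 2 1) 2 = -(X p 1 * (deriv D (p 1) / D (p 1))) := by
      field_simp
      have : D (p 1) * (2 * D (p 1) * fderiv ℝ X p (Pi.single 2 1) 2 + 2 * X p 1 * deriv D (p 1))
        = 0 := by linarith
      have := (mul_eq_zero.1 this).resolve_left hD
      linarith
    refine ⟨?_, ?_, h3 u, ?_⟩
    · rw [clm_apply_eq_sum]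
      simp [a1, f01, f31]
      ring
    · rw [clm_apply_eq_sum]
      simp [b1, b2, f02, f32]
      ring
    -- ω⁰ is tensored with ω³ only to be handled as a bilinear form. As ω³ is already invariant,
    -- evaluating the second slot at ∂_z recovers the invariance of ω⁰ itself.
    · have e := h.time p hp u (Pi.single 3 1)
      rw [lieDerivForm_timeForm _ _ _ (hM.hasDerivAt_H hp), h3] at e
      simp at e
      linarith
  · rintro ⟨h1, h2, h3⟩
    refine ⟨h1, h2, fun p hp u v => ?_, fun p hp u v => ?_, fun p hp u v => ?_⟩ <;>
      obtain ⟨q, hq⟩ := h3 p hp <;> have hD := hM.D_ne_zero p hp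
    · rw [lieDerivForm_timeForm _ _ _ (hM.hasDerivAt_H hp), (hq v).2.2.1, (hq u).2.2.2]
      ring
    · rw [lieDerivForm_flatForm _ _ _ (hM.hasDerivAt_D hp), (hq v).2.1, (hq u).2.1, (hq u).1,
        (hq v).1]
      field_simp
      ring
    · rw [lieDerivForm_heightForm, (hq v).2.2.1, (hq u).2.2.1]
      ring

/-- An infinitesimal isometry of the surface has zero divergence: the diagonal entry −X¹ D'/D of DX
cancels the derivative of D. -/
theorem lieDerivForm_areaForm_eq_zero (hM : IsGodelType M H D S) (hX : IsCoframeKilling M H D X)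
    {p : CoordSpace} (hp : p ∈ M.carrier) (u v : CoordSpace) :
    lieDerivForm (areaForm D) X p u v = 0 := by
  obtain ⟨q, hq⟩ := (hM.isCoframeKilling_iff.1 hX).2.2 p hp
  have hD := hM.D_ne_zero p hp
  rw [lieDerivForm_areaForm _ _ _ (hM.hasDerivAt_D hp), (hq v).2.1, (hq u).2.1, (hq u).1, (hq v).1]
  field_simp
  ring

/-- Each condition is the vanishing of a Lie derivative, and these are stable under brackets by
`lieDerivForm_lieBracket`. -/
theorem isCoframeKilling_lieBracket (hM : IsGodelType M H D S) {Y : CoordSpace → CoordSpace}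
    (hX : IsCoframeKilling M H D X) (hY : IsCoframeKilling M H D Y) :
    IsCoframeKilling M H D (VectorField.lieBracket ℝ X Y) := by
  refine ⟨?_, fun p hp => VectorField.lieBracket_eq_zero_of_eq_zero (hX.eq_zero p hp)
    (hY.eq_zero p hp), ?_, ?_, ?_⟩
  · have h1 := hX.smooth.fderiv_of_isOpen (m := ∞) M.isOpen_carrier (by simp)
    have h2 := hY.smooth.fderiv_of_isOpen (m := ∞) M.isOpen_carrier (by simp)
    exact (h2.clm_apply hX.smooth).sub (h1.clm_apply hY.smooth)
  · exact lieDerivForm_lieBracket M.isOpen_carrier hM.contDiffOn_timeForm hX.smooth hY.smooth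
      hX.time hY.time
  · exact lieDerivForm_lieBracket M.isOpen_carrier hM.contDiffOn_flatForm hX.smooth hY.smooth
      hX.flat hY.flat
  · exact lieDerivForm_lieBracket M.isOpen_carrier contDiffOn_const hX.smooth hY.smooth
      hX.height hY.height

/-- The flow of an infinitesimal motion of the coframe consists of affine isometries. -/
theorem isMotionGenerator (hM : IsGodelType M H D S) {S₀ : ℝ} (hS : ∀ p ∈ M.carrier, S (p 3) = S₀)
    (hX : IsCoframeKilling M H D X) : IsMotionGenerator M X := by
  refine ⟨hX.smooth, hX.eq_zero, fun p hp => ?_⟩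
  obtain ⟨ε, hε, V, hVM, hV, hpV, Φ, hΦ, hΦ₀, hΦM, hd, hinj⟩ :=
    exists_smooth_flow M.isOpen_carrier hX.smooth hp
  refine ⟨ε, hε, V, hpV, Φ, hΦ, hΦ₀, hd, fun s hs => ?_⟩
  have hsl : ContDiffOn ℝ ∞ (Φ s) V :=
    hΦ.comp (contDiffOn_const.prodMk contDiffOn_id) fun q hq => ⟨hs, hq⟩
  refine hM.isAffineIsometryOn hM (σ := 1) (by norm_num) hV hVM (hΦM s hs) (hinj s hs) hsl
    (fun q hq => by rw [hS _ (hΦM s hs q hq), hS q (hVM hq), one_mul]) fun q hq => ?_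
  have height (u) : fderiv ℝ (Φ s) q u 3 = u 3 := by
    have h1 (r) (hr : r ∈ Set.Ioo (-ε) ε) : HasDerivAt (fun r => fderiv ℝ (Φ r) q u 3) 0 r := by
      refine (hasDerivAt_pi.1 (hasDerivAt_fderiv_flow M.isOpen_carrier hX.smooth hV hΦ hΦM hd hr
        hq u) 3).congr_deriv ?_
      obtain ⟨_, h⟩ := (hM.isCoframeKilling_iff.1 hX).2.2 _ (hΦM r hr q hq)
      exact (h _).2.2.1
    have h2 := isOpen_Ioo.is_const_of_deriv_eq_zero isPreconnected_Ioo
      (fun r hr => (h1 r hr).differentiableAt.differentiableWithinAt)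
      (fun r hr => (h1 r hr).deriv) hs (show (0 : ℝ) ∈ Set.Ioo (-ε) ε from ⟨by linarith, hε⟩)
    rw [h2, fderiv_flow_zero hV hΦ₀ hq]
  refine ⟨fun u => ?_, fun u v => ?_, fun u v => ?_, fun u => ?_⟩
  · have h := form_flow_eq M.isOpen_carrier hM.contDiffOn_timeForm hX.smooth hV hΦ hΦM hd hΦ₀
      hX.time hs hq u (Pi.single 3 1)
    simp [timeForm, height] at h
    simpa [godelCoframe] using h
  · have h := form_flow_eq M.isOpen_carrier hM.contDiffOn_flatForm hX.smooth hV hΦ hΦM hd hΦ₀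
      hX.flat hs hq u v
    simp [flatForm] at h
    simp [godelCoframe]
    linear_combination h
  · have h := form_flow_eq M.isOpen_carrier hM.contDiffOn_areaForm hX.smooth hV hΦ hΦM hd hΦ₀
      (fun p hp => hM.lieDerivForm_areaForm_eq_zero hX hp) hs hq u v
    simp [areaForm] at h
    simp [godelCoframe]
    linear_combination h
  · simpa [godelCoframe] using height u

end IsGodelType

/-! ### Torsion restricts the affine motions. -/

/-- Antisymmetrizing `map_conn` removes the second derivative of φ. -/
theorem IsAffineIsometryOn.map_torsion {M N : RCSpacetime} {V : Set CoordSpace}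
    {φ : CoordSpace → CoordSpace} (h : IsAffineIsometryOn M N V φ) {p : CoordSpace} (hp : p ∈ V)
    (u v : CoordSpace) : N.torsion (φ p) (fderiv ℝ φ p u) (fderiv ℝ φ p v)
      = fderiv ℝ φ p (M.torsion p u v) := by
  rw [RCSpacetime.torsion, RCSpacetime.torsion, map_sub, ← h.map_conn p hp, ← h.map_conn p hp,
    fderiv_fderiv_symm_of_contDiffOn h.isOpen_source h.smooth hp u v]
  abel

namespace IsGodelType

variable {M : RCSpacetime} {H D S : ℝ → ℝ} {X : CoordSpace → CoordSpace}

theorem metric_eq_godelMetric (hM : IsGodelType M H D S) {p : CoordSpace} (hp : p ∈ M.carrier) :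
    M.metric p = godelMetric H D p := by
  refine ContinuousLinearMap.ext fun u => ContinuousLinearMap.ext fun v => ?_
  rw [hM.metric_eq p hp, godelMetric_apply]

theorem contDiffOn_godelMetric (hM : IsGodelType M H D S) :
    ContDiffOn ℝ ∞ (godelMetric H D) M.carrier :=
  M.contDiffOn_metric.congr fun _ hp => (hM.metric_eq_godelMetric hp).symm

theorem torsion_eq_areaForm (hM : IsGodelType M H D S) {p : CoordSpace} (hp : p ∈ M.carrier)
    (u v : CoordSpace) :
    M.torsion p u v = (S (p 3) * areaForm D p u v) • (Pi.single 0 1 : CoordSpace) := by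
  rw [hM.torsion_eq p hp]
  congr 1
  simp [godelCoframe, areaForm]
  ring_nf
  simp

/-- In the presence of torsion, the affine motions preserve `ω⁰` and `ω³`. -/
theorem isCoframeKilling_of_isMotionGenerator (hM : IsGodelType M H D S) {S₀ : ℝ}
    (hS : ∀ p ∈ M.carrier, S (p 3) = S₀) (hS₀ : S₀ ≠ 0) (hX : IsMotionGenerator M X) :
    IsCoframeKilling M H D X := by
  -- Invariance of the metric and of S₀ (ω¹ ∧ ω²) ⊗ ∂_t under the flow is differentiated at time 0;
  -- S₀ ≠ 0 is cancelled.
  have key (p) (hp : p ∈ M.carrier) : (∀ u v, lieDerivForm (godelMetric H D) X p u v = 0) ∧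
      ∀ u v i, lieDerivForm (areaForm D) X p u v * (Pi.single 0 1 : CoordSpace) i
        = areaForm D p u v * fderiv ℝ X p (Pi.single 0 1) i := by
    obtain ⟨ε, hε, V, hpV, Φ, hΦ, hΦ₀, hd, hiso⟩ := hX.flow p hp
    have h0 : (0 : ℝ) ∈ Set.Ioo (-ε) ε := ⟨by linarith, hε⟩
    have hV := (hiso 0 h0).isOpen_source
    have hVM := (hiso 0 h0).source_subset
    have hΦM : ∀ s ∈ Set.Ioo (-ε) ε, ∀ q ∈ V, Φ s q ∈ M.carrier :=
      fun s hs q hq => (hiso s hs).mapsTo hq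
    have hF₀ := fderiv_flow_zero hV hΦ₀ hpV
    constructor
    · intro u v
      have h1 := hasDerivAt_form_flow M.isOpen_carrier hM.contDiffOn_godelMetric hX.smooth hV hΦ
        hΦM hd h0 hpV u v
      rw [hΦ₀ p hpV, hF₀, hF₀] at h1
      refine h1.unique ((hasDerivAt_const (0 : ℝ) (godelMetric H D p u v)).congr_of_eventuallyEq
        (Filter.eventually_of_mem (isOpen_Ioo.mem_nhds h0) fun r hr => ?_))
      change godelMetric H D (Φ r p) _ _ = godelMetric H D p u v
      rw [← hM.metric_eq_godelMetric (hΦM r hr p hpV), ← hM.metric_eq_godelMetric hp]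
      exact (hiso r hr).map_metric p hpV u v
    · intro u v i
      have h1 := (hasDerivAt_form_flow M.isOpen_carrier hM.contDiffOn_areaForm hX.smooth hV hΦ
        hΦM hd h0 hpV u v).mul_const ((Pi.single 0 1 : CoordSpace) i)
      have h2 := (hasDerivAt_pi.1 (hasDerivAt_fderiv_flow M.isOpen_carrier hX.smooth hV hΦ hΦM hd
        h0 hpV (Pi.single 0 1)) i).const_mul (areaForm D p u v)
      rw [hΦ₀ p hpV, hF₀, hF₀] at h1
      rw [hΦ₀ p hpV, hF₀] at h2
      refine h1.unique (h2.congr_of_eventuallyEq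
        (Filter.eventually_of_mem (isOpen_Ioo.mem_nhds h0) fun r hr => ?_))
      have h3 := congrFun ((hiso r hr).map_torsion hpV u v) i
      rw [hM.torsion_eq_areaForm (hΦM r hr p hpV), hM.torsion_eq_areaForm hp, map_smul,
        hS _ (hΦM r hr p hpV), hS p hp] at h3
      simp only [Pi.smul_apply, smul_eq_mul, mul_assoc] at h3
      exact mul_left_cancel₀ hS₀ h3
  have main (p) (hp : p ∈ M.carrier) :
      (∀ u, fderiv ℝ X p u 0 + H (p 1) * fderiv ℝ X p u 2 + deriv H (p 1) * X p 1 * u 2 = 0) ∧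
      (∀ u, fderiv ℝ X p u 3 = 0) := by
    obtain ⟨hg, ha⟩ := key p hp
    have hD := hM.D_ne_zero p hp
    have hdH := hM.hasDerivAt_H hp
    have hdD := hM.hasDerivAt_D hp
    -- Components 1, 2, 3 make DX(∂_t) parallel to ∂_t, and the constant unit length of ∂_t makes it
    -- zero. Contracting the metric with ∂_t then yields invariance of ω⁰.
    have a12 := ha (Pi.single 1 1) (Pi.single 2 1)
    have z1 := a12 1
    have z2 := a12 2
    have z3 := a12 3
    simp [areaForm, hD] at z1 z2 z3
    have g00 := hg (Pi.single 0 1) (Pi.single 0 1)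
    rw [lieDerivForm_godelMetric _ _ _ hdH hdD] at g00
    simp [z1, z2, z3] at g00
    have z0 : fderiv ℝ X p (Pi.single 0 1) 0 = 0 := by linarith
    have ht (u) : fderiv ℝ X p u 0 + H (p 1) * fderiv ℝ X p u 2 + deriv H (p 1) * X p 1 * u 2
        = 0 := by
      have g := hg (Pi.single 0 1) u
      rw [lieDerivForm_godelMetric _ _ _ hdH hdD] at g
      simpa [z0, z1, z2, z3] using g
    have al (u v) : lieDerivForm (areaForm D) X p u v = 0 := by
      simpa [z0] using ha u v 0
    -- Invariance of ω¹ ∧ ω² on pairs containing its null vector ∂_z removes the surface components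
    -- of DX(∂_z); the metric then makes ω³ invariant.
    have c1 := al (Pi.single 3 1) (Pi.single 2 1)
    have c2 := al (Pi.single 1 1) (Pi.single 3 1)
    rw [lieDerivForm_areaForm _ _ _ hdD] at c1 c2
    simp [hD] at c1 c2
    have g13 := hg (Pi.single 1 1) (Pi.single 3 1)
    have g23 := hg (Pi.single 2 1) (Pi.single 3 1)
    have g33 := hg (Pi.single 3 1) (Pi.single 3 1)
    simp only [lieDerivForm_godelMetric _ _ _ hdH hdD, ht] at g13 g23 g33
    simp [c1, c2] at g13 g23 g33
    refine ⟨ht, fun u => ?_⟩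
    rw [clm_apply_eq_sum]
    simp [z3, g13, g23]
    right
    linarith
  refine ⟨hX.smooth, hX.eq_zero, fun p hp u v => ?_, fun p hp u v => ?_, fun p hp u v => ?_⟩ <;>
    obtain ⟨m0, m3⟩ := main p hp
  · rw [lieDerivForm_timeForm _ _ _ (hM.hasDerivAt_H hp), m0, m3]
    ring
  · have h := (key p hp).1 u v
    rw [lieDerivForm_godelMetric _ _ _ (hM.hasDerivAt_H hp) (hM.hasDerivAt_D hp), m0, m0, m3, m3]
      at h
    rw [lieDerivForm_flatForm _ _ _ (hM.hasDerivAt_D hp)]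
    linarith
  · rw [lieDerivForm_heightForm, m3, m3]
    ring

end IsGodelType

/-! ### The transitive five-dimensional algebra. -/

namespace IsGodelType

variable {M : RCSpacetime} {H D S : ℝ → ℝ} {m2 w S₀ : ℝ}

/-- There is an infinitesimal motion of the coframe with prescribed value and rotation at a
point. -/
theorem exists_isCoframeKilling (hM : IsGodelType M H D S) (hP : HasParameters M H D S m2 w S₀)
    {p₀ : CoordSpace} (hp₀ : p₀ ∈ M.carrier) (v : CoordSpace) (q₀ : ℝ) :
    ∃ X, IsCoframeKilling M H D X ∧ X p₀ = v ∧ fderiv ℝ X p₀ (Pi.single 2 1) 1 = q₀ := by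
  classical
  obtain ⟨c, s, sv, hm⟩ := exists_genTrig (-m2)
  have hD₀ := hM.D_ne_zero p₀ hp₀
  obtain ⟨D₀, hD₀e⟩ : ∃ D₀, D (p₀ 1) = D₀ := ⟨_, rfl⟩
  obtain ⟨D₁, hD₁e⟩ : ∃ D₁, deriv D (p₀ 1) = D₁ := ⟨_, rfl⟩
  rw [hD₀e] at hD₀
  obtain ⟨k, hk⟩ : ∃ k, k = D₁ ^ 2 - m2 * D₀ ^ 2 := ⟨_, rfl⟩
  obtain ⟨C, Sn, Cv, hg⟩ := exists_genTrig k
  obtain ⟨x₀, hx₀⟩ : ∃ x₀, p₀ 1 = x₀ := ⟨_, rfl⟩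
  obtain ⟨y₀, hy₀⟩ : ∃ y₀, p₀ 2 = y₀ := ⟨_, rfl⟩
  have hDq (p) (hp : p ∈ M.carrier) := hM.D_eq hP hm hp₀ hp
  rw [hx₀] at hD₀e hD₁e
  simp only [hx₀, hD₀e, hD₁e] at hDq
  -- The ansatz integrates the Killing equations. The component a = X¹ solves a'' = −k a in y, with
  -- primitive A and derivative q, and E is a primitive of 1/D² in x. The component b = X² has b_x =
  -- −q/D² and b_y = −a D'/D, and g = ω⁰(X) satisfies dg = 2w D (b dx − a dy), that is, minus the
  -- contraction of dω⁰ with X.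
  let A : CoordSpace → ℝ := fun p => v 1 * Sn (p 2 - y₀) + q₀ * Cv (p 2 - y₀)
  let a : CoordSpace → ℝ := fun p => v 1 * C (p 2 - y₀) + q₀ * Sn (p 2 - y₀)
  let q : CoordSpace → ℝ := fun p => q₀ * C (p 2 - y₀) - k * v 1 * Sn (p 2 - y₀)
  let E : CoordSpace → ℝ := fun p => s (p 1 - x₀) / (D₀ * D (p 1))
  let b : CoordSpace → ℝ := fun p => v 2 - D₁ / D₀ * A p - q p * E p
  let g : CoordSpace → ℝ := fun p => v 2 * (H (p 1) - H x₀) + (v 0 + H x₀ * v 2)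
    - 2 * w * (D (p 1) * A p) - 2 * w * q₀ / D₀ * sv (p 1 - x₀)
  let Y : CoordSpace → CoordSpace := fun p => ![g p - H (p 1) * b p, a p, b p, v 3]
  have hsub {f : ℝ → ℝ} {f' y : ℝ} {i : Fin 4} {p : CoordSpace} (h : HasDerivAt f f' (p i - y)) :
      HasFDerivAt (fun p : CoordSpace => f (p i - y))
        (f' • (ContinuousLinearMap.proj (R := ℝ) i : CoordSpace →L[ℝ] ℝ)) p :=
    (h.comp_sub_const (p i) y).hasFDerivAt_coord
  have hA (p) : HasFDerivAt A (a p • ContinuousLinearMap.proj (R := ℝ) 2) p := by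
    refine (((hsub (hg.deriv_s _)).const_mul (v 1)).add
      ((hsub (hg.deriv_v _)).const_mul q₀)).congr_fderiv ?_
    ext i
    simp [a]
    ring
  have ha (p) : HasFDerivAt a (q p • ContinuousLinearMap.proj (R := ℝ) 2) p := by
    refine (((hsub (hg.deriv_c _)).const_mul (v 1)).add
      ((hsub (hg.deriv_s _)).const_mul q₀)).congr_fderiv ?_
    ext i
    simp [q]
    ring
  have hq (p) : HasFDerivAt q (-(k * a p) • ContinuousLinearMap.proj (R := ℝ) 2) p := by
    refine (((hsub (hg.deriv_c _)).const_mul q₀).sub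
      ((hsub (hg.deriv_s _)).const_mul (k * v 1))).congr_fderiv ?_
    ext i
    simp [a]
    ring
  have hE (p) (hp : p ∈ M.carrier) :
      HasFDerivAt E ((D (p 1) ^ 2)⁻¹ • ContinuousLinearMap.proj (R := ℝ) 1) p := by
    have hD := hM.D_ne_zero p hp
    have h1 : HasDerivAt (fun x => s (x - x₀) / (D₀ * D x)) ((D (p 1) ^ 2)⁻¹) (p 1) := by
      refine (((hm.deriv_s _).comp_sub_const (p 1) x₀).div
        ((hM.hasDerivAt_D hp).const_mul D₀) (mul_ne_zero hD₀ hD)).congr_deriv ?_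
      have h2 := hm.c_sq (p 1 - x₀)
      obtain ⟨e1, e2⟩ := hDq p hp
      field_simp
      rw [e2]
      nth_rewrite 1 [e1]
      linear_combination D₀ * h2
    exact h1.hasFDerivAt_coord
  have hb (p) (hp : p ∈ M.carrier) : HasFDerivAt b
      (-(q p / D (p 1) ^ 2) • (ContinuousLinearMap.proj (R := ℝ) 1 : CoordSpace →L[ℝ] ℝ)
        - (a p * (deriv D (p 1) / D (p 1))) • ContinuousLinearMap.proj (R := ℝ) 2) p := by
    have hD := hM.D_ne_zero p hp
    refine ((((hA p).const_mul (D₁ / D₀)).const_sub (v 2)).sub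
      ((hq p).mul (hE p hp))).congr_fderiv ?_
    have h1 : deriv D (p 1) / D (p 1) = D₁ / D₀ - k * E p := by
      obtain ⟨e1, e2⟩ := hDq p hp
      simp only [E]
      field_simp
      rw [e2, e1, hk]
      ring
    rw [h1]
    refine ContinuousLinearMap.ext fun u => ?_
    simp
    ring
  have hgd (p) (hp : p ∈ M.carrier) : HasFDerivAt g
      ((2 * w * D (p 1) * b p) • (ContinuousLinearMap.proj (R := ℝ) 1 : CoordSpace →L[ℝ] ℝ)
        - (2 * w * D (p 1) * a p) • ContinuousLinearMap.proj (R := ℝ) 2) p := by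
    have hD := hM.D_ne_zero p hp
    refine ((((((hM.hasDerivAt_H hp).hasFDerivAt_coord.sub_const (H x₀)).const_mul (v 2)).add_const
      (v 0 + H x₀ * v 2)).sub (((hM.hasDerivAt_D hp).hasFDerivAt_coord.mul (hA p)).const_mul
      (2 * w))).sub ((hsub (hm.deriv_v _)).const_mul (2 * w * q₀ / D₀))).congr_fderiv ?_
    have h1 : deriv D (p 1) * A p + q₀ * s (p 1 - x₀) / D₀
        = D (p 1) * (D₁ / D₀ * A p + q p * E p) := by
      obtain ⟨e1, e2⟩ := hDq p hp
      have e3 : q p = q₀ - k * A p := by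
        simp only [q, A]
        rw [hg.c_eq]
        ring
      simp only [E]
      field_simp
      rw [e2, e1, e3, hk]
      ring
    refine ContinuousLinearMap.ext fun u => ?_
    simp [hM.deriv_H_eq hP hp]
    simp only [b]
    linear_combination (-2 * w * u 1) * h1
  have hY (p) (hp : p ∈ M.carrier) : ∃ B : CoordSpace →L[ℝ] CoordSpace, HasFDerivAt Y B p ∧
      ∀ u, B u = ![-(H (p 1) * B u 2) - deriv H (p 1) * a p * u 2, q p * u 2,
        -(q p / D (p 1) ^ 2) * u 1 - a p * (deriv D (p 1) / D (p 1)) * u 2, 0] := by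
    obtain ⟨B₀, h0, e0⟩ : ∃ B₀ : CoordSpace →L[ℝ] ℝ,
        HasFDerivAt (fun p => g p - H (p 1) * b p) B₀ p ∧
        ∀ u, B₀ u = -(H (p 1) * (-(q p / D (p 1) ^ 2) * u 1
          - a p * (deriv D (p 1) / D (p 1)) * u 2)) - deriv H (p 1) * a p * u 2 := by
      refine ⟨_, (hgd p hp).sub ((hM.hasDerivAt_H hp).hasFDerivAt_coord.mul (hb p hp)),
        fun u => ?_⟩
      simp [hM.deriv_H_eq hP hp]
      ring
    refine ⟨ContinuousLinearMap.pi ![B₀, q p • ContinuousLinearMap.proj (R := ℝ) 2,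
      -(q p / D (p 1) ^ 2) • (ContinuousLinearMap.proj (R := ℝ) 1 : CoordSpace →L[ℝ] ℝ)
        - (a p * (deriv D (p 1) / D (p 1))) • ContinuousLinearMap.proj 2, 0],
      hasFDerivAt_pi.2 fun i => ?_, fun u => ?_⟩
    · fin_cases i
      exacts [h0, ha p, hb p hp, hasFDerivAt_const _ _]
    · ext i
      fin_cases i <;> simp [e0]
  have hYc : ContDiffOn ℝ ∞ Y M.carrier := by
    have cC (p) : ContDiffAt ℝ ∞ (fun p : CoordSpace => C (p 2 - y₀)) p :=
      (hg.smooth_c.comp ((contDiff_apply ℝ ℝ 2).sub contDiff_const)).contDiffAt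
    have cS (p) : ContDiffAt ℝ ∞ (fun p : CoordSpace => Sn (p 2 - y₀)) p :=
      (hg.smooth_s.comp ((contDiff_apply ℝ ℝ 2).sub contDiff_const)).contDiffAt
    have cV (p) : ContDiffAt ℝ ∞ (fun p : CoordSpace => Cv (p 2 - y₀)) p :=
      (hg.smooth_v.comp ((contDiff_apply ℝ ℝ 2).sub contDiff_const)).contDiffAt
    have cs (p) : ContDiffAt ℝ ∞ (fun p : CoordSpace => s (p 1 - x₀)) p :=
      (hm.smooth_s.comp ((contDiff_apply ℝ ℝ 1).sub contDiff_const)).contDiffAt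
    have cv (p) : ContDiffAt ℝ ∞ (fun p : CoordSpace => sv (p 1 - x₀)) p :=
      (hm.smooth_v.comp ((contDiff_apply ℝ ℝ 1).sub contDiff_const)).contDiffAt
    intro p hp
    have cH := hM.smooth_H.comp_coord.contDiffAt (M.isOpen_carrier.mem_nhds hp)
    have cD := hM.smooth_D.comp_coord.contDiffAt (M.isOpen_carrier.mem_nhds hp)
    have cA : ContDiffAt ℝ ∞ A p := (contDiffAt_const.mul (cS p)).add (contDiffAt_const.mul (cV p))
    have cE : ContDiffAt ℝ ∞ E p :=
      (cs p).div (contDiffAt_const.mul cD) (mul_ne_zero hD₀ (hM.D_ne_zero p hp))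
    have cb : ContDiffAt ℝ ∞ b p := (contDiffAt_const.sub (contDiffAt_const.mul cA)).sub
      (((contDiffAt_const.mul (cC p)).sub (contDiffAt_const.mul (cS p))).mul cE)
    have cg : ContDiffAt ℝ ∞ g p := (((contDiffAt_const.mul (cH.sub contDiffAt_const)).add
      contDiffAt_const).sub (contDiffAt_const.mul (cD.mul cA))).sub (contDiffAt_const.mul (cv p))
    refine (contDiffAt_pi.2 fun i => ?_).contDiffWithinAt
    fin_cases i
    exacts [cg.sub (cH.mul cb), (contDiffAt_const.mul (cC p)).add (contDiffAt_const.mul (cS p)),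
      cb, contDiffAt_const]
  have hX (p) (hp : p ∈ M.carrier) : M.carrier.indicator Y =ᶠ[nhds p] Y :=
    Filter.eventually_of_mem (M.isOpen_carrier.mem_nhds hp) fun r hr => Set.indicator_of_mem hr Y
  have hv : Y p₀ = v := by
    ext i
    fin_cases i <;>
      simp [Y, g, b, a, A, E, hx₀, hy₀, hg.s_zero, hg.v_zero, hg.c_zero, hm.s_zero, hm.v_zero]
  refine ⟨M.carrier.indicator Y, hM.isCoframeKilling_iff.2
    ⟨hYc.congr fun p hp => Set.indicator_of_mem hp Y, fun p hp => Set.indicator_of_notMem hp Y,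
    fun p hp => ⟨q p, fun u => ?_⟩⟩, ?_, ?_⟩
  · obtain ⟨B, hB, hBu⟩ := hY p hp
    rw [(hX p hp).fderiv_eq, hB.fderiv, Set.indicator_of_mem hp]
    have h1 : B u 2 = _ := congrFun (hBu u) 2
    refine ⟨congrFun (hBu u) 1, h1, congrFun (hBu u) 3, congrFun (hBu u) 0⟩
  · rw [Set.indicator_of_mem hp₀, hv]
  · obtain ⟨B, hB, hBu⟩ := hY p₀ hp₀
    rw [(hX p₀ hp₀).fderiv_eq, hB.fderiv, hBu]
    simp [q, hy₀, hg.s_zero, hg.c_zero]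

/-- An infinitesimal motion of the coframe is determined by its value and rotation at a point. -/
theorem eq_zero_of_isCoframeKilling (hM : IsGodelType M H D S)
    (hP : HasParameters M H D S m2 w S₀) {X : CoordSpace → CoordSpace}
    (hX : IsCoframeKilling M H D X) {p₀ : CoordSpace} (hp₀ : p₀ ∈ M.carrier) (hv : X p₀ = 0)
    (hq₀ : fderiv ℝ X p₀ (Pi.single 2 1) 1 = 0) : X = 0 := by
  obtain ⟨k, hk⟩ : ∃ k, ∀ p ∈ M.carrier, deriv D (p 1) ^ 2 - m2 * D (p 1) ^ 2 = k := by
    obtain ⟨c, s, sv, hm⟩ := exists_genTrig (-m2)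
    refine ⟨deriv D (p₀ 1) ^ 2 - m2 * D (p₀ 1) ^ 2, fun p hp => ?_⟩
    obtain ⟨e1, e2⟩ := hM.D_eq hP hm hp₀ hp
    rw [e1, e2]
    linear_combination (deriv D (p₀ 1) ^ 2 - m2 * D (p₀ 1) ^ 2) * hm.c_sq (p 1 - p₀ 1)
  obtain ⟨-, hX0, hX1⟩ := hM.isCoframeKilling_iff.1 hX
  let q : CoordSpace → ℝ := fun p => fderiv ℝ X p (Pi.single 2 1) 1
  have hXd (p) (hp : p ∈ M.carrier) := hasFDerivAt_of_contDiffOn M.isOpen_carrier hX.smooth hp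
  have hXdd (p) (hp : p ∈ M.carrier) :=
    hasFDerivAt_fderiv_of_contDiffOn M.isOpen_carrier hX.smooth hp
  have hc (p) (hp : p ∈ M.carrier) (i) := hasFDerivAt_pi'.1 (hXd p hp) i
  have hK (p) (hp : p ∈ M.carrier) (u) : fderiv ℝ X p u 1 = q p * u 2 ∧
        fderiv ℝ X p u 2 = -(q p / D (p 1) ^ 2) * u 1
          - X p 1 * (deriv D (p 1) / D (p 1)) * u 2 ∧
        fderiv ℝ X p u 3 = 0 ∧
        fderiv ℝ X p u 0 = -(H (p 1) * fderiv ℝ X p u 2) - deriv H (p 1) * X p 1 * u 2 := by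
    obtain ⟨r, hr⟩ := hX1 p hp
    have : q p = r := by simpa using (hr (Pi.single 2 1)).1
    rw [this]
    exact hr u
  have hdd (p) (hp : p ∈ M.carrier) (u i) : HasFDerivAt (fun p => fderiv ℝ X p u i)
      ((ContinuousLinearMap.proj i).comp ((fderiv ℝ (fderiv ℝ X) p).flip u)) p :=
    hasFDerivAt_pi'.1 (((ContinuousLinearMap.apply ℝ CoordSpace u).hasFDerivAt).comp p
      (hXdd p hp)) i
  -- Equality of mixed second derivatives, of X¹ and then of X², shows that dq is a multiple of dy
  -- and that the factor is −k X¹. This closes the system for (X¹, q).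
  have hqd (p) (hp : p ∈ M.carrier) :
      HasFDerivAt q ((-(k * X p 1)) • ContinuousLinearMap.proj (R := ℝ) 2) p := by
    obtain ⟨Q, hQ⟩ : ∃ Q : CoordSpace →L[ℝ] ℝ, HasFDerivAt q Q p := ⟨_, hdd p hp _ _⟩
    have hD := hM.D_ne_zero p hp
    have hnhds := M.isOpen_carrier.mem_nhds hp
    have s1 (u z) : fderiv ℝ (fderiv ℝ X) p z u 1 = Q z * u 2 := by
      have e := (hQ.mul_const (u 2)).congr_of_eventuallyEq
        (Filter.eventually_of_mem hnhds fun r hr => (hK r hr u).1)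
      have := congrArg (fun B : CoordSpace →L[ℝ] ℝ => B z) ((hdd p hp u 1).unique e)
      simp at this
      linear_combination this
    have s2 (u z) : fderiv ℝ (fderiv ℝ X) p z u 2
        = -(Q z / D (p 1) ^ 2) * u 1 + 2 * q p * deriv D (p 1) * z 1 / D (p 1) ^ 3 * u 1
          - q p * z 2 * (deriv D (p 1) / D (p 1)) * u 2
          - X p 1 * (m2 - deriv D (p 1) ^ 2 / D (p 1) ^ 2) * z 1 * u 2 := by
      have hDd := hM.hasDerivAt_D hp
      have i1 := ((hDd.pow 2).inv (pow_ne_zero 2 hD)).hasFDerivAt_coord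
      have i2 := ((hM.hasDerivAt_deriv_D hp).div hDd hD).hasFDerivAt_coord
      have e := (((hQ.mul i1).neg.mul_const (u 1)).sub
        (((hc p hp 1).mul i2).mul_const (u 2))).congr_of_eventuallyEq
        (f₁ := fun p => fderiv ℝ X p u 2)
        (Filter.eventually_of_mem hnhds fun r hr => by
          simp [(hK r hr u).2.1, div_eq_mul_inv])
      have := congrArg (fun B : CoordSpace →L[ℝ] ℝ => B z) ((hdd p hp u 2).unique e)
      simp [hM.deriv_deriv_D_eq hP hp, (hK p hp z).1] at this
      rw [this]
      field_simp
      ring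
    have sy (u z) := fderiv_fderiv_symm_of_contDiffOn M.isOpen_carrier hX.smooth hp u z
    have t1 (z) : Q z = Q (Pi.single 2 1) * z 2 := by
      have := congrFun (sy z (Pi.single 2 1)) 1
      rw [s1, s1] at this
      simpa using this
    have t2 : Q (Pi.single 2 1) = -(k * X p 1) := by
      have := congrFun (sy (Pi.single 2 1) (Pi.single 1 1)) 2
      rw [s2, s2] at this
      simp at this
      field_simp at this
      rw [← hk p hp]
      linear_combination this
    refine hQ.congr_fderiv (ContinuousLinearMap.ext fun z => ?_)
    rw [t1, t2]
    simp
  obtain ⟨C, Sn, Cv, hg⟩ := exists_genTrig k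
  have hconst {f : CoordSpace → ℝ} (hf : ∀ p ∈ M.carrier, HasFDerivAt f (0 : CoordSpace →L[ℝ] ℝ) p)
      (p) (hp : p ∈ M.carrier) : f p = f p₀ :=
    M.isOpen_carrier.is_const_of_fderiv_eq_zero M.isConnected_carrier.isPreconnected
      (fun r hr => (hf r hr).differentiableAt.differentiableWithinAt) (fun r hr => (hf r hr).fderiv)
      hp hp₀
  have hx (p) (hp : p ∈ M.carrier) : HasFDerivAt (fun p => X p 1)
      (q p • ContinuousLinearMap.proj (R := ℝ) 2) p := by
    refine (hc p hp 1).congr_fderiv (ContinuousLinearMap.ext fun u => ?_)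
    simpa using (hK p hp u).1
  have hq₀' : q p₀ = 0 := hq₀
  -- The pair (X¹, q) turned back by the angle y is constant on the connected domain and zero at p₀.
  -- These first integrals avoid following coordinate lines, which may leave the domain.
  have ha (p) (hp : p ∈ M.carrier) : X p 1 * C (p 2) - q p * Sn (p 2) = 0 := by
    rw [hconst (f := fun p => X p 1 * C (p 2) - q p * Sn (p 2)) (fun r hr => ?_) p hp, hv, hq₀']
    · simp
    · refine (((hx r hr).mul (hg.deriv_c _).hasFDerivAt_coord).sub ((hqd r hr).mul
        (hg.deriv_s _).hasFDerivAt_coord)).congr_fderiv (ContinuousLinearMap.ext fun u => ?_)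
      simp
      ring
  have hb (p) (hp : p ∈ M.carrier) : q p * C (p 2) + k * (X p 1 * Sn (p 2)) = 0 := by
    rw [hconst (f := fun p => q p * C (p 2) + k * (X p 1 * Sn (p 2))) (fun r hr => ?_) p hp, hv,
      hq₀']
    · simp
    · refine (((hqd r hr).mul (hg.deriv_c _).hasFDerivAt_coord).add (((hx r hr).mul
        (hg.deriv_s _).hasFDerivAt_coord).const_mul k)).congr_fderiv
        (ContinuousLinearMap.ext fun u => ?_)
      simp
      ring
  have hx0 (p) (hp : p ∈ M.carrier) : X p 1 = 0 := by
    linear_combination C (p 2) * ha p hp + Sn (p 2) * hb p hp - X p 1 * hg.c_sq (p 2)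
  have hq0 (p) (hp : p ∈ M.carrier) : q p = 0 := by
    linear_combination C (p 2) * hb p hp - k * Sn (p 2) * ha p hp - q p * hg.c_sq (p 2)
  have hall (p) (hp : p ∈ M.carrier) : fderiv ℝ X p = 0 := by
    refine ContinuousLinearMap.ext fun u => ?_
    obtain ⟨e1, e2, e3, e0⟩ := hK p hp u
    rw [hx0 p hp, hq0 p hp] at *
    rw [e2] at e0
    ext i
    fin_cases i
    · simpa using e0
    · simpa using e1
    · simpa using e2
    · simpa using e3
  funext p
  by_cases hp : p ∈ M.carrier
  · rw [M.isOpen_carrier.is_const_of_fderiv_eq_zero M.isConnected_carrier.isPreconnected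
      (fun r hr => (hXd r hr).differentiableAt.differentiableWithinAt) hall hp hp₀, hv]
    rfl
  · exact hX0 p hp

/-- The Lie algebra of the infinitesimal motions of the coframe. -/
def coframeKillingAlgebra (hM : IsGodelType M H D S) : Submodule ℝ (CoordSpace → CoordSpace) where
  carrier := {X | IsCoframeKilling M H D X}
  zero_mem' := by
    refine hM.isCoframeKilling_iff.2 ⟨contDiffOn_const, fun _ _ => rfl, fun p hp => ⟨0, fun u => ?_⟩⟩
    have : fderiv ℝ (0 : CoordSpace → CoordSpace) p = 0 := (hasFDerivAt_const 0 p).fderiv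
    rw [this]
    simp
  add_mem' := by
    intro X Y hX hY
    refine hM.isCoframeKilling_iff.2 ⟨hX.smooth.add hY.smooth, fun p hp => ?_, fun p hp => ?_⟩
    · rw [Pi.add_apply, hX.eq_zero p hp, hY.eq_zero p hp, add_zero]
    · obtain ⟨q, hq⟩ := (hM.isCoframeKilling_iff.1 hX).2.2 p hp
      obtain ⟨r, hr⟩ := (hM.isCoframeKilling_iff.1 hY).2.2 p hp
      refine ⟨q + r, fun u => ?_⟩
      obtain ⟨q1, q2, q3, q0⟩ := hq u
      obtain ⟨r1, r2, r3, r0⟩ := hr u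
      rw [((hasFDerivAt_of_contDiffOn M.isOpen_carrier hX.smooth hp).add
        (hasFDerivAt_of_contDiffOn M.isOpen_carrier hY.smooth hp)).fderiv]
      simp only [add_apply, Pi.add_apply]
      refine ⟨?_, ?_, ?_, ?_⟩
      · linear_combination q1 + r1
      · linear_combination q2 + r2
      · linear_combination q3 + r3
      · linear_combination q0 + r0
  smul_mem' := by
    intro k X hX
    refine hM.isCoframeKilling_iff.2 ⟨contDiffOn_const.smul hX.smooth, fun p hp => ?_,
      fun p hp => ?_⟩
    · rw [Pi.smul_apply, hX.eq_zero p hp, smul_zero]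
    · obtain ⟨q, hq⟩ := (hM.isCoframeKilling_iff.1 hX).2.2 p hp
      refine ⟨k * q, fun u => ?_⟩
      obtain ⟨q1, q2, q3, q0⟩ := hq u
      rw [((hasFDerivAt_of_contDiffOn M.isOpen_carrier hX.smooth hp).const_smul k).fderiv]
      simp only [smul_apply, Pi.smul_apply, smul_eq_mul]
      refine ⟨?_, ?_, ?_, ?_⟩
      · linear_combination k * q1
      · linear_combination k * q2
      · linear_combination k * q3
      · linear_combination k * q0

/-- The value and the rotation of an infinitesimal motion of the coframe at a point. -/
noncomputable def initialData (hM : IsGodelType M H D S) {p : CoordSpace} (hp : p ∈ M.carrier) :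
    hM.coframeKillingAlgebra →ₗ[ℝ] CoordSpace × ℝ where
  toFun X := (X.1 p, fderiv ℝ X.1 p (Pi.single 2 1) 1)
  map_add' X Y := by
    simp [((hasFDerivAt_of_contDiffOn M.isOpen_carrier X.2.smooth hp).add
        (hasFDerivAt_of_contDiffOn M.isOpen_carrier Y.2.smooth hp)).fderiv]
  map_smul' k X := by
    simp [((hasFDerivAt_of_contDiffOn M.isOpen_carrier X.2.smooth hp).const_smul k).fderiv]

/-- Existence and uniqueness for the Killing equations identify the algebra with ℝ⁴ × ℝ, whence
dimension five. -/
theorem initialData_bijective (hM : IsGodelType M H D S) (hP : HasParameters M H D S m2 w S₀)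
    {p : CoordSpace} (hp : p ∈ M.carrier) : Function.Bijective (hM.initialData hp) := by
  constructor
  · refine (injective_iff_map_eq_zero _).2 fun X hX => Subtype.ext ?_
    exact hM.eq_zero_of_isCoframeKilling hP X.2 hp (congrArg Prod.fst hX) (congrArg Prod.snd hX)
  · rintro ⟨v, q⟩
    obtain ⟨X, hX, h1, h2⟩ := hM.exists_isCoframeKilling hP hp v q
    exact ⟨⟨X, hX⟩, Prod.ext h1 h2⟩

/-- The infinitesimal motions of the coframe form a transitive five-dimensional Lie algebra. -/
theorem isMotionGroupAlgebra (hM : IsGodelType M H D S) (hP : HasParameters M H D S m2 w S₀) :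
    IsMotionGroupAlgebra M 5 hM.coframeKillingAlgebra := by
  obtain ⟨p, hp⟩ := M.isConnected_carrier.nonempty
  let e := LinearEquiv.ofBijective _ (hM.initialData_bijective hP hp)
  exact ⟨Module.Finite.equiv e.symm, by simp [e.finrank_eq], fun X hX =>
    hM.isMotionGenerator hP.torsion hX, fun X hX Y hY => hM.isCoframeKilling_lieBracket hX hY⟩

end IsGodelType

/-! ### Curvature and its invariance. -/

namespace RCSpacetime

/-- The curvature `R(u, v) w`. -/
noncomputable def curvature (M : RCSpacetime) (p u v w : CoordSpace) : CoordSpace :=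
  fderiv ℝ M.conn p u v w - fderiv ℝ M.conn p v u w + M.conn p u (M.conn p v w)
    - M.conn p v (M.conn p u w)

/-- The linear map `u ↦ R(u, v) w`. -/
noncomputable def curvatureMap (M : RCSpacetime) (p v w : CoordSpace) :
    CoordSpace →ₗ[ℝ] CoordSpace where
  toFun u := M.curvature p u v w
  map_add' u u' := by simp [curvature]; abel
  map_smul' k u := by simp [curvature, smul_sub, smul_add]

/-- The Ricci curvature. -/
noncomputable def ricci (M : RCSpacetime) (p v w : CoordSpace) : ℝ :=
  LinearMap.trace ℝ CoordSpace (M.curvatureMap p v w)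

theorem ricci_eq_sum (M : RCSpacetime) (p v w : CoordSpace) :
    M.ricci p v w = ∑ i, M.curvature p (Pi.single i 1) v w i := by
  rw [ricci, LinearMap.trace_eq_matrix_trace ℝ (Pi.basisFun ℝ (Fin 4)), Matrix.trace]
  simp [curvatureMap]

end RCSpacetime

namespace IsAffineIsometryOn

variable {M N : RCSpacetime} {V : Set CoordSpace} {φ : CoordSpace → CoordSpace}

/-- `map_conn` is differentiated and antisymmetrized: third derivatives of φ cancel, and second
derivatives are eliminated by `map_conn` itself. -/
theorem map_curvature (h : IsAffineIsometryOn M N V φ) {p : CoordSpace} (hp : p ∈ V)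
    (u v w : CoordSpace) :
    N.curvature (φ p) (fderiv ℝ φ p u) (fderiv ℝ φ p v) (fderiv ℝ φ p w)
      = fderiv ℝ φ p (M.curvature p u v w) := by
  have hφ := hasFDerivAt_of_contDiffOn h.isOpen_source h.smooth hp
  have hF := hasFDerivAt_fderiv_of_contDiffOn h.isOpen_source h.smooth hp
  have h1 : ContDiffOn ℝ ∞ (fderiv ℝ φ) V := h.smooth.fderiv_of_isOpen h.isOpen_source (by simp)
  have hFF := hasFDerivAt_fderiv_of_contDiffOn h.isOpen_source h1 hp
  have hM := hasFDerivAt_of_contDiffOn M.isOpen_carrier M.contDiffOn_conn (h.source_subset hp)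
  have hN := (hasFDerivAt_of_contDiffOn N.isOpen_carrier N.contDiffOn_conn (h.mapsTo hp)).comp p hφ
  have hc (u : CoordSpace) := hasFDerivAt_const (𝕜 := ℝ) (E := CoordSpace) u p
  have key (z u w) : fderiv ℝ (fderiv ℝ (fderiv ℝ φ)) p z u w
      + (fderiv ℝ N.conn (φ p) (fderiv ℝ φ p z) (fderiv ℝ φ p u) (fderiv ℝ φ p w)
        + N.conn (φ p) (fderiv ℝ (fderiv ℝ φ) p z u) (fderiv ℝ φ p w)
        + N.conn (φ p) (fderiv ℝ φ p u) (fderiv ℝ (fderiv ℝ φ) p z w))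
      = fderiv ℝ (fderiv ℝ φ) p z (M.conn p u w) + fderiv ℝ φ p (fderiv ℝ M.conn p z u w) := by
    have e1 := ((hFF.clm_apply (hc u)).clm_apply (hc w)).add
      ((hN.clm_apply (hF.clm_apply (hc u))).clm_apply (hF.clm_apply (hc w)))
    have e2 := hF.clm_apply ((hM.clm_apply (hc u)).clm_apply (hc w))
    have e3 := e1.unique (e2.congr_of_eventuallyEq
      (Filter.eventually_of_mem (h.isOpen_source.mem_nhds hp) fun r hr => h.map_conn r hr u w))
    have := congrArg (fun B : CoordSpace →L[ℝ] CoordSpace => B z) e3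
    simp at this
    rw [← sub_eq_zero] at this ⊢
    rw [← this]
    abel
  have k1 := key u v w
  have k2 := key v u w
  have s3 := congrArg (fun B : CoordSpace →L[ℝ] CoordSpace => B w)
    (fderiv_fderiv_symm_of_contDiffOn h.isOpen_source h1 hp u v)
  have s2 (a b) : fderiv ℝ (fderiv ℝ φ) p a b = fderiv ℝ φ p (M.conn p a b)
      - N.conn (φ p) (fderiv ℝ φ p a) (fderiv ℝ φ p b) := eq_sub_of_add_eq (h.map_conn p hp a b)
  have s4 := fderiv_fderiv_symm_of_contDiffOn h.isOpen_source h.smooth hp u v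
  rw [s3, s4, s2 u (M.conn p v w), s2 u w] at k1
  rw [s2 v (M.conn p u w), s2 v w] at k2
  simp only [RCSpacetime.curvature, map_sub, map_add] at k1 k2 ⊢
  linear_combination (exp := 1) k1 - k2

/-- The curvature maps are conjugate under the differential of φ, so their traces agree. -/
theorem map_ricci (h : IsAffineIsometryOn M N V φ) {p : CoordSpace} (hp : p ∈ V)
    (v w : CoordSpace) :
    N.ricci (φ p) (fderiv ℝ φ p v) (fderiv ℝ φ p w) = M.ricci p v w := by
  have hinj : Function.Injective (fderiv ℝ φ p : CoordSpace →ₗ[ℝ] CoordSpace) :=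
    LinearMap.injective_iff_surjective.2
      (M.surjective_of_map_metric N (h.source_subset hp) (h.map_metric p hp))
  let F := LinearEquiv.ofInjectiveEndo _ hinj
  rw [RCSpacetime.ricci, RCSpacetime.ricci, ← LinearMap.trace_conj' (M.curvatureMap p v w) F]
  congr 1
  refine LinearMap.ext fun u => ?_
  obtain ⟨z, rfl⟩ := F.surjective u
  rw [LinearEquiv.conj_apply_apply, F.symm_apply_apply]
  exact h.map_curvature hp z v w

end IsAffineIsometryOn

/-! ### The explicit connection and its Ricci tensor. -/

/-- The vector-valued bilinear form `dxⁱ ⊗ dxʲ ⊗ ∂ₖ`. -/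
noncomputable def coordTensor (i j k : Fin 4) : CoordSpace →L[ℝ] CoordSpace →L[ℝ] CoordSpace :=
  (ContinuousLinearMap.proj i : CoordSpace →L[ℝ] ℝ).smulRight
    ((ContinuousLinearMap.proj j : CoordSpace →L[ℝ] ℝ).smulRight (Pi.single k 1 : CoordSpace))

@[simp] theorem coordTensor_apply (i j k : Fin 4) (u v : CoordSpace) :
    coordTensor i j k u v = (u i * v j) • (Pi.single k 1 : CoordSpace) := by
  simp [coordTensor, mul_smul]

/-- The general shape of a connection with the symmetries of a Gödel-type space-time. -/
noncomputable def connTensor (a : Fin 7 → ℝ) : CoordSpace →L[ℝ] CoordSpace →L[ℝ] CoordSpace :=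
  a 0 • coordTensor 1 2 0 + a 1 • coordTensor 2 1 0
    + a 2 • (coordTensor 1 0 0 + coordTensor 0 1 0)
    + a 3 • (coordTensor 2 0 1 + coordTensor 0 2 1) + a 4 • coordTensor 2 2 1
    + a 5 • (coordTensor 1 2 2 + coordTensor 2 1 2)
    + a 6 • (coordTensor 1 0 2 + coordTensor 0 1 2)

theorem connTensor_apply (a : Fin 7 → ℝ) (u v : CoordSpace) : connTensor a u v =
    ![a 0 * (u 1 * v 2) + a 1 * (u 2 * v 1) + a 2 * (u 1 * v 0 + u 0 * v 1),
      a 3 * (u 2 * v 0 + u 0 * v 2) + a 4 * (u 2 * v 2),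
      a 5 * (u 1 * v 2 + u 2 * v 1) + a 6 * (u 1 * v 0 + u 0 * v 1), 0] := by
  ext i
  fin_cases i <;> simp [connTensor] <;> ring

theorem hasFDerivAt_connTensor {a : ℝ → Fin 7 → ℝ} {a' : Fin 7 → ℝ} {p : CoordSpace}
    (h : ∀ i, HasDerivAt (fun x => a x i) (a' i) (p 1)) :
    HasFDerivAt (fun p : CoordSpace => connTensor (a (p 1)))
      ((ContinuousLinearMap.proj 1 : CoordSpace →L[ℝ] ℝ).smulRight (connTensor a')) p := by
  have e (i) (T : CoordSpace →L[ℝ] CoordSpace →L[ℝ] CoordSpace) :=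
    (h i).hasFDerivAt_coord.smul_const T
  refine (((((((e 0 _).add (e 1 _)).add (e 2 _)).add (e 3 _)).add (e 4 _)).add (e 5 _)).add
    (e 6 _)).congr_fderiv ?_
  refine ContinuousLinearMap.ext fun u => ?_
  simp [connTensor]
  module

/-- The coefficients of the connection in terms of the values `h`, `d` of `H`, `D`, of their
derivatives `h₁`, `d₁` and of the torsion `s`. -/
noncomputable def connCoeff (h d h₁ d₁ s : ℝ) : Fin 7 → ℝ :=
  let Q := (h₁ - s * d) / 2
  ![h₁ - Q - h * (d₁ / d - Q * h / d ^ 2), Q - h * (d₁ / d - Q * h / d ^ 2), h * Q / d ^ 2,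
    Q, 2 * Q * h - d * d₁, d₁ / d - Q * h / d ^ 2, -Q / d ^ 2]

/-- The connection of Gödel type with constant torsion `s`. -/
noncomputable def godelConn (H D : ℝ → ℝ) (s : ℝ) (p : CoordSpace) :
    CoordSpace →L[ℝ] CoordSpace →L[ℝ] CoordSpace :=
  connTensor (connCoeff (H (p 1)) (D (p 1)) (deriv H (p 1)) (deriv D (p 1)) s)

section

variable {H D : ℝ → ℝ} {p : CoordSpace}

theorem godelConn_compatible (hD₀ : D (p 1) ≠ 0) (hH : HasDerivAt H (deriv H (p 1)) (p 1))
    (hD : HasDerivAt D (deriv D (p 1)) (p 1)) (s : ℝ) (u v w : CoordSpace) :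
    fderiv ℝ (godelMetric H D) p u v w = godelMetric H D p (godelConn H D s p u v) w
      + godelMetric H D p v (godelConn H D s p u w) := by
  rw [(hasFDerivAt_godelMetric hH hD).fderiv, godelConn, connTensor_apply, connTensor_apply]
  simp [godelMetric, connCoeff]
  field_simp
  ring

theorem godelConn_torsion (s : ℝ) (u v : CoordSpace) :
    godelConn H D s p u v - godelConn H D s p v u
      = (s * areaForm D p u v) • (Pi.single 0 1 : CoordSpace) := by
  rw [godelConn, connTensor_apply, connTensor_apply]
  ext i
  fin_cases i
  · simp [areaForm, connCoeff]
    ring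
  · simp
    ring
  · simp
    ring
  · simp

end

namespace RCSpacetime

/-- The metric and the torsion determine the connection. -/
theorem conn_eq_of_compatible (M : RCSpacetime) {p : CoordSpace} (hp : p ∈ M.carrier)
    {C : CoordSpace →L[ℝ] CoordSpace →L[ℝ] CoordSpace}
    (hC : ∀ u v w, fderiv ℝ M.metric p u v w = M.metric p (C u v) w + M.metric p v (C u w))
    (hT : ∀ u v, C u v - C v u = M.torsion p u v) : M.conn p = C := by
  refine ContinuousLinearMap.ext fun u => ContinuousLinearMap.ext fun v => ?_
  refine sub_eq_zero.1 (M.eq_zero_of_metric_eq_zero hp fun w => ?_)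
  have hs (u v) : M.conn p u v - C u v = M.conn p v u - C v u := by
    have := hT u v
    rw [torsion] at this
    linear_combination (exp := 1) -this
  have ha (u v w) : M.metric p (M.conn p u v - C u v) w
      + M.metric p (M.conn p u w - C u w) v = 0 := by
    have h1 := M.metric_compatible p hp u v w
    rw [hC u v w, M.metric_symm p hp v, M.metric_symm p hp v] at h1
    simp only [map_sub, sub_apply]
    linarith
  have h1 := ha u v w
  have h2 := ha v w u
  have h3 := ha w u v
  rw [hs w u] at h3
  rw [hs v w] at h2
  rw [hs v u] at h2
  linarith

end RCSpacetime

namespace IsGodelType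

variable {M : RCSpacetime} {H D S : ℝ → ℝ} {S₀ : ℝ}

theorem conn_eq_godelConn (hM : IsGodelType M H D S) {p : CoordSpace} (hp : p ∈ M.carrier) :
    M.conn p = godelConn H D (S (p 3)) p := by
  refine M.conn_eq_of_compatible hp (fun u v w => ?_) fun u v => ?_
  · have h : M.metric =ᶠ[nhds p] godelMetric H D := Filter.eventually_of_mem
      (M.isOpen_carrier.mem_nhds hp) fun r hr => hM.metric_eq_godelMetric hr
    rw [h.fderiv_eq, hM.metric_eq_godelMetric hp, godelConn_compatible (hM.D_ne_zero p hp)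
      (hM.hasDerivAt_H hp) (hM.hasDerivAt_D hp)]
  · rw [godelConn_torsion, hM.torsion_eq_areaForm hp]

/-- The Ricci curvature for constant torsion. -/
theorem ricci_eq (hM : IsGodelType M H D S) (hS : ∀ p ∈ M.carrier, S (p 3) = S₀)
    {p : CoordSpace} (hp : p ∈ M.carrier) {P P₁ l : ℝ} (hP : P = deriv H (p 1) / D (p 1) - S₀)
    (hP₁ : P₁ = (deriv (deriv H) (p 1) * D (p 1) - deriv H (p 1) * deriv D (p 1)) / D (p 1) ^ 2)
    (hl : l = deriv (deriv D) (p 1) / D (p 1) - P * (deriv H (p 1) / D (p 1)) / 2)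
    (u v : CoordSpace) :
    M.ricci p u v = P ^ 2 / 2 * (godelCoframe H D p u 0 * godelCoframe H D p v 0)
      - l * (godelCoframe H D p u 1 * godelCoframe H D p v 1
        + godelCoframe H D p u 2 * godelCoframe H D p v 2)
      + P₁ / 2 * (godelCoframe H D p u 0 * godelCoframe H D p v 2
        + godelCoframe H D p u 2 * godelCoframe H D p v 0) := by
  have hD := hM.D_ne_zero p hp
  have dH := hM.hasDerivAt_H hp
  have dD := hM.hasDerivAt_D hp
  have dH' := hM.hasDerivAt_deriv_H hp
  have dD' := hM.hasDerivAt_deriv_D hp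
  have hc : M.conn =ᶠ[nhds p] godelConn H D S₀ := Filter.eventually_of_mem
    (M.isOpen_carrier.mem_nhds hp) fun r hr => by rw [hM.conn_eq_godelConn hr, hS r hr]
  have dQ : HasDerivAt (fun x => (deriv H x - S₀ * D x) / 2) _ (p 1) :=
    (dH'.sub (dD.const_mul S₀)).div_const 2
  have df : HasDerivAt (fun x => deriv D x / D x - (deriv H x - S₀ * D x) / 2 * H x / D x ^ 2) _
    (p 1) := (dD'.div dD hD).sub ((dQ.mul dH).div (dD.pow 2) (pow_ne_zero 2 hD))
  have key := hasFDerivAt_connTensor (p := p)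
    (a := fun x => connCoeff (H x) (D x) (deriv H x) (deriv D x) S₀) (a' := ![_, _, _, _, _, _, _])
    (by
      intro i
      fin_cases i
      exacts [(dH'.sub dQ).sub (dH.mul df), dQ.sub (dH.mul df),
        (dH.mul dQ).div (dD.pow 2) (pow_ne_zero 2 hD), dQ, ((dQ.const_mul 2).mul dH).sub
        (dD.mul dD'), df, dQ.neg.div (dD.pow 2) (pow_ne_zero 2 hD)])
  have hd : fderiv ℝ M.conn p = _ := hc.fderiv_eq.trans key.fderiv
  rw [M.ricci_eq_sum, Fin.sum_univ_four]
  simp only [RCSpacetime.curvature, hd, hc.eq_of_nhds, godelConn, connTensor_apply,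
    ContinuousLinearMap.smulRight_apply, ContinuousLinearMap.proj_apply, smul_apply]
  rw [hl, hP, hP₁]
  clear key hd df dQ dD' dH' dD dH hc hl hP hP₁
  simp only [godelCoframe]
  generalize H (p 1) = h at *
  generalize deriv (deriv H) (p 1) = h₂ at *
  generalize deriv H (p 1) = h₁ at *
  generalize deriv (deriv D) (p 1) = d₂ at *
  generalize deriv D (p 1) = d₁ at *
  simp [connCoeff]
  generalize D (p 1) = d at *
  field_simp
  ring

end IsGodelType

/-! ### Frame components and pointwise invariants. -/

theorem exists_godelCoframe_eq {H D : ℝ → ℝ} {p : CoordSpace} (hD : D (p 1) ≠ 0) (a : Fin 4 → ℝ) :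
    ∃ u, godelCoframe H D p u = a := by
  refine ⟨![a 0 - H (p 1) * (a 2 / D (p 1)), a 1, a 2 / D (p 1), a 3], ?_⟩
  ext i
  fin_cases i
  · simp [godelCoframe]
  · simp [godelCoframe]
  · simp [godelCoframe]
    field_simp
  · simp [godelCoframe]

theorem areaForm_eq (H D : ℝ → ℝ) (p u v : CoordSpace) : areaForm D p u v =
    godelCoframe H D p u 1 * godelCoframe H D p v 2
      - godelCoframe H D p u 2 * godelCoframe H D p v 1 := by
  simp [areaForm, godelCoframe]
  ring

theorem godelCoframe_smul (H D : ℝ → ℝ) (p : CoordSpace) (k : ℝ) (u : CoordSpace) :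
    godelCoframe H D p (k • u) = k • godelCoframe H D p u := by
  ext i
  fin_cases i <;> simp [godelCoframe] <;> ring

theorem godelCoframe_single_zero (H D : ℝ → ℝ) (p : CoordSpace) :
    godelCoframe H D p (Pi.single 0 1) = ![1, 0, 0, 0] := by
  ext i
  fin_cases i <;> simp [godelCoframe]

/-- This is g(∇_u ∂_t, v). It depends on P = H'/D − s linearly, whereas the eigenvalue P²/2 of the
Ricci matrix loses the sign. -/
theorem godelMetric_godelConn_single_zero {H D : ℝ → ℝ} {p : CoordSpace} (hD : D (p 1) ≠ 0)
    (s : ℝ) (u v : CoordSpace) :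
    godelMetric H D p (godelConn H D s p u (Pi.single 0 1)) v
      = (deriv H (p 1) / D (p 1) - s) / 2 * areaForm D p u v := by
  rw [godelConn, connTensor_apply]
  simp [godelMetric, connCoeff, areaForm]
  field_simp
  ring

/-- The frame components of the metric. -/
def frameMetric : Matrix (Fin 4) (Fin 4) ℝ := Matrix.diagonal ![1, -1, -1, -1]

/-- The frame components of the Ricci curvature. -/
def frameRicci (s l r : ℝ) : Matrix (Fin 4) (Fin 4) ℝ :=
  !![s, 0, r, 0; 0, -l, 0, 0; r, 0, -l, 0; 0, 0, 0, 0]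

/-- The direction of z contributes the factor x, and the decoupled direction 1 makes l a root of the
cubic whatever r is. -/
theorem det_frameRicci_sub (s l r x : ℝ) :
    (frameRicci s l r - x • frameMetric).det
      = -(x * (x ^ 3 - (2 * l + s) * x ^ 2 + (l ^ 2 + 2 * l * s + r ^ 2) * x
        - (l ^ 2 * s + l * r ^ 2))) := by
  have : frameRicci s l r - x • frameMetric
      = !![s - x, 0, r, 0; 0, x - l, 0, 0; r, 0, x - l, 0; 0, 0, 0, x] := by
    ext i j
    fin_cases i <;> fin_cases j <;> simp [frameRicci, frameMetric] <;> ring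
  rw [this]
  simp [Matrix.det_succ_row_zero, Fin.sum_univ_succ, Fin.succAbove]
  ring

/-- The pencil R − x g transforms by congruence under a matrix with squared determinant 1, so its
determinant is the same polynomial in x; the three quantities are its coefficients. -/
theorem frameRicci_invariants {s l r s' l' r' : ℝ} {A : Matrix (Fin 4) (Fin 4) ℝ}
    (hg : A * frameMetric * A.transpose = frameMetric)
    (hR : A * frameRicci s' l' r' * A.transpose = frameRicci s l r) :
    2 * l + s = 2 * l' + s' ∧ l ^ 2 + 2 * l * s + r ^ 2 = l' ^ 2 + 2 * l' * s' + r' ^ 2 ∧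
      l ^ 2 * s + l * r ^ 2 = l' ^ 2 * s' + l' * r' ^ 2 := by
  have hdet : frameMetric.det = -1 := by
    simp [frameMetric, Matrix.det_diagonal, Fin.prod_univ_four]
  have hA : A.det * A.det = 1 := by
    have := congrArg Matrix.det hg
    rw [Matrix.det_mul, Matrix.det_mul, Matrix.det_transpose, hdet] at this
    linarith
  have key (x : ℝ) : (frameRicci s l r - x • frameMetric).det
      = (frameRicci s' l' r' - x • frameMetric).det := by
    have : frameRicci s l r - x • frameMetric
        = A * (frameRicci s' l' r' - x • frameMetric) * A.transpose := by
      rw [Matrix.mul_sub, Matrix.sub_mul, hR, Matrix.mul_smul, Matrix.smul_mul, hg]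
    rw [this, Matrix.det_mul, Matrix.det_mul, Matrix.det_transpose]
    linear_combination (frameRicci s' l' r' - x • frameMetric).det * hA
  -- At x = 0 both sides vanish identically; three other values determine the three unknown
  -- coefficients.
  have k1 := key 1
  have k2 := key (-1)
  have k3 := key 2
  simp only [det_frameRicci_sub] at k1 k2 k3
  refine ⟨?_, ?_, ?_⟩ <;> linarith

theorem IsGodelType.metric_eq_frame {M : RCSpacetime} {H D S : ℝ → ℝ} (hM : IsGodelType M H D S)
    {p : CoordSpace} (hp : p ∈ M.carrier) (u v : CoordSpace) :
    M.metric p u v = ∑ i, ∑ j,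
      godelCoframe H D p u i * frameMetric i j * godelCoframe H D p v j := by
  rw [hM.metric_eq p hp]
  simp [Fin.sum_univ_four, frameMetric, Matrix.diagonal]
  ring

namespace IsAffineIsometryOn

variable {M N : RCSpacetime} {H D S H' D' S' : ℝ → ℝ} {V : Set CoordSpace}
  {φ : CoordSpace → CoordSpace} {p : CoordSpace}

/-- The matrix of the differential in the frames. -/
theorem exists_frame_matrix (hM : IsGodelType M H D S) (hN : IsGodelType N H' D' S')
    (h : IsAffineIsometryOn M N V φ) (hp : p ∈ V) {s l r s' l' r' : ℝ}
    (hR : ∀ u v, M.ricci p u v = ∑ i, ∑ j,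
      godelCoframe H D p u i * frameRicci s l r i j * godelCoframe H D p v j)
    (hR' : ∀ u v, N.ricci (φ p) u v = ∑ i, ∑ j, godelCoframe H' D' (φ p) u i
      * frameRicci s' l' r' i j * godelCoframe H' D' (φ p) v j) :
    ∃ A : Matrix (Fin 4) (Fin 4) ℝ, A * frameMetric * A.transpose = frameMetric ∧
      A * frameRicci s' l' r' * A.transpose = frameRicci s l r := by
  choose e he using fun i : Fin 4 => exists_godelCoframe_eq (H := H)
    (hM.D_ne_zero p (h.source_subset hp)) (Pi.single i 1)
  have hsum (A B : Matrix (Fin 4) (Fin 4) ℝ) (i j) :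
      (A * B * A.transpose) i j = ∑ k, ∑ l, A i k * B k l * A j l := by
    simp only [Matrix.mul_apply, Matrix.transpose_apply, Finset.sum_mul]
    exact Finset.sum_comm
  have hone (B : Matrix (Fin 4) (Fin 4) ℝ) (i j) : ∑ k, ∑ l,
      godelCoframe H D p (e i) k * B k l * godelCoframe H D p (e j) l = B i j := by
    simp [he, Pi.single_apply]
  refine ⟨Matrix.of fun i j => godelCoframe H' D' (φ p) (fderiv ℝ φ p (e i)) j, ?_, ?_⟩ <;> ext i j
  · simp only [hsum, Matrix.of_apply]
    rw [← hN.metric_eq_frame (h.mapsTo hp), h.map_metric p hp,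
      hM.metric_eq_frame (h.source_subset hp), hone]
  · simp only [hsum, Matrix.of_apply]
    rw [← hR', h.map_ricci hp, hR, hone]

/-- The behaviour of the torsion. -/
theorem torsion_sq_eq (hM : IsGodelType M H D S) (hN : IsGodelType N H' D' S')
    (h : IsAffineIsometryOn M N V φ) (hp : p ∈ V) : S (p 3) ^ 2 = S' (φ p 3) ^ 2 ∧
      (S (p 3) ≠ 0 → ∃ σ τ : ℝ, σ ^ 2 = 1 ∧ τ ^ 2 = 1 ∧ S' (φ p 3) * τ = S (p 3) * σ ∧
        fderiv ℝ φ p (Pi.single 0 1) = σ • (Pi.single 0 1 : CoordSpace) ∧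
        ∀ u v, areaForm D' (φ p) (fderiv ℝ φ p u) (fderiv ℝ φ p v) = τ * areaForm D p u v) := by
  have hpM := h.source_subset hp
  have hT (u v) : (S' (φ p 3) * areaForm D' (φ p) (fderiv ℝ φ p u) (fderiv ℝ φ p v)) •
      (Pi.single 0 1 : CoordSpace)
      = (S (p 3) * areaForm D p u v) • fderiv ℝ φ p (Pi.single 0 1) := by
    rw [← hN.torsion_eq_areaForm (h.mapsTo hp), h.map_torsion hp, hM.torsion_eq_areaForm hpM,
      map_smul]
  by_cases hS : S (p 3) = 0
  · refine ⟨?_, fun h => absurd hS h⟩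
    have hsurj := M.surjective_of_map_metric N hpM (h.map_metric p hp)
    obtain ⟨f₁, hf₁⟩ := exists_godelCoframe_eq (H := H') (hN.D_ne_zero _ (h.mapsTo hp)) ![0, 1, 0, 0]
    obtain ⟨f₂, hf₂⟩ := exists_godelCoframe_eq (H := H') (hN.D_ne_zero _ (h.mapsTo hp)) ![0, 0, 1, 0]
    obtain ⟨u, rfl⟩ := hsurj f₁
    obtain ⟨v, rfl⟩ := hsurj f₂
    have := congrFun (hT u v) 0
    rw [areaForm_eq H' D', hf₁, hf₂, hS] at this
    simp at this
    rw [hS, this]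
  · obtain ⟨e₁, he₁⟩ := exists_godelCoframe_eq (H := H) (hM.D_ne_zero _ hpM) ![0, 1, 0, 0]
    obtain ⟨e₂, he₂⟩ := exists_godelCoframe_eq (H := H) (hM.D_ne_zero _ hpM) ![0, 0, 1, 0]
    obtain ⟨e₃, he₃⟩ := exists_godelCoframe_eq (H := H) (hM.D_ne_zero _ hpM) ![0, 0, 0, 1]
    have hg (u v) := h.map_metric p hp u v
    simp only [hN.metric_eq _ (h.mapsTo hp), hM.metric_eq _ hpM] at hg
    -- τ is the factor on ω¹ ∧ ω², and σ the resulting factor on ∂_t, as the torsion takes values in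
    -- the span of ∂_t.
    obtain ⟨τ, hτ⟩ : ∃ τ, τ = areaForm D' (φ p) (fderiv ℝ φ p e₁) (fderiv ℝ φ p e₂) := ⟨_, rfl⟩
    obtain ⟨σ, hσ⟩ : ∃ σ, σ = S' (φ p 3) * τ / S (p 3) := ⟨_, rfl⟩
    have hF₀ : fderiv ℝ φ p (Pi.single 0 1) = σ • (Pi.single 0 1 : CoordSpace) := by
      have := hT e₁ e₂
      rw [← hτ, areaForm_eq H D p, he₁, he₂] at this
      simp only [Matrix.cons_val] at this
      rw [hσ, div_eq_inv_mul, mul_smul, this, smul_smul]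
      simp [hS]
    have hσS : S' (φ p 3) * τ = S (p 3) * σ := by
      rw [hσ]
      field_simp
    have hσ2 : σ ^ 2 = 1 := by
      have := hg (Pi.single 0 1) (Pi.single 0 1)
      simp only [hF₀, godelCoframe_smul, godelCoframe_single_zero] at this
      simp at this
      linarith
    have hσ0 : σ ≠ 0 := by rintro rfl; simp at hσ2
    have hS' : S' (φ p 3) ≠ 0 := by
      intro h0
      rw [h0, zero_mul] at hσS
      exact mul_ne_zero hS hσ0 hσS.symm
    have hτ0 : τ ≠ 0 := by
      rintro rfl
      rw [mul_zero] at hσS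
      exact mul_ne_zero hS hσ0 hσS.symm
    have hA (u v) : areaForm D' (φ p) (fderiv ℝ φ p u) (fderiv ℝ φ p v) = τ * areaForm D p u v := by
      have := congrFun (hT u v) 0
      rw [hF₀] at this
      simp at this
      refine mul_left_cancel₀ hS' ?_
      linear_combination this - areaForm D p u v * hσS
    have hz (u) (hu : godelCoframe H D p u 0 = 0) :
        godelCoframe H' D' (φ p) (fderiv ℝ φ p u) 0 = 0 := by
      have := hg (Pi.single 0 1) u
      simp only [hF₀, godelCoframe_smul, godelCoframe_single_zero, hu] at this
      simpa [hσ0] using this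
    have x0 := hz e₁ (by simp [he₁])
    have y0 := hz e₂ (by simp [he₂])
    have z0 := hz e₃ (by simp [he₃])
    have a31 := hA e₃ e₁
    have a32 := hA e₃ e₂
    have g33 := hg e₃ e₃
    have g31 := hg e₃ e₁
    have g32 := hg e₃ e₂
    have g11 := hg e₁ e₁
    have g12 := hg e₁ e₂
    have g22 := hg e₂ e₂
    simp only [areaForm_eq H D, areaForm_eq H' D', he₁, he₂, he₃, Matrix.cons_val, x0, y0, z0]
      at hτ a31 a32 g33 g31 g32 g11 g12 g22
    generalize godelCoframe H' D' (φ p) (fderiv ℝ φ p e₁) 1 = x1 at *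
    generalize godelCoframe H' D' (φ p) (fderiv ℝ φ p e₁) 2 = x2 at *
    generalize godelCoframe H' D' (φ p) (fderiv ℝ φ p e₁) 3 = x3 at *
    generalize godelCoframe H' D' (φ p) (fderiv ℝ φ p e₂) 1 = y1 at *
    generalize godelCoframe H' D' (φ p) (fderiv ℝ φ p e₂) 2 = y2 at *
    generalize godelCoframe H' D' (φ p) (fderiv ℝ φ p e₂) 3 = y3 at *
    generalize godelCoframe H' D' (φ p) (fderiv ℝ φ p e₃) 1 = z1 at *
    generalize godelCoframe H' D' (φ p) (fderiv ℝ φ p e₃) 2 = z2 at *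
    generalize godelCoframe H' D' (φ p) (fderiv ℝ φ p e₃) 3 = z3 at *
    -- Invariance of ω¹ ∧ ω² up to τ forces the image of e₃ along ∂_z. Orthogonality then puts the
    -- images of e₁ and e₂ in the plane of directions 1 and 2, so τ is the determinant of an
    -- orthogonal 2 × 2 matrix.
    have hz1 : z1 = 0 := by
      refine (mul_eq_zero.1 (show τ * z1 = 0 from ?_)).resolve_left hτ0
      rw [hτ]
      linear_combination x1 * a32 - y1 * a31
    have hz2 : z2 = 0 := by
      refine (mul_eq_zero.1 (show τ * z2 = 0 from ?_)).resolve_left hτ0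
      rw [hτ]
      linear_combination x2 * a32 - y2 * a31
    subst hz1 hz2
    have hz3 : z3 ≠ 0 := by rintro rfl; norm_num at g33
    have hx3 : x3 = 0 := by simpa [hz3] using g31
    have hy3 : y3 = 0 := by simpa [hz3] using g32
    subst hx3 hy3
    have hτ2 : τ ^ 2 = 1 := by
      have n1 : x1 ^ 2 + x2 ^ 2 = 1 := by linarith
      have n2 : y1 ^ 2 + y2 ^ 2 = 1 := by linarith
      have n3 : x1 * y1 + x2 * y2 = 0 := by linarith
      rw [hτ]
      linear_combination (y1 ^ 2 + y2 ^ 2) * n1 + n2 - (x1 * y1 + x2 * y2) * n3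
    refine ⟨?_, fun _ => ⟨σ, τ, hσ2, hτ2, hσS, hF₀, hA⟩⟩
    linear_combination (S (p 3)) ^ 2 * (-hσ2) - (S' (φ p 3) * τ + S (p 3) * σ) * hσS
      + S' (φ p 3) ^ 2 * hτ2

end IsAffineIsometryOn

/-! ### Constancy of the parameters and their invariance. -/

/-- The image is a preconnected set of reals, which is infinite once it has two points. -/
theorem eq_of_continuousOn_of_finite {U : Set CoordSpace} (hU : IsPreconnected U)
    {f : CoordSpace → ℝ} (hf : ContinuousOn f U) {T : Set ℝ} (hT : T.Finite)
    (hfT : Set.MapsTo f U T) {p q : CoordSpace} (hp : p ∈ U) (hq : q ∈ U) : f p = f q := by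
  by_contra hne
  exact (((hU.image f hf).infinite_of_nontrivial
    ⟨f p, ⟨p, hp, rfl⟩, f q, ⟨q, hq, rfl⟩, hne⟩).mono (Set.image_subset_iff.2 hfT)) hT

theorem eq_of_continuousOn_of_sq_eq {U : Set CoordSpace} (hU : IsPreconnected U)
    {f : CoordSpace → ℝ} (hf : ContinuousOn f U) {p q : CoordSpace}
    (h : ∀ r ∈ U, f r ^ 2 = f p ^ 2) (hp : p ∈ U) (hq : q ∈ U) : f q = f p :=
  eq_of_continuousOn_of_finite hU hf (T := {f p, -f p}) (Set.toFinite _)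
    (fun r hr => sq_eq_sq_iff_eq_or_eq_neg.1 (h r hr)) hq hp

theorem finite_setOf_cubic_eq_zero (a b c : ℝ) :
    {x : ℝ | x ^ 3 - a * x ^ 2 + b * x - c = 0}.Finite := by
  open Polynomial in
  have hQ : (X ^ 3 - C a * X ^ 2 + C b * X - C c : ℝ[X]) ≠ 0 := by
    intro h
    have := congrArg (fun p : ℝ[X] => p.coeff 3) h
    simp at this
  refine (Polynomial.finite_setOfPred_isRoot hQ).subset fun x hx => ?_
  simpa [Polynomial.IsRoot] using hx

namespace IsGodelType

variable {M N : RCSpacetime} {H D S H' D' S' : ℝ → ℝ} {m2 w S₀ m2' w' S₀' : ℝ}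

/-- The matrix of the Ricci curvature for constant torsion. -/
theorem ricci_eq_frame (hM : IsGodelType M H D S) (hS : ∀ p ∈ M.carrier, S (p 3) = S₀)
    {p : CoordSpace} (hp : p ∈ M.carrier) {P P₁ l : ℝ} (hP : P = deriv H (p 1) / D (p 1) - S₀)
    (hP₁ : P₁ = (deriv (deriv H) (p 1) * D (p 1) - deriv H (p 1) * deriv D (p 1)) / D (p 1) ^ 2)
    (hl : l = deriv (deriv D) (p 1) / D (p 1) - P * (deriv H (p 1) / D (p 1)) / 2)
    (u v : CoordSpace) :
    M.ricci p u v = ∑ i, ∑ j, godelCoframe H D p u i * frameRicci (P ^ 2 / 2) l (P₁ / 2) i j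
      * godelCoframe H D p v j := by
  rw [hM.ricci_eq hS hp hP hP₁ hl]
  simp [Fin.sum_univ_four, frameRicci]
  ring

/-- A locally homogeneous space-time of Gödel type has constant parameters. -/
theorem exists_hasParameters (hM : IsGodelType M H D S) (hh : LocallyHomogeneous M) :
    ∃ m2 w S₀, HasParameters M H D S m2 w S₀ := by
  obtain ⟨p₀, hp₀⟩ := M.isConnected_carrier.nonempty
  have hc := M.isConnected_carrier.isPreconnected
  have hS (p) (hp : p ∈ M.carrier) : S (p 3) = S (p₀ 3) := by
    refine eq_of_continuousOn_of_sq_eq hc (f := fun p => S (p 3)) hM.smooth_S.comp_coord.continuousOn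
      (fun r hr => ?_) hp₀ hp
    obtain ⟨V, φ, h, hrV, hφ⟩ := hh r hr p₀ hp₀
    simpa [hφ] using (h.torsion_sq_eq hM hM hrV).1
  obtain ⟨S₀, hS₀⟩ : ∃ S₀, S (p₀ 3) = S₀ := ⟨_, rfl⟩
  rw [hS₀] at hS
  let om : CoordSpace → ℝ := fun p => deriv H (p 1) / D (p 1)
  let k : CoordSpace → ℝ := fun p => deriv (deriv D) (p 1) / D (p 1)
  let l : CoordSpace → ℝ := fun p => k p - (om p - S₀) * om p / 2
  let r : CoordSpace → ℝ := fun p =>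
    (deriv (deriv H) (p 1) * D (p 1) - deriv H (p 1) * deriv D (p 1)) / D (p 1) ^ 2 / 2
  have com : ContinuousOn om M.carrier := hM.smooth_deriv_H.comp_coord.continuousOn.div
    hM.smooth_D.comp_coord.continuousOn hM.D_ne_zero
  have ck : ContinuousOn k M.carrier := by
    have := hM.smooth_deriv_D.deriv_of_isOpen (m := ∞) (isOpen_image_apply M.isOpen_carrier 1)
      (by simp)
    exact this.comp_coord.continuousOn.div hM.smooth_D.comp_coord.continuousOn hM.D_ne_zero
  have cl : ContinuousOn l M.carrier :=
    ck.sub (((com.sub continuousOn_const).mul com).div_const 2)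
  have key (p) (hp : p ∈ M.carrier) :
      2 * l p + (om p - S₀) ^ 2 / 2 = 2 * l p₀ + (om p₀ - S₀) ^ 2 / 2 ∧
      l p ^ 2 + 2 * l p * ((om p - S₀) ^ 2 / 2) + r p ^ 2
        = l p₀ ^ 2 + 2 * l p₀ * ((om p₀ - S₀) ^ 2 / 2) + r p₀ ^ 2 ∧
      l p ^ 2 * ((om p - S₀) ^ 2 / 2) + l p * r p ^ 2
        = l p₀ ^ 2 * ((om p₀ - S₀) ^ 2 / 2) + l p₀ * r p₀ ^ 2 := by
    obtain ⟨V, φ, h, hpV, hφ⟩ := hh p hp p₀ hp₀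
    obtain ⟨A, hg, hR⟩ := h.exists_frame_matrix hM hM hpV (hM.ricci_eq_frame hS hp rfl rfl rfl)
      (hM.ricci_eq_frame hS (h.mapsTo hpV) rfl rfl rfl)
    have := frameRicci_invariants hg hR
    rw [hφ] at this
    exact this
  -- l p is a root of a cubic whose coefficients do not depend on p, so it takes finitely many
  -- values. The off-diagonal entry r need not be known to vanish.
  have hl (p) (hp : p ∈ M.carrier) : l p = l p₀ := by
    refine eq_of_continuousOn_of_finite hc cl (finite_setOf_cubic_eq_zero
      (2 * l p₀ + (om p₀ - S₀) ^ 2 / 2)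
      (l p₀ ^ 2 + 2 * l p₀ * ((om p₀ - S₀) ^ 2 / 2) + r p₀ ^ 2)
      (l p₀ ^ 2 * ((om p₀ - S₀) ^ 2 / 2) + l p₀ * r p₀ ^ 2)) (fun q hq => ?_) hp hp₀
    obtain ⟨k1, k2, k3⟩ := key q hq
    rw [Set.mem_ofPred_eq, ← k1, ← k2, ← k3]
    ring
  -- With l constant, the first invariant fixes (H'/D − S₀)², and continuity fixes the sign.
  have hP (p) (hp : p ∈ M.carrier) : om p = om p₀ := by
    refine sub_left_inj.1 (eq_of_continuousOn_of_sq_eq hc (f := fun p => om p - S₀)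
      (com.sub continuousOn_const) (fun q hq => ?_) hp₀ hp)
    have k1 := (key q hq).1
    have := hl q hq
    linarith
  refine ⟨k p₀, om p₀ / 2, S₀, fun p hp => ?_, fun p hp => ?_, hS⟩
  · exact (hP p hp).trans (by ring)
  · have h1 := hl p hp
    simp only [l, hP p hp] at h1
    exact sub_left_inj.1 h1

/-- The parameters are determined by the geometry, up to sign. -/
theorem parameters_eq_of_locallyEquivalentAt (hM : IsGodelType M H D S)
    (hPM : HasParameters M H D S m2 w S₀) (hN : IsGodelType N H' D' S')
    (hPN : HasParameters N H' D' S' m2' w' S₀') {p q : CoordSpace} (hp : p ∈ M.carrier)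
    (h : LocallyEquivalentAt M N p q) :
    m2 = m2' ∧ ((w = w' ∧ S₀ = S₀') ∨ (w = -w' ∧ S₀ = -S₀')) := by
  obtain ⟨V, φ, h, hpV, rfl⟩ := h
  have hφN := h.mapsTo hpV
  -- For constant H'/D the off-diagonal Ricci entry vanishes, so the roots of the cubic are l, l, s.
  have zero {M : RCSpacetime} {H D S : ℝ → ℝ} {m2 w S₀ : ℝ} (hM : IsGodelType M H D S)
      (hPM : HasParameters M H D S m2 w S₀) {p : CoordSpace} (hp : p ∈ M.carrier) :
      0 = (deriv (deriv H) (p 1) * D (p 1) - deriv H (p 1) * deriv D (p 1)) / D (p 1) ^ 2 := by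
    have h1 : deriv H =ᶠ[nhds (p 1)] fun x => 2 * w * D x := by
      refine Filter.eventually_of_mem ((isOpen_image_apply M.isOpen_carrier 1).mem_nhds
        (Set.mem_image_of_mem _ hp)) ?_
      rintro _ ⟨r, hr, rfl⟩
      exact hM.deriv_H_eq hPM hr
    rw [h1.deriv_eq, ((hM.hasDerivAt_D hp).const_mul (2 * w)).deriv, hM.deriv_H_eq hPM hp]
    ring
  obtain ⟨A, hg, hR⟩ := h.exists_frame_matrix hM hN hpV
    (hM.ricci_eq_frame (P := 2 * w - S₀) (l := m2 - (2 * w - S₀) * (2 * w) / 2) hPM.torsion hp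
      (by rw [hPM.rotation p hp]) (zero hM hPM hp)
      (by rw [hPM.rotation p hp, hPM.curvature p hp]))
    (hN.ricci_eq_frame (P := 2 * w' - S₀') (l := m2' - (2 * w' - S₀') * (2 * w') / 2) hPN.torsion
      hφN (by rw [hPN.rotation _ hφN]) (zero hN hPN hφN)
      (by rw [hPN.rotation _ hφN, hPN.curvature _ hφN]))
  have inv := frameRicci_invariants hg hR
  -- Equal cubics have equal roots with multiplicity, and the double root tells l from s.
  have hroots {l s l' s' : ℝ} (h : 2 * l + s = 2 * l' + s' ∧
      l ^ 2 + 2 * l * s + (0 / 2) ^ 2 = l' ^ 2 + 2 * l' * s' + (0 / 2) ^ 2 ∧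
      l ^ 2 * s + l * (0 / 2) ^ 2 = l' ^ 2 * s' + l' * (0 / 2) ^ 2) : l = l' ∧ s = s' := by
    obtain ⟨h1, h2, h3⟩ := h
    have e : (l - l') ^ 2 * (l' - s) = 0 := by
      linear_combination l' ^ 2 * (-h1) + l' * h2 - h3
    have e' : (l - l') ^ 2 * (l - s') = 0 := by
      linear_combination l ^ 2 * h1 - l * h2 + h3
    by_cases hl : l = l'
    · exact ⟨hl, by rw [hl] at h1; linarith⟩
    · have hne : (l - l') ^ 2 ≠ 0 := pow_ne_zero 2 (sub_ne_zero.2 hl)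
      have e1 := (mul_eq_zero.1 e).resolve_left hne
      have e2 := (mul_eq_zero.1 e').resolve_left hne
      exact absurd (by linarith) hl
  obtain ⟨hl, hs⟩ := hroots inv
  have hT {r} (hr : r ∈ V) := h.torsion_sq_eq hM hN hr
  have hsq := (hT hpV).1
  rw [hPM.torsion p hp, hPN.torsion _ hφN] at hsq
  by_cases hS₀ : S₀ = 0
  · have hS₀' : S₀' = 0 := by simpa [hS₀] using hsq.symm
    subst hS₀ hS₀'
    have hw : w ^ 2 = w' ^ 2 := by linarith
    refine ⟨by linarith, ?_⟩
    simpa using sq_eq_sq_iff_eq_or_eq_neg.1 hw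
  · obtain ⟨σ, τ, hσ, hτ, hστ, hF₀, hA⟩ := (hT hpV).2 (by rwa [hPM.torsion p hp])
    rw [hPM.torsion p hp, hPN.torsion _ hφN] at hστ
    have hF (r) (hr : r ∈ V) : fderiv ℝ φ r (Pi.single 0 1) 0 ^ 2 = 1 ∧
        fderiv ℝ φ r (Pi.single 0 1)
          = fderiv ℝ φ r (Pi.single 0 1) 0 • (Pi.single 0 1 : CoordSpace) := by
      obtain ⟨σ, τ, hσ, -, -, hF, -⟩ := (hT hr).2 (by rwa [hPM.torsion r (h.source_subset hr)])
      rw [hF]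
      simp [hσ]
    obtain ⟨ε, hε, hball⟩ := Metric.isOpen_iff.1 h.isOpen_source p hpV
    have hcont : ContinuousOn (fun r => fderiv ℝ φ r (Pi.single 0 1) 0) V := by
      have h1 := (h.smooth.fderiv_of_isOpen (m := ∞) h.isOpen_source (by simp)).continuousOn
      exact (continuous_apply 0).comp_continuousOn (h1.clm_apply continuousOn_const)
    -- The factor of ∂_t is ±1 and continuous, hence locally constant. The second derivative of φ
    -- then kills ∂_t, so φ carries ∇∂_t to σ ∇∂_t, and the sign of 2w − S₀ can be compared with
    -- that of S₀.
    have hloc : (fun r => fderiv ℝ φ r (Pi.single 0 1)) =ᶠ[nhds p]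
        fun _ => fderiv ℝ φ p (Pi.single 0 1) := by
      refine Filter.eventually_of_mem (Metric.ball_mem_nhds p hε) fun r hr => ?_
      simp only
      rw [(hF r (hball hr)).2, (hF p hpV).2]
      congr 1
      exact eq_of_continuousOn_of_sq_eq (convex_ball p ε).isPreconnected (hcont.mono hball)
        (fun q hq => by rw [(hF q (hball hq)).1, (hF p hpV).1]) (Metric.mem_ball_self hε) hr
    have hdd (u) : fderiv ℝ (fderiv ℝ φ) p u (Pi.single 0 1) = 0 := by
      have h1 := (hasFDerivAt_fderiv_of_contDiffOn h.isOpen_source h.smooth hpV).clm_apply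
        (hasFDerivAt_const (Pi.single 0 1 : CoordSpace) p)
      have h2 := congrArg (fun B : CoordSpace →L[ℝ] CoordSpace => B u)
        (h1.unique ((hasFDerivAt_const _ p).congr_of_eventuallyEq hloc))
      simpa using h2
    obtain ⟨e₁, he₁⟩ := exists_godelCoframe_eq (H := H) (hM.D_ne_zero p hp) ![0, 1, 0, 0]
    obtain ⟨e₂, he₂⟩ := exists_godelCoframe_eq (H := H) (hM.D_ne_zero p hp) ![0, 0, 1, 0]
    have hconn := h.map_conn p hpV e₁ (Pi.single 0 1)
    rw [hdd, zero_add, hF₀, map_smul] at hconn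
    have hPP : (2 * w' - S₀') * (σ * τ) = 2 * w - S₀ := by
      have h1 := h.map_metric p hpV (M.conn p e₁ (Pi.single 0 1)) e₂
      rw [← hconn, map_smul, smul_apply, hM.metric_eq_godelMetric hp,
        hN.metric_eq_godelMetric hφN, hM.conn_eq_godelConn hp, hN.conn_eq_godelConn hφN,
        godelMetric_godelConn_single_zero (hM.D_ne_zero p hp),
        godelMetric_godelConn_single_zero (hN.D_ne_zero _ hφN), hA, hPM.rotation p hp,
        hPN.rotation _ hφN, hPM.torsion p hp, hPN.torsion _ hφN, areaForm_eq H D, he₁, he₂] at h1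
      simp at h1
      linarith
    have hSS : S₀' * (σ * τ) = S₀ := by linear_combination σ * hστ + S₀ * hσ
    have hε2 : (σ * τ) ^ 2 = 1 := by rw [mul_pow, hσ, hτ, one_mul]
    generalize σ * τ = ε' at hPP hSS hε2
    have hww : w' * ε' = w := by linarith
    refine ⟨?_, ?_⟩
    · rw [← hSS, ← hww] at hl
      linear_combination hl + (2 * w' - S₀') * w' * hε2
    · rcases sq_eq_sq_iff_eq_or_eq_neg.1 (hε2.trans (one_pow 2).symm) with rfl | rfl
      · exact Or.inl ⟨by linarith, by linarith⟩
      · exact Or.inr ⟨by linarith, by linarith⟩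

end IsGodelType

/-! ### Models for all triads. -/

theorem contDiffAt_connTensor {a : CoordSpace → Fin 7 → ℝ} {p : CoordSpace}
    (h : ∀ i, ContDiffAt ℝ ∞ (fun p => a p i) p) :
    ContDiffAt ℝ ∞ (fun p => connTensor (a p)) p := by
  have e (i) (T : CoordSpace →L[ℝ] CoordSpace →L[ℝ] CoordSpace) :
      ContDiffAt ℝ ∞ (fun p => a p i • T) p := (h i).smul contDiffAt_const
  exact ((((((e 0 _).add (e 1 _)).add (e 2 _)).add (e 3 _)).add (e 4 _)).add (e 5 _)).add (e 6 _)

theorem contDiffAt_godelConn {H D : ℝ → ℝ} (hH : ContDiff ℝ ∞ H) (hD : ContDiff ℝ ∞ D) (s : ℝ)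
    {p : CoordSpace} (hp : D (p 1) ≠ 0) : ContDiffAt ℝ ∞ (godelConn H D s) p := by
  have c {f : ℝ → ℝ} (hf : ContDiff ℝ ∞ f) : ContDiffAt ℝ ∞ (fun p : CoordSpace => f (p 1)) p :=
    (hf.comp (contDiff_apply ℝ ℝ 1)).contDiffAt
  have cH := c hH
  have cD := c hD
  have cH' := c (contDiff_infty_iff_deriv.1 hH).2
  have cD' := c (contDiff_infty_iff_deriv.1 hD).2
  have cQ : ContDiffAt ℝ ∞ (fun p : CoordSpace => (deriv H (p 1) - s * D (p 1)) / 2) p :=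
    (cH'.sub (contDiffAt_const.mul cD)).div_const 2
  have hp2 : D (p 1) ^ 2 ≠ 0 := pow_ne_zero 2 hp
  have cf := (cD'.div cD hp).sub ((cQ.mul cH).div (cD.pow 2) hp2)
  refine contDiffAt_connTensor fun i => ?_
  fin_cases i
  exacts [(cH'.sub cQ).sub (cH.mul cf), cQ.sub (cH.mul cf), (cH.mul cQ).div (cD.pow 2) hp2, cQ,
    ((contDiffAt_const.mul cQ).mul cH).sub (cD.mul cD'), cf, cQ.neg.div (cD.pow 2) hp2]

theorem contDiff_godelMetric {H D : ℝ → ℝ} (hH : ContDiff ℝ ∞ H) (hD : ContDiff ℝ ∞ D) :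
    ContDiff ℝ ∞ (godelMetric H D) := by
  have c {f : ℝ → ℝ} (hf : ContDiff ℝ ∞ f) : ContDiff ℝ ∞ (fun p : CoordSpace => f (p 1)) :=
    hf.comp (contDiff_apply ℝ ℝ 1)
  exact (((contDiff_const.add ((c hH).smul contDiff_const)).add
    ((((c hH).pow 2).sub ((c hD).pow 2)).smul contDiff_const)).sub contDiff_const).sub
    contDiff_const

theorem exists_lorentz_basis {H D : ℝ → ℝ} {p : CoordSpace} (hD : D (p 1) ≠ 0) :
    ∃ e : Module.Basis (Fin 4) ℝ CoordSpace,
      ∀ i j, godelMetric H D p (e i) (e j) = Matrix.diagonal ![(1 : ℝ), -1, -1, -1] i j := by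
  let θ : CoordSpace →ₗ[ℝ] (Fin 4 → ℝ) :=
    { toFun := godelCoframe H D p
      map_add' := fun u v => by
        ext i
        fin_cases i <;> simp [godelCoframe] <;> ring
      map_smul' := fun k u => godelCoframe_smul H D p k u }
  have hsurj : Function.Surjective θ := fun a => exists_godelCoframe_eq hD a
  let e := Module.Basis.ofEquivFun
    (LinearEquiv.ofBijective θ ⟨LinearMap.injective_iff_surjective.2 hsurj, hsurj⟩)
  have he (i) : godelCoframe H D p (e i) = Pi.single i 1 := by
    ext j
    have h := e.equivFun_self i j
    rw [Module.Basis.equivFun_ofEquivFun] at h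
    refine Eq.trans h ?_
    simp [Pi.single_apply, eq_comm]
  refine ⟨e, fun i j => ?_⟩
  rw [godelMetric_apply, he, he]
  fin_cases i <;> fin_cases j <;> simp [Matrix.diagonal]

/-- Smooth functions define a space-time of Gödel type with constant torsion. -/
theorem exists_isGodelType {H D : ℝ → ℝ} (hH : ContDiff ℝ ∞ H) (hD : ContDiff ℝ ∞ D) (s : ℝ)
    {I : Set ℝ} (hI : IsOpen I) (hIc : Convex ℝ I) (hI₀ : I.Nonempty) (hD₀ : ∀ x ∈ I, D x ≠ 0) :
    ∃ M : RCSpacetime, M.carrier = {p | p 1 ∈ I} ∧ IsGodelType M H D fun _ => s := by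
  have dH (x) : HasDerivAt H (deriv H x) x := (hH.differentiable (by simp) x).hasDerivAt
  have dD (x) : HasDerivAt D (deriv D x) x := (hD.differentiable (by simp) x).hasDerivAt
  refine ⟨{ carrier := {p | p 1 ∈ I}
            isOpen_carrier := hI.preimage (continuous_apply 1)
            isConnected_carrier := ⟨?_, ?_⟩
            metric := godelMetric H D
            conn := godelConn H D s
            contDiffOn_metric := (contDiff_godelMetric hH hD).contDiffOn
            contDiffOn_conn := fun p hp =>
              (contDiffAt_godelConn hH hD s (hD₀ _ hp)).contDiffWithinAt
            metric_symm := fun p _ u v => by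
              rw [godelMetric_apply, godelMetric_apply]
              ring
            metric_lorentzian := fun p hp => exists_lorentz_basis (hD₀ _ hp)
            metric_compatible := fun p hp =>
              godelConn_compatible (hD₀ _ hp) (dH _) (dD _) s }, rfl,
    ⟨hH.contDiffOn, hD.contDiffOn, contDiffOn_const, fun p hp => hD₀ _ hp, fun p hp u v =>
      godelMetric_apply H D p u v, fun p hp u v => ?_⟩⟩
  · obtain ⟨x, hx⟩ := hI₀
    exact ⟨fun _ => x, hx⟩
  · exact (hIc.linear_preimage (LinearMap.proj 1 : CoordSpace →ₗ[ℝ] ℝ)).isPreconnected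
  · rw [RCSpacetime.torsion, godelConn_torsion, areaForm_eq H]
    congr 1
    ring

/-- All triads of parameters occur. -/
theorem exists_locallyHomogeneous (m2 w S₀ : ℝ) : ∃ (M : RCSpacetime) (H D S : ℝ → ℝ),
    IsGodelType M H D S ∧ LocallyHomogeneous M ∧ HasParameters M H D S m2 w S₀ := by
  obtain ⟨c, s, v, h⟩ := exists_genTrig (-m2)
  have hev : ∀ᶠ x in nhds 0, c x ≠ 0 :=
    h.smooth_c.continuous.continuousAt.eventually_ne (by rw [h.c_zero]; exact one_ne_zero)
  obtain ⟨δ, hδ, hball⟩ := Metric.eventually_nhds_iff_ball.1 hev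
  -- D = c solves D'' = m2 D and H = 2w s solves H' = 2w D; the slab is where c has no zero.
  -- Homogeneity then follows from local equivalence of the model with itself.
  obtain ⟨M, hMc, hM⟩ := exists_isGodelType (H := fun x => 2 * w * s x)
    (contDiff_const.mul h.smooth_s) h.smooth_c S₀ Metric.isOpen_ball (convex_ball 0 δ)
    ⟨0, Metric.mem_ball_self hδ⟩ hball
  have hP : HasParameters M (fun x => 2 * w * s x) c (fun _ => S₀) m2 w S₀ := by
    refine ⟨fun p hp => ?_, fun p hp => ?_, fun _ _ => rfl⟩
    · rw [((h.deriv_s _).const_mul (2 * w)).deriv, mul_div_cancel_right₀ _ (hM.D_ne_zero p hp)]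
    · have : deriv c = fun x => m2 * s x := funext fun x => by rw [(h.deriv_c x).deriv]; ring
      rw [this, ((h.deriv_s _).const_mul m2).deriv, mul_div_cancel_right₀ _ (hM.D_ne_zero p hp)]
  exact ⟨M, _, c, _, hM, fun p hp q hq => hM.locallyEquivalentAt (σ := 1) (by norm_num) hP hM
    (by simpa using hP) hp hq, hP⟩

/-! ### Assembly. -/

theorem theorem2 :
    -- the parameters exist, and there is a five-dimensional group of affine-isometric motions
    (∀ (M : RCSpacetime) (H D S : ℝ → ℝ), IsGodelType M H D S → LocallyHomogeneous M →
      ∃ m2 w S₀ : ℝ, HasParameters M H D S m2 w S₀ ∧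
        ∃ L : Submodule ℝ (CoordSpace → CoordSpace), IsMotionGroupAlgebra M 5 L ∧
          (∀ p ∈ M.carrier, ∀ v : CoordSpace, ∃ X ∈ L, X p = v) ∧
          (S₀ ≠ 0 → ∀ X, IsMotionGenerator M X → X ∈ L)) ∧
    -- identical triads specify locally equivalent manifolds
    (∀ (M N : RCSpacetime) (H D S H' D' S' : ℝ → ℝ) (m2 w S₀ : ℝ),
      IsGodelType M H D S → LocallyHomogeneous M → HasParameters M H D S m2 w S₀ →
      IsGodelType N H' D' S' → LocallyHomogeneous N → HasParameters N H' D' S' m2 w S₀ →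
      ∀ p ∈ M.carrier, ∀ q ∈ N.carrier, LocallyEquivalentAt M N p q) ∧
    -- the parameters are invariants, `(w, S₀)` up to a simultaneous change of sign
    (∀ (M N : RCSpacetime) (H D S H' D' S' : ℝ → ℝ) (m2 w S₀ m2' w' S₀' : ℝ),
      IsGodelType M H D S → LocallyHomogeneous M → HasParameters M H D S m2 w S₀ →
      IsGodelType N H' D' S' → LocallyHomogeneous N → HasParameters N H' D' S' m2' w' S₀' →
      ((∃ p ∈ M.carrier, ∃ q ∈ N.carrier, LocallyEquivalentAt M N p q) ↔
        m2 = m2' ∧ ((w = w' ∧ S₀ = S₀') ∨ (w = -w' ∧ S₀ = -S₀')))) ∧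
    -- the parameters are independent: all triads occur
    (∀ m2 w S₀ : ℝ, ∃ (M : RCSpacetime) (H D S : ℝ → ℝ),
      IsGodelType M H D S ∧ LocallyHomogeneous M ∧ HasParameters M H D S m2 w S₀) := by
  refine ⟨fun M H D S hM hh => ?_, fun M N H D S H' D' S' m2 w S₀ hM _ hPM hN _ hPN p hp q hq => ?_,
    fun M N H D S H' D' S' m2 w S₀ m2' w' S₀' hM _ hPM hN _ hPN => ⟨?_, ?_⟩,
    exists_locallyHomogeneous⟩
  · obtain ⟨m2, w, S₀, hP⟩ := hM.exists_hasParameters hh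
    refine ⟨m2, w, S₀, hP, hM.coframeKillingAlgebra, hM.isMotionGroupAlgebra hP,
      fun p hp v => ?_, fun hS₀ X hX => hM.isCoframeKilling_of_isMotionGenerator hP.torsion hS₀ hX⟩
    obtain ⟨X, hX, hXv, -⟩ := hM.exists_isCoframeKilling hP hp v 0
    exact ⟨X, hX, hXv⟩
  · exact hM.locallyEquivalentAt (σ := 1) (by norm_num) hPM hN (by simpa using hPN) hp hq
  · rintro ⟨p, hp, q, -, h⟩
    exact hM.parameters_eq_of_locallyEquivalentAt hPM hN hPN hp h
  · obtain ⟨p, hp⟩ := M.isConnected_carrier.nonempty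
    obtain ⟨q, hq⟩ := N.isConnected_carrier.nonempty
    rintro ⟨rfl, ⟨rfl, rfl⟩ | ⟨rfl, rfl⟩⟩
    · exact ⟨p, hp, q, hq,
        hM.locallyEquivalentAt (σ := 1) (by norm_num) hPM hN (by simpa using hPN) hp hq⟩
    · exact ⟨p, hp, q, hq,
        hM.locallyEquivalentAt (σ := -1) (by norm_num) hPM hN (by simpa using hPN) hp hq⟩
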